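/- All graphs are finite and simple. For a graph $G$ and $X\subseteq V(G)$, let $\operatorname{cutrk}_G(X)$ be the rank over $GF(2)$ of the submatrix $A_G[X,V(G)\setminus X]$ of the adjacency matrix of $G$. The linear rank-width of $G$ is the minimum, over all linear orderings $x_1,\dots,x_n$ of $V(G)$, of $\max_{1\le i\le n}\operatorname{cutrk}_G(\{x_1,\dots,x_i\})$. A graph is distance-hereditary if all its induced paths are isometric. A graph $G$ is an induced-subgraph obstruction for linear rank-width $1$ if it has linear rank-width $2$ and every proper induced subgraph of $G$ has linear rank-width at most $1$. A split of a connected graph $G$ is a bipartition $\{X,Y\}$ of $V(G)$ with $|X|,|Y|\ge 2$ and $\operatorname{cutrk}_G(X)=1$. Given a split $\{X,Y\}$, let $G^X$ be obtained from $G[X]$ by adding a new vertex adjacent to exactly those vertices of $X$ that have a neighbour in $Y$, and let $G^Y$ be defined symmetrically; the two new vertices are called neighbour markers. A decomposition of $G$ is a collection of graphs (blocks) obtained from $\{G\}$ by repeatedly replacing a block by the two graphs given by a split of it; two blocks containing neighbour markers of each other are called neighbours. The decomposition is canonical if (i) every block has no split, or is a clique with at least three vertices, or is a star with at least three vertices;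 (ii) no two clique blocks are neighbours; (iii) whenever two star blocks are neighbours, their neighbour markers are either both centres or both not centres. Every connected graph has a canonical decomposition, unique up to isomorphism; its split decomposition tree has the blocks as nodes, two nodes being adjacent when the blocks are neighbours. A path may consist of a single node. Proposition. Let $G$ be a distance-hereditary graph. Then $G$ is an induced-subgraph obstruction for linear rank-width $1$ if and only if both of the following hold: (1) $G$ is connected and its split decomposition tree is a star with three leaves (that is, isomorphic to $K_{1,3}$); (2) for every proper induced subgraph $H$ of $G$, every connected component of $H$ has a path as split decomposition tree. -/

import Mathlib

universe u

namespace SplitTree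

/-! ### Cut-rank and linear rank-width -/

open Classical in
/-- The cut-rank of a set `X` of vertices of `G`: the rank over `GF(2)` of the submatrix
`A_G[X, V \ X]` of the adjacency matrix of `G`. -/
noncomputable def cutRank {V : Type u} (G : SimpleGraph V) (X : Set V) : ℕ∞ :=
  ((G.adjMatrix (ZMod 2)).submatrix
    ((↑) : {x : V // x ∈ X} → V) ((↑) : {y : V // y ∉ X} → V)).eRank

/-- The linear rank-width of a (finite) graph `G`: the minimum over all linear orderings
`x_1, …, x_n` of the vertices of the maximum over `i` of the cut-rank of `{x_1, …, x_i}`.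
An ordering is given by the bijection that sends each vertex to its position. -/
noncomputable def linearRankWidth {V : Type u} (G : SimpleGraph V) : ℕ∞ :=
  ⨅ σ : V ≃ Fin (Nat.card V), ⨆ i : Fin (Nat.card V), cutRank G {v | σ v ≤ i}

/-- `G` is an induced-subgraph obstruction for linear rank-width `1`: it has linear rank-width `2`
and every proper induced subgraph of it has linear rank-width at most `1`. -/
def IsObstruction {V : Type u} (G : SimpleGraph V) : Prop :=
  linearRankWidth G = 2 ∧ ∀ S : Set V, S ≠ Set.univ → linearRankWidth (G.induce S) ≤ 1

/-- `G` is distance-hereditary: every induced path of `G` is isometric. -/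
def IsDistanceHereditary {V : Type u} (G : SimpleGraph V) : Prop :=
  ∀ (n : ℕ) (f : SimpleGraph.pathGraph n ↪g G) (i j : Fin n),
    G.dist (f i) (f j) = (SimpleGraph.pathGraph n).dist i j

/-! ### Splits and decompositions -/

/-- The bipartition `{X, V \ X}` of the vertex set is a split of `G`. -/
def IsSplit {V : Type u} (G : SimpleGraph V) (X : Set V) : Prop :=
  2 ≤ X.encard ∧ 2 ≤ Xᶜ.encard ∧ cutRank G X = 1

/-- The graph `G^X`: the subgraph of `G` induced by `X` with one new vertex, the marker `none`,
adjacent to those vertices of `X` that have a neighbour outside `X`. -/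
def splitPart {V : Type u} (G : SimpleGraph V) (X : Set V) :
    SimpleGraph (Option {x : V // x ∈ X}) where
  Adj
    | some x, some y => G.Adj x y
    | some x, none => ∃ z, z ∉ X ∧ G.Adj x z
    | none, some x => ∃ z, z ∉ X ∧ G.Adj x z
    | none, none => False
  symm := ⟨by rintro (_ | x) (_ | y) h <;> first | exact h | exact G.adj_symm h⟩
  loopless := ⟨by rintro (_ | x) h <;> first | exact h | exact G.irrefl h⟩

/-- The decompositions of `G`, recorded together with the splits that produce them. Either `G` is
not split at all, and is the only block, or `G` has a split `{X, V \ X}`, and is replaced by `G^X`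
and `G^(V \ X)`, whose new vertices are neighbour markers and each of which is decomposed
further. -/
inductive Decomposition : {V : Type u} → SimpleGraph V → Type (u + 1)
  | single {V : Type u} (G : SimpleGraph V) : Decomposition G
  | split {V : Type u} (G : SimpleGraph V) (X : Set V) (hX : IsSplit G X)
      (D₁ : Decomposition (splitPart G X)) (D₂ : Decomposition (splitPart G Xᶜ)) :
      Decomposition G

namespace Decomposition

/-- The index type of the blocks of a decomposition. -/
@[reducible] def Block {V : Type u} {G : SimpleGraph V} : Decomposition G → Type
  | single _ => Unit
  | split _ _ _ D₁ D₂ => D₁.Block ⊕ D₂.Block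

/-- The vertices of all the blocks: the vertices of `G` and the markers. -/
@[reducible] def Vertex {V : Type u} {G : SimpleGraph V} : Decomposition G → Type u
  | single (V := V) _ => V
  | split _ _ _ D₁ D₂ => D₁.Vertex ⊕ D₂.Vertex

open Classical in
/-- The vertices of `G` among the vertices of the blocks. -/
noncomputable def vertex {V : Type u} {G : SimpleGraph V} :
    (D : Decomposition G) → V → D.Vertex
  | single _, v => v
  | split _ X _ D₁ D₂, v =>
      if h : v ∈ X then Sum.inl (D₁.vertex (some ⟨v, h⟩)) else Sum.inr (D₂.vertex (some ⟨v, h⟩))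

/-- The block in which a vertex lies. -/
def blockOf {V : Type u} {G : SimpleGraph V} : (D : Decomposition G) → D.Vertex → D.Block
  | single _, _ => ()
  | split _ _ _ D₁ D₂, w => Sum.map D₁.blockOf D₂.blockOf w

/-- The graph formed by the solid edges, that is, the disjoint union of the blocks. -/
def solid {V : Type u} {G : SimpleGraph V} : (D : Decomposition G) → SimpleGraph D.Vertex
  | single G => G
  | split _ _ _ D₁ D₂ => SimpleGraph.sum D₁.solid D₂.solid

/-- The graph formed by the marked edges, which join the pairs of neighbour markers. -/
noncomputable def marked {V : Type u} {G : SimpleGraph V} :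
    (D : Decomposition G) → SimpleGraph D.Vertex
  | single _ => ⊥
  | split _ _ _ D₁ D₂ =>
      SimpleGraph.sum D₁.marked D₂.marked ⊔
        SimpleGraph.edge (Sum.inl (D₁.vertex none)) (Sum.inr (D₂.vertex none))

/-- The block with index `b`, as a graph. -/
def block {V : Type u} {G : SimpleGraph V} (D : Decomposition G) (b : D.Block) :
    SimpleGraph {w : D.Vertex // D.blockOf w = b} :=
  D.solid.comap (↑)

/-- The tree of a decomposition: each block is contracted to one node, and two nodes are adjacent
if a marked edge joins the two blocks. -/
def tree {V : Type u} {G : SimpleGraph V} (D : Decomposition G) : SimpleGraph D.Block where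
  Adj b c := b ≠ c ∧ ∃ v w, D.marked.Adj v w ∧ D.blockOf v = b ∧ D.blockOf w = c
  symm := ⟨by rintro b c ⟨h, v, w, hvw, hv, hw⟩; exact ⟨h.symm, w, v, hvw.symm, hw, hv⟩⟩
  loopless := ⟨fun _ h => h.1 rfl⟩

end Decomposition

/-- A graph without splits. -/
def IsPrime {V : Type u} (G : SimpleGraph V) : Prop :=
  ∀ X : Set V, ¬ IsSplit G X

/-- A clique with at least three vertices. -/
def IsClique {V : Type u} (G : SimpleGraph V) : Prop :=
  3 ≤ ENat.card V ∧ ∀ x y, G.Adj x y ↔ x ≠ y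

/-- A star with at least three vertices and centre `c`. -/
def IsStarWithCentre {V : Type u} (G : SimpleGraph V) (c : V) : Prop :=
  3 ≤ ENat.card V ∧ ∀ x y, G.Adj x y ↔ x ≠ y ∧ (x = c ∨ y = c)

/-- A decomposition is canonical if each block is prime, a clique or a star, no two clique blocks
are neighbours, and whenever two star blocks are neighbours, their neighbour markers are either
both centres or both not centres. -/
structure Decomposition.IsCanonical {V : Type u} {G : SimpleGraph V} (D : Decomposition G) :
    Prop where
  blocks : ∀ b : D.Block,
    IsPrime (D.block b) ∨ IsClique (D.block b) ∨ ∃ c, IsStarWithCentre (D.block b) c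
  cliques : ∀ v w : D.Vertex, D.marked.Adj v w →
    ¬ (IsClique (D.block (D.blockOf v)) ∧ IsClique (D.block (D.blockOf w)))
  stars : ∀ v w : D.Vertex, D.marked.Adj v w → ∀ c d,
    IsStarWithCentre (D.block (D.blockOf v)) c → IsStarWithCentre (D.block (D.blockOf w)) d →
      (c = ⟨v, rfl⟩ ↔ d = ⟨w, rfl⟩)

/-- `G` is connected, and `T` is (up to isomorphism) the split decomposition tree of `G`, that is,
the tree of the canonical decomposition of `G`. -/
def IsSplitDecompositionTree {V : Type u} {B : Type} (G : SimpleGraph V) (T : SimpleGraph B) :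
    Prop :=
  G.Connected ∧ ∃ D : Decomposition G, D.IsCanonical ∧ Nonempty (D.tree ≃g T)

/-- The split decomposition tree of `G` is a path (possibly with a single node). -/
def HasPathAsSplitTree {V : Type u} (G : SimpleGraph V) : Prop :=
  ∃ n : ℕ, IsSplitDecompositionTree G (SimpleGraph.pathGraph (n + 1))

/-- The split decomposition tree of `G` is a star with three leaves. -/
def HasThreeLeafStarAsSplitTree {V : Type u} (G : SimpleGraph V) : Prop :=
  IsSplitDecompositionTree G (completeBipartiteGraph (Fin 1) (Fin 3))

end SplitTree

namespace SplitTree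
open SimpleGraph

/-! ### Cut-rank at most one -/

/-- The edges between `X` and its complement form a complete bipartite graph. -/
def CutComplete {V : Type*} (G : SimpleGraph V) (X : Set V) : Prop :=
  ∀ ⦃x₁⦄, x₁ ∈ X → ∀ ⦃x₂⦄, x₂ ∈ X → ∀ ⦃y₁⦄, y₁ ∉ X → ∀ ⦃y₂⦄, y₂ ∉ X →
    G.Adj x₁ y₁ → G.Adj x₂ y₂ → G.Adj x₁ y₂

lemma eRank_eq_rank {m n : Type*} [Fintype n] (A : Matrix m n (ZMod 2)) :
    A.eRank = (A.rank : ℕ∞) := by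
  rw [← Matrix.eRank_toNat_eq_rank, ENat.natCast_toNat]
  have h := A.eRank_le_card_width
  intro h'
  rw [h', top_le_iff] at h
  exact absurd h (by simp)

lemma cutRank_le_of_eq {V : Type u} [Finite V] (G : SimpleGraph V) (X : Set V) (k : ℕ)
    (h : ∀ [Fintype {y : V // y ∉ X}] [DecidableRel G.Adj], ((G.adjMatrix (ZMod 2)).submatrix
      ((↑) : {x : V // x ∈ X} → V) ((↑) : {y : V // y ∉ X} → V)).rank ≤ k) :
    cutRank G X ≤ k := by
  classical
  let := Fintype.ofFinite {y : V // y ∉ X}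
  unfold cutRank
  rw [eRank_eq_rank]
  exact_mod_cast h

lemma cutComplete_of_cutRank_le {V : Type u} [Finite V] {G : SimpleGraph V} {X : Set V}
    (h : cutRank G X ≤ 1) : CutComplete G X := by
  classical
  intro x₁ h₁ x₂ h₂ y₁ k₁ y₂ k₂ a₁ a₂
  by_contra a₃
  have key := Matrix.eRank_submatrix_le ((G.adjMatrix (ZMod 2)).submatrix
    ((↑) : {x : V // x ∈ X} → V) ((↑) : {y : V // y ∉ X} → V))
    ![⟨x₁, h₁⟩, ⟨x₂, h₂⟩] ![⟨y₁, k₁⟩, ⟨y₂, k₂⟩]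
  have h2 := key.trans (by simpa [cutRank] using h)
  rw [eRank_eq_rank, Matrix.rank_of_isUnit] at h2
  · norm_num at h2
  · rw [Matrix.isUnit_iff_isUnit_det, Matrix.det_fin_two]
    simp [a₁, a₂, a₃]

lemma cutRank_le_of_cutComplete {V : Type u} [Finite V] {G : SimpleGraph V} {X : Set V}
    (h : CutComplete G X) : cutRank G X ≤ 1 := by
  classical
  refine cutRank_le_of_eq G X 1 ?_
  intro _ _
  refine le_trans (le_of_eq ?_) (Matrix.rank_vecMulVec_le
    (fun x : {x : V // x ∈ X} => if ∃ y, y ∉ X ∧ G.Adj x y then (1 : ZMod 2) else 0)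
    (fun y : {y : V // y ∉ X} => if ∃ x, x ∈ X ∧ G.Adj x y then (1 : ZMod 2) else 0))
  congr 1
  ext ⟨x, hx⟩ ⟨y, hy⟩
  simp only [Matrix.submatrix_apply, adjMatrix_apply, Matrix.vecMulVec_apply]
  by_cases hxy : G.Adj x y
  · rw [if_pos hxy, if_pos ⟨y, hy, hxy⟩, if_pos ⟨x, hx, hxy⟩, one_mul]
  · rw [if_neg hxy]
    by_cases h1 : ∃ y, y ∉ X ∧ G.Adj x y
    · rw [if_neg (c := ∃ x, x ∈ X ∧ G.Adj x y), mul_zero]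
      rintro ⟨x', hx', h2⟩
      obtain ⟨y', hy', h1⟩ := h1
      exact hxy (h hx hx' hy' hy h1 h2)
    · rw [if_neg h1, zero_mul]

lemma cutRank_le_one_iff {V : Type u} [Finite V] {G : SimpleGraph V} {X : Set V} :
    cutRank G X ≤ 1 ↔ CutComplete G X :=
  ⟨cutComplete_of_cutRank_le, cutRank_le_of_cutComplete⟩

lemma one_le_cutRank_iff {V : Type u} [Finite V] {G : SimpleGraph V} {X : Set V} :
    1 ≤ cutRank G X ↔ ∃ x ∈ X, ∃ y ∉ X, G.Adj x y := by
  classical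
  constructor
  · intro h
    by_contra! h'
    have : cutRank G X = 0 := by
      unfold cutRank
      convert Matrix.eRank_zero
      · ext ⟨x, hx⟩ ⟨y, hy⟩
        simp [h' x hx y hy]
      · infer_instance
    rw [this] at h
    simp at h
  · rintro ⟨x, hx, y, hy, h⟩
    have key := Matrix.eRank_submatrix_le ((G.adjMatrix (ZMod 2)).submatrix
      ((↑) : {x : V // x ∈ X} → V) ((↑) : {y : V // y ∉ X} → V))
      ![⟨x, hx⟩] ![⟨y, hy⟩]
    rw [eRank_eq_rank, Matrix.rank_of_isUnit] at key
    · simpa [cutRank] using key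
    · rw [Matrix.isUnit_iff_isUnit_det, Matrix.det_fin_one]
      simp [h]

lemma isSplit_iff {V : Type u} [Finite V] {G : SimpleGraph V} {X : Set V} :
    IsSplit G X ↔ X.Nontrivial ∧ Xᶜ.Nontrivial ∧ CutComplete G X ∧
      ∃ x ∈ X, ∃ y ∉ X, G.Adj x y := by
  have h2 : ∀ Y : Set V, 2 ≤ Y.encard ↔ Y.Nontrivial := fun Y => by
    rw [← Set.one_lt_encard_iff_nontrivial, ← one_add_one_eq_two]
    exact ENat.add_one_le_iff (by simp)
  rw [IsSplit, h2, h2, ← cutRank_le_one_iff, ← one_le_cutRank_iff, le_antisymm_iff]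

lemma CutComplete.compl {V : Type*} {G : SimpleGraph V} {X : Set V} (h : CutComplete G X) :
    CutComplete G Xᶜ := by
  intro x₁ h₁ x₂ h₂ y₁ k₁ y₂ k₂ a₁ a₂
  rw [Set.notMem_compl_iff] at k₁ k₂
  exact (h k₂ k₁ h₂ h₁ a₂.symm a₁.symm).symm

lemma IsSplit.compl {V : Type u} [Finite V] {G : SimpleGraph V} {X : Set V} (h : IsSplit G X) :
    IsSplit G Xᶜ := by
  rw [isSplit_iff] at *
  obtain ⟨h1, h2, h3, x, hx, y, hy, h⟩ := h
  exact ⟨h2, by rwa [compl_compl], h3.compl, y, hy, x, by simpa using hx, h.symm⟩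

/-! ### Linear rank-width at most one -/

/-- `σ` is a linear ordering of the vertices all of whose cuts have rank at most one. -/
def IsLinearLayout {V L : Type*} [LinearOrder L] (G : SimpleGraph V) (σ : V → L) : Prop :=
  Function.Injective σ ∧ ∀ x₁ x₂ y₁ y₂, σ x₁ < σ y₁ → σ x₁ < σ y₂ → σ x₂ < σ y₁ → σ x₂ < σ y₂ →
    G.Adj x₁ y₁ → G.Adj x₂ y₂ → G.Adj x₁ y₂

/-- `G` has a linear ordering all of whose cuts have rank at most one. -/
def HasLinearLayout {V : Type u} (G : SimpleGraph V) : Prop :=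
  ∃ (L : Type) (_ : LinearOrder L) (σ : V → L), IsLinearLayout G σ

lemma linearRankWidth_le_iff {V : Type u} [Finite V] {G : SimpleGraph V} {k : ℕ} :
    linearRankWidth G ≤ k ↔
      ∃ σ : V ≃ Fin (Nat.card V), ∀ i, cutRank G {v | σ v ≤ i} ≤ k := by
  have : linearRankWidth G ≤ k ↔ linearRankWidth G < (k + 1 : ℕ) := by
    rw [Nat.cast_add, Nat.cast_one]
    exact (ENat.lt_add_one_iff (by simp)).symm
  rw [this, linearRankWidth, iInf_lt_iff]
  refine exists_congr fun σ => ?_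
  rw [Nat.cast_add, Nat.cast_one, ENat.lt_add_one_iff (by simp), iSup_le_iff]

lemma exists_equiv_fin {V L : Type*} [Finite V] [LinearOrder L] (σ : V → L)
    (hσ : Function.Injective σ) :
    ∃ e : V ≃ Fin (Nat.card V), ∀ v w, e v ≤ e w ↔ σ v ≤ σ w := by
  let : LinearOrder V := LinearOrder.lift' σ hσ
  let := Fintype.ofFinite V
  refine ⟨(Fintype.orderIsoFinOfCardEq V Nat.card_eq_fintype_card.symm).symm.toEquiv, ?_⟩
  intro v w
  exact (Fintype.orderIsoFinOfCardEq V Nat.card_eq_fintype_card.symm).symm.le_iff_le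

lemma linearRankWidth_le_one_iff {V : Type u} [Finite V] {G : SimpleGraph V} :
    linearRankWidth G ≤ 1 ↔ HasLinearLayout G := by
  have h1 := linearRankWidth_le_iff (G := G) (k := 1)
  rw [Nat.cast_one] at h1
  rw [h1]
  constructor
  · rintro ⟨σ, h⟩
    refine ⟨_, inferInstance, σ, σ.injective, ?_⟩
    intro x₁ x₂ y₁ y₂ h₁₁ h₁₂ h₂₁ h₂₂ a₁ a₂
    have := cutRank_le_one_iff.1 (h (max (σ x₁) (σ x₂)))
    exact this (x₁ := x₁) (x₂ := x₂) (y₁ := y₁) (y₂ := y₂) (by simp) (by simp)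
      (by simp [h₁₁, h₂₁]) (by simp [h₁₂, h₂₂]) a₁ a₂
  · rintro ⟨L, _, σ, hσ, h⟩
    obtain ⟨e, he⟩ := exists_equiv_fin σ hσ
    refine ⟨e, fun i => cutRank_le_one_iff.2 ?_⟩
    intro x₁ h₁ x₂ h₂ y₁ k₁ y₂ k₂
    have key : ∀ x y, e x ≤ i → ¬ e y ≤ i → σ x < σ y := fun x y hx hy => by
      rw [← not_le, ← he]
      exact fun h => hy (h.trans hx)
    exact h _ _ _ _ (key _ _ h₁ k₁) (key _ _ h₁ k₂) (key _ _ h₂ k₁) (key _ _ h₂ k₂)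

lemma HasLinearLayout.of_embedding {V W : Type u} {G : SimpleGraph V} {H : SimpleGraph W}
    (h : HasLinearLayout G) (f : H ↪g G) : HasLinearLayout H := by
  obtain ⟨L, _, σ, hσ, h⟩ := h
  refine ⟨L, inferInstance, fun w => σ (f w), hσ.comp f.injective, ?_⟩
  intro x₁ x₂ y₁ y₂ h₁₁ h₁₂ h₂₁ h₂₂ a₁ a₂
  exact f.map_adj_iff.1 (h _ _ _ _ h₁₁ h₁₂ h₂₁ h₂₂ (f.map_adj_iff.2 a₁) (f.map_adj_iff.2 a₂))

lemma hasLinearLayout_of_components {V : Type u} [Finite V] {G : SimpleGraph V}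
    (h : ∀ C : G.ConnectedComponent, HasLinearLayout C.toSimpleGraph) : HasLinearLayout G := by
  have h' : ∀ C : G.ConnectedComponent, ∃ e : C.supp ≃ Fin (Nat.card C.supp),
      IsLinearLayout C.toSimpleGraph e := fun C => by
    obtain ⟨L, _, σ, hσ, h⟩ := h C
    obtain ⟨e, he⟩ := exists_equiv_fin σ hσ
    have hlt : ∀ v w, e v < e w ↔ σ v < σ w := fun v w => by
      rw [← not_le, ← not_le, he]
    refine ⟨e, e.injective, ?_⟩
    intro x₁ x₂ y₁ y₂
    rw [hlt, hlt, hlt, hlt]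
    exact h x₁ x₂ y₁ y₂
  choose e he using h'
  obtain ⟨n, ⟨c⟩⟩ := Finite.exists_equiv_fin G.ConnectedComponent
  let m : ∀ v : V, (G.connectedComponentMk v).supp := fun v => ⟨v, rfl⟩
  let σ : V → ℕ ×ₗ ℕ := fun v => toLex ((c (G.connectedComponentMk v) : ℕ), (e _ (m v) : ℕ))
  have hσ : ∀ v w, σ v < σ w ↔ c (G.connectedComponentMk v) < c (G.connectedComponentMk w) ∨
      c (G.connectedComponentMk v) = c (G.connectedComponentMk w) ∧
        (e _ (m v) : ℕ) < (e _ (m w) : ℕ) := by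
    intro v w
    simp only [σ, Prod.Lex.toLex_lt_toLex, Fin.lt_def, Fin.ext_iff]
  have key : ∀ C : G.ConnectedComponent, ∀ v (hv : v ∈ C.supp),
      (e _ (m v) : ℕ) = e C ⟨v, hv⟩ := by
    rintro C v rfl
    rfl
  refine ⟨_, inferInstance, σ, ?_, ?_⟩
  · intro v w hvw
    have h1 : ((c (G.connectedComponentMk v) : ℕ), (e _ (m v) : ℕ)) =
        ((c (G.connectedComponentMk w) : ℕ), (e _ (m w) : ℕ)) := toLex.injective hvw
    rw [Prod.mk.injEq, Fin.val_inj, c.injective.eq_iff] at h1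
    obtain ⟨h1, h2⟩ := h1
    rw [key _ v h1, Fin.val_inj, (e _).injective.eq_iff] at h2
    exact congrArg Subtype.val h2
  · intro x₁ x₂ y₁ y₂
    rw [hσ, hσ, hσ, hσ]
    intro h₁₁ h₁₂ h₂₁ h₂₂ a₁ a₂
    have c₁ := SimpleGraph.ConnectedComponent.connectedComponentMk_eq_of_adj a₁
    have c₂ := SimpleGraph.ConnectedComponent.connectedComponentMk_eq_of_adj a₂
    simp only [← c₁] at h₁₁ h₂₁
    simp only [← c₂] at h₁₂ h₂₂
    have c₃ : G.connectedComponentMk x₁ = G.connectedComponentMk x₂ := by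
      apply c.injective
      simp only [lt_irrefl, false_or] at h₁₁ h₂₂
      rcases h₁₂ with h | h
      · rcases h₂₁ with h' | h'
        · exact absurd h h'.asymm
        · exact h'.1.symm
      · exact h.1
    rw [c₃] at c₁
    simp only [c₃, lt_irrefl, false_or, true_and] at h₁₁ h₁₂ h₂₁ h₂₂
    rw [key _ x₁ c₃] at h₁₁ h₁₂
    rw [key _ y₁ c₁.symm] at h₁₁ h₂₁
    rw [key _ y₂ c₂.symm] at h₁₂ h₂₂
    exact (he _).2 _ _ _ _ (Fin.lt_def.2 h₁₁) (Fin.lt_def.2 h₁₂) (Fin.lt_def.2 h₂₁)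
      (Fin.lt_def.2 h₂₂) a₁ a₂

/-- Adding a vertex raises the linear rank-width from at most one to at most two. -/
lemma linearRankWidth_le_two {V : Type u} [Finite V] {G : SimpleGraph V} (a : V)
    (h : HasLinearLayout (G.induce {a}ᶜ)) : linearRankWidth G ≤ 2 := by
  classical
  obtain ⟨L, _, σ, hσ, h⟩ := h
  let τ : V → WithBot L := fun v => if hv : v = a then ⊥ else (σ ⟨v, hv⟩ : L)
  have hτ : Function.Injective τ := by
    intro v w
    by_cases hv : v = a <;> by_cases hw : w = a <;> simp [τ, hv, hw, hσ.eq_iff]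
    exact congrArg Subtype.val
  obtain ⟨e, he⟩ := exists_equiv_fin τ hτ
  have h2 := linearRankWidth_le_iff (G := G) (k := 2)
  rw [Nat.cast_ofNat] at h2
  refine h2.2 ⟨e, fun i => ?_⟩
  set X : Set V := {v | e v ≤ i} with hX
  refine cutRank_le_of_eq G X 2 ?_
  intro _ _
  have key : ∀ x y (hx : x ≠ a) (hy : y ≠ a), x ∈ X → y ∉ X → σ ⟨x, hx⟩ < σ ⟨y, hy⟩ := by
    intro x y hx hy h1 h2
    have : ¬ τ y ≤ τ x := by
      rw [← he]
      exact fun h => h2 (h.trans h1)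
    simpa [τ, hx, hy] using this
  have hya : X.Nonempty → ∀ y, y ∉ X → y ≠ a := by
    rintro ⟨x, hx⟩ y hy rfl
    apply hy
    have : τ y ≤ τ x := by simp [τ]
    rw [← he] at this
    exact this.trans hx
  have hdec : (G.adjMatrix (ZMod 2)).submatrix ((↑) : {x : V // x ∈ X} → V)
      ((↑) : {y : V // y ∉ X} → V) =
      (Matrix.of fun (x : {x : V // x ∈ X}) => ![if x.1 = a then (1 : ZMod 2) else 0,
          if x.1 ≠ a ∧ ∃ y, y ∉ X ∧ G.Adj x y then (1 : ZMod 2) else 0]) *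
      (Matrix.of ![fun y : {y : V // y ∉ X} => if G.Adj a y then (1 : ZMod 2) else 0,
        fun y : {y : V // y ∉ X} =>
          if ∃ x, x ∈ X ∧ x ≠ a ∧ G.Adj x y then (1 : ZMod 2) else 0]) := by
    ext ⟨x, hx⟩ ⟨y, hy⟩
    simp only [Matrix.submatrix_apply, adjMatrix_apply, Matrix.mul_apply, Fin.sum_univ_two,
      Matrix.of_apply, Matrix.cons_val_zero, Matrix.cons_val_one]
    by_cases hxa : x = a
    · simp [hxa]
    rw [if_neg hxa, zero_mul, zero_add]
    by_cases hxy : G.Adj x y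
    · have h1 : x ≠ a ∧ ∃ y, y ∉ X ∧ G.Adj x y := ⟨hxa, y, hy, hxy⟩
      have h2 : ∃ x, x ∈ X ∧ x ≠ a ∧ G.Adj x y := ⟨x, hx, hxa, hxy⟩
      rw [if_pos hxy, if_pos h1, if_pos h2, one_mul]
    · rw [if_neg hxy]
      by_cases h1 : ∃ y, y ∉ X ∧ G.Adj x y
      · rw [if_neg (c := ∃ x, x ∈ X ∧ x ≠ a ∧ G.Adj x y), mul_zero]
        rintro ⟨x', hx', hxa', h2⟩
        obtain ⟨y', hy', h1⟩ := h1
        have q := hya ⟨x, hx⟩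
        exact hxy (h ⟨x, hxa⟩ ⟨x', hxa'⟩ ⟨y', q _ hy'⟩ ⟨y, q _ hy⟩ (key _ _ _ _ hx hy')
          (key _ _ _ _ hx hy) (key _ _ _ _ hx' hy') (key _ _ _ _ hx' hy) h1 h2)
      · rw [if_neg (c := x ≠ a ∧ ∃ y, y ∉ X ∧ G.Adj x y) (fun h => h1 h.2), zero_mul]
  rw [hdec]
  exact (Matrix.rank_mul_le_left _ _).trans ((Matrix.rank_le_card_width _).trans (by simp))


/-! ### Distance-hereditary graphs -/

lemma pathGraph_dist_le {n : ℕ} (i j : Fin n) (h : i ≤ j) :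
    (pathGraph n).dist i j ≤ j - i := by
  obtain ⟨j, hj⟩ := j
  induction j with
  | zero =>
    have : i = ⟨0, hj⟩ := le_antisymm h (Nat.zero_le _)
    simp [this]
  | succ j ih =>
    rcases eq_or_lt_of_le h with rfl | h'
    · simp
    · have h2 : (i : ℕ) < j + 1 := h'
      have h3 := ih (by omega) (by rw [Fin.le_def]; simp; omega)
      have hadj : (pathGraph n).Adj ⟨j, by omega⟩ ⟨j + 1, hj⟩ := by simp [pathGraph_adj]
      have h4 := hadj.reachable.dist_triangle_right i
      rw [dist_eq_one_iff_adj.2 hadj] at h4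
      simp only at h3 ⊢
      omega

lemma le_pathGraph_walk_length {n : ℕ} {i j : Fin n} (p : (pathGraph n).Walk i j) :
    (j : ℕ) ≤ i + p.length := by
  induction p with
  | nil => simp
  | cons h p ih =>
    rw [pathGraph_adj] at h
    rw [Walk.length_cons]
    omega

lemma pathGraph_dist {n : ℕ} (i j : Fin n) (h : i ≤ j) : (pathGraph n).dist i j = j - i := by
  apply le_antisymm (pathGraph_dist_le i j h)
  obtain ⟨p, hp⟩ := (pathGraph_preconnected n i j).exists_walk_length_eq_dist
  rw [← hp]
  have := le_pathGraph_walk_length p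
  omega

lemma IsDistanceHereditary.of_embedding {V W : Type*} {G : SimpleGraph V} {H : SimpleGraph W}
    (hG : IsDistanceHereditary G) (f : H ↪g G) : IsDistanceHereditary H := by
  intro n g i j
  have hr := pathGraph_preconnected n i j
  apply le_antisymm
  · obtain ⟨p, hp⟩ := hr.exists_walk_length_eq_dist
    rw [← hp, ← Walk.length_map g.toHom p]
    exact dist_le _
  · rw [← hG n (f.comp g) i j]
    obtain ⟨p, hp⟩ := (hr.map g.toHom).exists_walk_length_eq_dist
    refine le_trans ?_ hp.le
    rw [← Walk.length_map f.toHom p]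
    exact dist_le _

/-- `x` and `y` are connected within the set `S`. -/
def Joined {V : Type*} (G : SimpleGraph V) (S : Set V) (x y : V) : Prop :=
  ∃ (hx : x ∈ S) (hy : y ∈ S), (G.induce S).Reachable ⟨x, hx⟩ ⟨y, hy⟩

namespace Joined

variable {V : Type*} {G : SimpleGraph V} {S T : Set V} {x y z : V}

lemma left_mem (h : Joined G S x y) : x ∈ S := h.1
lemma right_mem (h : Joined G S x y) : y ∈ S := h.2.1

lemma refl (hx : x ∈ S) : Joined G S x x := ⟨hx, hx, Reachable.refl _⟩

lemma symm (h : Joined G S x y) : Joined G S y x := ⟨h.2.1, h.1, h.2.2.symm⟩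

lemma trans (h : Joined G S x y) (h' : Joined G S y z) : Joined G S x z :=
  ⟨h.1, h'.2.1, h.2.2.trans h'.2.2⟩

lemma of_adj (hx : x ∈ S) (hy : y ∈ S) (h : G.Adj x y) : Joined G S x y :=
  ⟨hx, hy, Adj.reachable (G := G.induce S) (u := ⟨x, hx⟩) (v := ⟨y, hy⟩) h⟩

lemma mono (h : Joined G S x y) (hST : S ⊆ T) : Joined G T x y :=
  ⟨hST h.1, hST h.2.1, h.2.2.map (induceHomOfLE G hST).toHom⟩

lemma reachable (h : Joined G S x y) : G.Reachable x y :=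
  h.2.2.map (Embedding.induce S).toHom

lemma of_reachable (h : G.Reachable x y) : Joined G Set.univ x y :=
  let f : G →g G.induce Set.univ := ⟨fun v => ⟨v, trivial⟩, fun h => h⟩
  ⟨trivial, trivial, h.map f⟩

end Joined

lemma exists_closer_neighbor {V : Type*} {G : SimpleGraph V} (hG : IsDistanceHereditary G)
    {S : Set V} {y u : V} (h : Joined G S y u) (hyu : y ≠ u) :
    ∃ y' ∈ S, G.Adj y y' ∧ G.dist y' u + 1 = G.dist y u := by
  obtain ⟨hy, hu, hr⟩ := h
  obtain ⟨p, hp⟩ := hr.exists_walk_length_eq_dist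
  have hpath := p.isPath_of_length_eq_dist hp
  have hpos : 0 < p.length := by
    rw [hp]
    exact hr.pos_dist_of_ne fun h => hyu (congrArg Subtype.val h)
  have hshort : ∀ i j, i ≤ p.length → j ≤ p.length → (G.induce S).Adj (p.getVert i) (p.getVert j) →
      j ≤ i + 1 := by
    intro i j hi hj hadj
    have := dist_le ((p.take i).append (Walk.cons hadj (p.drop j)))
    rw [← hp, Walk.length_append, Walk.length_cons, Walk.take_length, Walk.drop_length] at this
    omega
  let f : pathGraph (p.length + 1) ↪g G :=
    { toFun := fun i => (p.getVert i : V)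
      inj' := by
        intro i j hij
        have := hpath.getVert_injOn (x₁ := i) (x₂ := j) (Nat.le_of_lt_succ i.2)
          (Nat.le_of_lt_succ j.2) (Subtype.ext hij)
        exact Fin.ext this
      map_rel_iff' := by
        intro i j
        change G.Adj (p.getVert i) (p.getVert j) ↔ _
        rw [pathGraph_adj]
        constructor
        · intro hadj
          have h1 := hshort i j (Nat.le_of_lt_succ i.2) (Nat.le_of_lt_succ j.2) hadj
          have h2 := hshort j i (Nat.le_of_lt_succ j.2) (Nat.le_of_lt_succ i.2) hadj.symm
          have h3 : (i : ℕ) ≠ j := by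
            intro h
            rw [h] at hadj
            exact G.irrefl hadj
          omega
        · rintro (h | h)
          · rw [← h]
            exact p.adj_getVert_succ (by omega)
          · rw [← h]
            exact (p.adj_getVert_succ (i := j) (by omega)).symm }
  have h0 := hG _ f 0 (Fin.last _)
  have h1 := hG _ f ⟨1, by omega⟩ (Fin.last _)
  rw [pathGraph_dist _ _ (Fin.le_last _)] at h0 h1
  have hf0 : f 0 = y := by
    change ((p.getVert 0 : S) : V) = y
    rw [Walk.getVert_zero]
  have hfl : f (Fin.last _) = u := by
    change ((p.getVert p.length : S) : V) = u
    rw [Walk.getVert_length]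
  rw [hfl] at h0 h1
  rw [hf0] at h0
  refine ⟨f ⟨1, by omega⟩, (p.getVert 1).2, ?_, ?_⟩
  · have h2 : G.Adj (f 0) (f ⟨1, by omega⟩) := f.map_adj_iff.2 (by simp [pathGraph_adj])
    have h3 : ∀ a b, a = y → G.Adj a b → G.Adj y b := by
      rintro _ _ rfl h
      exact h
    exact h3 _ _ hf0 h2
  · rw [h0, h1]
    simp only [Fin.val_last, Fin.val_zero]
    omega

lemma dist_le_two {V : Type*} {G : SimpleGraph V} {a b c : V} (h : G.Adj a b) (h' : G.Adj b c) :
    G.dist a c ≤ 2 :=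
  dist_le (Walk.cons h (Walk.cons h' Walk.nil))

lemma eq_or_adj_of_dist_le_one {V : Type*} {G : SimpleGraph V} {a b : V} (h : G.Reachable a b)
    (h' : G.dist a b ≤ 1) : a = b ∨ G.Adj a b := by
  rcases Nat.le_one_iff_eq_zero_or_eq_one.1 h' with h0 | h1
  · exact Or.inl (h.dist_eq_zero_iff.1 h0)
  · exact Or.inr (dist_eq_one_iff_adj.1 h1)

/-- The vertices `x` and `y` have the same neighbours in `S`, apart from each other. -/
def TwinsIn {V : Type*} (G : SimpleGraph V) (S : Set V) (x y : V) : Prop :=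
  ∀ w ∈ S, w ≠ x → w ≠ y → (G.Adj w x ↔ G.Adj w y)

/-- There is a vertex of `S` other than `z` that either has a twin in `S` other than `z`, or has
exactly one neighbour in `S`. -/
def HasReducible {V : Type*} (G : SimpleGraph V) (S : Set V) (z : V) : Prop :=
  ∃ y ∈ S, y ≠ z ∧ ∃ x ∈ S, x ≠ y ∧
    ((x ≠ z ∧ TwinsIn G S x y) ∨ ∀ w ∈ S, G.Adj w y ↔ w = x)

lemma exists_twins_of_dominating {V : Type*} {G : SimpleGraph V} {A : Set V}
    (hA : A.Nontrivial) {x : V} (hx : ∀ a ∈ A, G.Adj x a)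
    (h : ∀ B ⊆ A, B.Nonempty → HasReducible G (insert x B) x) :
    ∃ a ∈ A, ∃ b ∈ A, a ≠ b ∧ TwinsIn G A a b := by
  have step : ∀ B ⊆ A, B.Nonempty → ∃ y ∈ B, (∃ a ∈ B, a ≠ y ∧ TwinsIn G B a y) ∨
      ∀ w ∈ B, ¬ G.Adj w y := by
    intro B hB hne
    obtain ⟨y, hy, hyx, a, ha, hay, h⟩ := h B hB hne
    have hyB : y ∈ B := hy.resolve_left hyx
    refine ⟨y, hyB, ?_⟩
    rcases h with ⟨hax, h⟩ | h
    · exact Or.inl ⟨a, ha.resolve_left hax, hay, fun w hw => h w (Or.inr hw)⟩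
    · right
      intro w hw hwy
      have h1 := (h w (Or.inr hw)).1 hwy
      have h2 := (h x (Or.inl rfl)).1 (hx y (hB hyB))
      have h3 := hx w (hB hw)
      rw [h1, h2] at h3
      exact G.irrefl h3
  obtain ⟨y, hy, ⟨a, ha, hay, h1⟩ | h1⟩ := step A le_rfl hA.nonempty
  · exact ⟨a, ha, y, hy, hay, h1⟩
  obtain ⟨b, hb, hby⟩ := hA.exists_ne y
  obtain ⟨y', hy', ⟨a, ha, hay, h2⟩ | h2⟩ := step (A \ {y}) Set.sdiff_subset ⟨b, hb, hby⟩
  · refine ⟨a, ha.1, y', hy'.1, hay, fun w hw hwa hwy => ?_⟩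
    by_cases hw' : w = y
    · subst hw'
      exact iff_of_false (fun h => h1 _ ha.1 h.symm) (fun h => h1 _ hy'.1 h.symm)
    · exact h2 w ⟨hw, hw'⟩ hwa hwy
  · refine ⟨y, hy, y', hy'.1, Ne.symm hy'.2, fun w hw hwy hwy' => ?_⟩
    exact iff_of_false (h1 w hw) (h2 w ⟨hw, hwy⟩)

section Levels

variable {V : Type*} {G : SimpleGraph V} {S : Set V} {z : V}

lemma joined_descending (hG : IsDistanceHereditary G) (hS : ∀ x ∈ S, Joined G S x z) :
    ∀ n, ∀ w ∈ S, G.dist w z = n → Joined G {v ∈ S | G.dist v z < n ∨ v = w} w z := by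
  intro n
  induction n with
  | zero =>
    intro w hw h
    rw [(hS w hw).reachable.dist_eq_zero_iff] at h
    subst h
    exact Joined.refl ⟨hw, Or.inr rfl⟩
  | succ n ih =>
    intro w hw h
    have hwz : w ≠ z := by
      rintro rfl
      simp at h
    obtain ⟨y, hy, hadj, hd⟩ := exists_closer_neighbor hG (hS w hw) hwz
    refine Joined.trans (y := y) (Joined.of_adj ⟨hw, Or.inr rfl⟩ ⟨hy, Or.inl (by omega)⟩ hadj)
      ((ih y hy (by omega)).mono ?_)
    rintro v ⟨hv, hv' | rfl⟩
    · exact ⟨hv, Or.inl (by omega)⟩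
    · exact ⟨hv, Or.inl (by omega)⟩

lemma adj_of_joined_of_level (hG : IsDistanceHereditary G) (hS : ∀ x ∈ S, Joined G S x z)
    {j : ℕ} {x y w : V} (h : Joined G {v ∈ S | j + 1 ≤ G.dist v z} x y)
    (hy : G.dist y z = j + 1) (hw : w ∈ S) (hwj : G.dist w z = j)
    (hwx : G.Adj w x) : G.Adj w y := by
  have hsub : {v ∈ S | j + 1 ≤ G.dist v z} ⊆ {v ∈ S | G.dist v z ≠ j ∨ v = w} := by
    rintro v ⟨hv, hv'⟩
    exact ⟨hv, Or.inl (by omega)⟩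
  have h1 : Joined G {v ∈ S | G.dist v z ≠ j ∨ v = w} y z := by
    refine (h.symm.mono hsub).trans ((Joined.of_adj (hsub h.left_mem) ⟨hw, Or.inr rfl⟩
      hwx.symm).trans ((joined_descending hG hS j w hw hwj).mono ?_))
    rintro v ⟨hv, hv' | rfl⟩
    · exact ⟨hv, Or.inl (by omega)⟩
    · exact ⟨hv, Or.inr rfl⟩
  have hyz : y ≠ z := by
    rintro rfl
    simp at hy
  obtain ⟨y', ⟨-, hy'⟩, hadj, hd⟩ := exists_closer_neighbor hG h1 hyz
  rcases hy' with hy' | rfl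
  · omega
  · exact hadj.symm

lemma dist_le_succ_of_adj (hS : ∀ x ∈ S, Joined G S x z) {v w : V} (hw : w ∈ S)
    (h : G.Adj v w) : G.dist v z ≤ G.dist w z + 1 := by
  have := (hS w hw).reachable.dist_triangle_right v
  rw [dist_eq_one_iff_adj.2 h] at this
  omega

end Levels

lemma TwinsIn.of_module {V : Type*} {G : SimpleGraph V} {S A : Set V} {a b : V}
    (h : TwinsIn G A a b) (ha : a ∈ A) (hb : b ∈ A)
    (hA : ∀ w ∈ S, w ∉ A → ∀ a ∈ A, ∀ b ∈ A, G.Adj w a → G.Adj w b) : TwinsIn G S a b := by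
  intro w hw hwa hwb
  by_cases hwA : w ∈ A
  · exact h w hwA hwa hwb
  · exact ⟨hA w hw hwA a ha b hb, hA w hw hwA b hb a ha⟩

/-- The case of a dominating vertex `z` of `S` in the theorem of Bandelt and Mulder. -/
lemma hasReducible_of_dominating {V : Type*} {G : SimpleGraph V} (hG : IsDistanceHereditary G)
    {F : Set V} {z : V} (hz : ∀ a ∈ F, G.Adj z a) (hF : F.Nontrivial)
    (hconn : ∀ x ∈ F, ∀ y ∈ F, Joined G F x y)
    (ih : ∀ T ⊆ F, (∀ x ∈ T, ∀ y ∈ T, Joined G T x y) → T.Nontrivial → ∀ w ∈ T,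
      HasReducible G T w) : HasReducible G (insert z F) z := by
  have hzF : ∀ a ∈ F, a ≠ z := by
    rintro a ha rfl
    exact G.irrefl (hz a ha)
  have hmod : ∀ w ∈ insert z F, w ∉ F → ∀ a ∈ F, ∀ b ∈ F, G.Adj w a → G.Adj w b := by
    rintro w (rfl | hw) hw' a - b hb -
    · exact hz b hb
    · exact absurd hw hw'
  have fin : ∀ a ∈ F, ∀ b ∈ F, a ≠ b → TwinsIn G F a b → HasReducible G (insert z F) z :=
    fun a ha b hb hab h => ⟨b, Or.inr hb, hzF b hb, a, Or.inr ha, hab,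
      Or.inl ⟨hzF a ha, h.of_module ha hb hmod⟩⟩
  obtain ⟨c, hc⟩ := hF.nonempty
  obtain ⟨y, hy, -, x, hx, hxy, ⟨-, h⟩ | h⟩ := ih F le_rfl hconn hF c hc
  · exact fin x hx y hy hxy h
  have hdom : ∀ v ∈ F, v ≠ x → G.Adj x v := by
    intro v hv hvx
    by_cases hvy : v = y
    · subst hvy
      exact (h x hx).2 rfl
    obtain ⟨v', hv', hadj, hd⟩ := exists_closer_neighbor hG (hconn v hv y hy) hvy
    have h2 := dist_le_two (hz v hv).symm (hz y hy)
    rcases eq_or_adj_of_dist_le_one (hconn v' hv' y hy).reachable (by omega) with rfl | h3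
    · exact absurd ((h v hv).1 hadj) hvx
    · rw [h v' hv'] at h3
      subst h3
      exact hadj.symm
  by_cases hA : (F \ {x}).Nontrivial
  · have hins : ∀ B ⊆ F \ {x}, insert x B ⊆ F := by
      rintro B hB w (rfl | hw)
      · exact hx
      · exact (hB hw).1
    obtain ⟨a, ha, b, hb, hab, htw⟩ := exists_twins_of_dominating hA
      (fun a ha => hdom a ha.1 ha.2) (by
        intro B hB hne
        refine ih _ (hins B hB) ?_ ?_ x (Or.inl rfl)
        · have : ∀ w ∈ insert x B, Joined G (insert x B) w x := by
            rintro w (rfl | hw)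
            · exact Joined.refl (Or.inl rfl)
            · exact Joined.of_adj (Or.inr hw) (Or.inl rfl) (hdom w (hB hw).1 (hB hw).2).symm
          exact fun v hv w hw => (this v hv).trans (this w hw).symm
        · obtain ⟨b, hb⟩ := hne
          exact ⟨x, Or.inl rfl, b, Or.inr hb, Ne.symm (hB hb).2⟩)
    refine fin a ha.1 b hb.1 hab (htw.of_module ha hb ?_)
    intro w hw hw' a _ b hb _
    have : w = x := by
      by_contra h
      exact hw' ⟨hw, h⟩
    subst this
    exact hdom b hb.1 hb.2
  · refine fin x hx y hy hxy fun w hw hwx hwy => ?_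
    exact absurd ⟨w, ⟨hw, hwx⟩, y, ⟨hy, hxy.symm⟩, hwy⟩ hA

/-- The theorem of Bandelt and Mulder: a connected distance-hereditary graph has twins or a
pendant vertex. -/
theorem hasReducible {V : Type*} [Finite V] {G : SimpleGraph V} (hG : IsDistanceHereditary G)
    (n : ℕ) : ∀ S : Set V, S.ncard = n → (∀ x ∈ S, ∀ y ∈ S, Joined G S x y) → S.Nontrivial →
      ∀ z ∈ S, HasReducible G S z := by
  induction n using Nat.strong_induction_on with
  | _ n ih =>
  intro S hSn hconn hS z hz
  have hSz : ∀ x ∈ S, Joined G S x z := fun x hx => hconn x hx z hz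
  have hpos : ∀ v ∈ S, v ≠ z → 0 < G.dist v z :=
    fun v hv hvz => (hSz v hv).reachable.pos_dist_of_ne hvz
  have hzero : ∀ v, 0 < G.dist v z → v ≠ z := by
    rintro v hv rfl
    simp at hv
  have hIH : ∀ T ⊂ S, (∀ x ∈ T, ∀ y ∈ T, Joined G T x y) → T.Nontrivial → ∀ w ∈ T,
      HasReducible G T w := fun T hT =>
    ih T.ncard (hSn ▸ Set.ncard_lt_ncard hT (Set.toFinite S)) T rfl
  have hM : ∀ (A : Set V) (x : V), insert x A ⊂ S → A.Nontrivial → (∀ a ∈ A, G.Adj x a) →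
      ∃ a ∈ A, ∃ b ∈ A, a ≠ b ∧ TwinsIn G A a b := by
    intro A x hAS hA hx
    refine exists_twins_of_dominating hA hx fun B hB hne => ?_
    refine hIH _ (lt_of_le_of_lt (Set.insert_subset_insert hB) hAS) ?_ ?_ x (Or.inl rfl)
    · have : ∀ w ∈ insert x B, Joined G (insert x B) w x := by
        rintro w (rfl | hw)
        · exact Joined.refl (Or.inl rfl)
        · exact Joined.of_adj (Or.inr hw) (Or.inl rfl) (hx w (hB hw)).symm
      exact fun v hv w hw => (this v hv).trans (this w hw).symm
    · obtain ⟨b, hb⟩ := hne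
      exact ⟨x, Or.inl rfl, b, Or.inr hb, (hx b (hB hb)).ne⟩
  have fin : ∀ A ⊆ S, (∀ a ∈ A, a ≠ z) →
      (∀ w ∈ S, w ∉ A → ∀ a ∈ A, ∀ b ∈ A, G.Adj w a → G.Adj w b) →
      (∃ a ∈ A, ∃ b ∈ A, a ≠ b ∧ TwinsIn G A a b) → HasReducible G S z := by
    rintro A hA hAz hmod ⟨a, ha, b, hb, hab, h⟩
    exact ⟨b, hA hb, hAz b hb, a, hA ha, hab, Or.inl ⟨hAz a ha, h.of_module ha hb hmod⟩⟩
  obtain ⟨m, hmS, hmax⟩ := Set.exists_max_image S (fun v => G.dist v z) (Set.toFinite S)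
    hS.nonempty
  obtain ⟨s, hs, hsz⟩ := hS.exists_ne z
  obtain ⟨k, hk⟩ : ∃ k, G.dist m z = k + 1 := ⟨G.dist m z - 1, by
    have := hmax s hs
    have := hpos s hs hsz
    omega⟩
  simp only [hk] at hmax
  set T : Set V := {v ∈ S | k + 1 ≤ G.dist v z} with hT
  have hTk : ∀ v ∈ T, G.dist v z = k + 1 := fun v hv => le_antisymm (hmax v hv.1) hv.2
  by_cases hedge : ∃ a ∈ T, ∃ b ∈ T, G.Adj a b
  · obtain ⟨a, ha, b, hb, hab⟩ := hedge
    set Q : Set V := {v | Joined G T a v} with hQ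
    have hQT : Q ⊆ T := fun v hv => hv.right_mem
    have hQS : Q ⊆ S := fun v hv => (hQT hv).1
    have haQ : a ∈ Q := Joined.refl ha
    have hbQ : b ∈ Q := Joined.of_adj ha hb hab
    have hQn : Q.Nontrivial := ⟨a, haQ, b, hbQ, hab.ne⟩
    have hQz : ∀ v ∈ Q, v ≠ z := fun v hv => hzero v (by rw [hTk v (hQT hv)]; omega)
    obtain ⟨t, ht, hat, htd⟩ := exists_closer_neighbor hG (hSz a ha.1) (hQz a haQ)
    rw [hTk a ha] at htd
    have htQ : ∀ v ∈ Q, G.Adj t v := fun v hv =>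
      adj_of_joined_of_level hG hSz hv (hTk v (hQT hv)) ht (by omega) hat.symm
    have hmod : ∀ w ∈ S, w ∉ Q → ∀ a ∈ Q, ∀ b ∈ Q, G.Adj w a → G.Adj w b := by
      intro w hw hwQ p hp q hq hwp
      have h1 := dist_le_succ_of_adj hSz hw hwp.symm
      rw [hTk p (hQT hp)] at h1
      rcases Nat.eq_or_lt_of_le h1 with h1 | h1
      · exact adj_of_joined_of_level hG hSz (hp.symm.trans hq) (hTk q (hQT hq)) hw (by omega) hwp
      · exact absurd (hp.trans (Joined.of_adj (hQT hp) ⟨hw, by omega⟩ hwp.symm)) hwQ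
    have hsub : insert t Q ⊆ S := Set.insert_subset ht hQS
    by_cases heq : insert t Q = S
    · have hzt : z = t := by
        rw [← heq] at hz
        exact hz.resolve_right fun h => hQz z h rfl
      subst hzt
      have hTQ : T ⊆ Q := by
        intro v hv
        have h1 := hv.1
        rw [← heq] at h1
        refine h1.resolve_left ?_
        rintro rfl
        have := hv.2
        simp at this
      rw [← heq]
      refine hasReducible_of_dominating hG htQ hQn
        (fun x hx y hy => (hx.symm.trans hy).mono hTQ) fun U hU => hIH U ?_
      refine lt_of_le_of_lt hU ⟨hQS, fun h => hQz z (h hz) rfl⟩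
    · exact fin Q hQS hQz hmod (hM Q t (lt_of_le_of_ne hsub heq) hQn htQ)
  · push Not at hedge
    have hTn : T.Nonempty := ⟨m, hmS, hk.ge⟩
    obtain ⟨x, hxT, hmin⟩ := Set.exists_min_image T (fun v => {w ∈ S | G.Adj v w}.ncard)
      (Set.toFinite T) hTn
    have hlow : ∀ y ∈ T, ∀ w ∈ S, G.Adj y w → G.dist w z = k := by
      intro y hy w hw hyw
      have h1 := dist_le_succ_of_adj hSz hw hyw
      rw [hTk y hy] at h1
      have h2 := hmax w hw
      have h3 : ¬ k + 1 ≤ G.dist w z := fun h => hedge y hy w ⟨hw, h⟩ hyw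
      omega
    have hxz : x ≠ z := hzero x (by rw [hTk x hxT]; omega)
    set A : Set V := {w ∈ S | G.Adj x w} with hA
    have hAk : ∀ a ∈ A, G.dist a z = k := fun a ha => hlow x hxT a ha.1 ha.2
    by_cases hAn : A.Nontrivial
    swap
    · obtain ⟨t, ht, hxt, -⟩ := exists_closer_neighbor hG (hSz x hxT.1) hxz
      refine ⟨x, hxT.1, hxz, t, ht, hxt.ne', Or.inr fun w hw => ⟨fun h => ?_, ?_⟩⟩
      · by_contra hwt
        exact hAn ⟨w, ⟨hw, h.symm⟩, t, ⟨ht, hxt⟩, hwt⟩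
      · rintro rfl
        exact hxt.symm
    obtain ⟨a₀, ha₀⟩ := hAn.nonempty
    have hAz : ∀ a ∈ A, a ≠ z := by
      rintro a ha rfl
      have hk0 : k = 0 := by simpa using (hAk a ha).symm
      obtain ⟨b, hb, hba⟩ := hAn.exists_ne a
      have := hpos b hb.1 hba
      rw [hAk b hb] at this
      omega
    obtain ⟨j, rfl⟩ : ∃ j, k = j + 1 := ⟨k - 1, by
      have := hpos a₀ ha₀.1 (hAz a₀ ha₀)
      rw [hAk a₀ ha₀] at this
      omega⟩
    set U : Set V := {v ∈ S | j + 1 ≤ G.dist v z} with hU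
    have hAU : ∀ a ∈ A, a ∈ U := fun a ha => ⟨ha.1, (hAk a ha).ge⟩
    have hTU : ∀ a ∈ T, a ∈ U := fun a ha => ⟨ha.1, by rw [hTk a ha]; omega⟩
    obtain ⟨t, ht, hat, htd⟩ := exists_closer_neighbor hG (hSz a₀ ha₀.1) (hAz a₀ ha₀)
    rw [hAk a₀ ha₀] at htd
    have htj : G.dist t z = j := by omega
    have hAA : ∀ a ∈ A, ∀ b ∈ A, Joined G U a b := fun a ha b hb =>
      (Joined.of_adj (hAU a ha) (hTU x hxT) ha.2.symm).trans
        (Joined.of_adj (hTU x hxT) (hAU b hb) hb.2)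
    have hup : ∀ a ∈ A, ∀ b, Joined G U a b → G.dist b z = j + 1 → G.Adj t b := fun a ha b hb hbd =>
      adj_of_joined_of_level hG hSz ((hAA a₀ ha₀ a ha).trans hb) hbd ht htj hat.symm
    have htA : ∀ a ∈ A, G.Adj t a := fun a ha => hup a ha a (Joined.refl (hAU a ha)) (hAk a ha)
    have htT : ∀ y ∈ T, ¬ G.Adj y t := by
      intro y hy h
      have := hlow y hy t ht h
      omega
    have hmodT : ∀ y ∈ T, ∀ a ∈ A, ∀ b ∈ A, G.Adj y a → G.Adj y b := by
      intro y hy a ha a' ha' hya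
      by_contra hya'
      obtain ⟨b, hb, hyb, hxb⟩ : ∃ b ∈ S, G.Adj y b ∧ ¬ G.Adj x b := by
        by_contra! hcon
        refine absurd (hmin y hy) (not_le.2 (Set.ncard_lt_ncard ⟨?_, ?_⟩ (Set.toFinite A)))
        · exact fun w hw => ⟨hw.1, hcon w hw.1 hw.2⟩
        · exact fun h => hya' (h ha').2
      have hbd := hlow y hy b hb hyb
      have htb : G.Adj t b := hup a ha b ((Joined.of_adj (hAU a ha) (hTU y hy) hya.symm).trans
        (Joined.of_adj (hTU y hy) ⟨hb, hbd.ge⟩ hyb)) hbd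
      have hJ : Joined G {x, a', t, b, y} y x :=
        (Joined.of_adj (by simp) (by simp) hyb).trans <|
        (Joined.of_adj (by simp) (by simp) htb.symm).trans <|
        (Joined.of_adj (by simp) (by simp) (htA a' ha')).trans <|
        Joined.of_adj (by simp) (by simp) ha'.2.symm
      have hyx : y ≠ x := by
        rintro rfl
        exact hya' ha'.2
      obtain ⟨y', hy', hadj, hd⟩ := exists_closer_neighbor hG hJ hyx
      have h2 := dist_le_two hya ha.2.symm
      have h3 := eq_or_adj_of_dist_le_one ((hSz y hy.1).reachable.symm.trans hadj.reachable
        |>.symm.trans (hSz x hxT.1).reachable.symm) (by omega : G.dist y' x ≤ 1)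
      rcases hy' with rfl | rfl | rfl | rfl | rfl
      · exact hedge y hy y' hxT hadj
      · exact hya' hadj
      · exact htT y hy hadj
      · rcases h3 with rfl | h3
        · rw [hTk y' hxT] at hbd
          omega
        · exact hxb h3.symm
      · exact G.irrefl hadj
    have hmodL : ∀ w ∈ S, G.dist w z = j + 1 → w ∉ A → ∀ a ∈ A, ∀ b ∈ A, G.Adj w a →
        G.Adj w b := by
      intro w hw hwd hwA a ha a' ha' hwa
      by_contra hwa'
      have hxw : ¬ G.Adj x w := fun h => hwA ⟨hw, h⟩
      have htw : G.Adj t w := hup a ha w (Joined.of_adj (hAU a ha) ⟨hw, hwd.ge⟩ hwa.symm) hwd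
      have hJ : Joined G {w, t, a', x} x w :=
        (Joined.of_adj (by simp) (by simp) ha'.2).trans <|
        (Joined.of_adj (by simp) (by simp) (htA a' ha').symm).trans <|
        Joined.of_adj (by simp) (by simp) htw
      have hne : x ≠ w := by
        rintro rfl
        rw [hTk x hxT] at hwd
        omega
      obtain ⟨x', hx', hadj, hd⟩ := exists_closer_neighbor hG hJ hne
      have h2 := dist_le_two ha.2 hwa.symm
      have h3 := eq_or_adj_of_dist_le_one (hadj.reachable.symm.trans ((hSz x hxT.1).reachable.trans
        (hSz w hw).reachable.symm)) (by omega : G.dist x' w ≤ 1)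
      rcases hx' with rfl | rfl | rfl | rfl
      · exact hxw hadj
      · exact htT x hxT hadj
      · rcases h3 with rfl | h3
        · exact hwA ha'
        · exact hwa' h3.symm
      · exact G.irrefl hadj
    refine fin A (fun a ha => ha.1) hAz ?_ (hM A x ⟨?_, ?_⟩ hAn fun a ha => ha.2)
    · intro w hw hwA a ha b hb hwa
      have h1 := dist_le_succ_of_adj hSz hw hwa.symm
      have h2 := dist_le_succ_of_adj hSz ha.1 hwa
      rw [hAk a ha] at h1 h2
      obtain h3 | h3 | h3 : G.dist w z = j ∨ G.dist w z = j + 1 ∨ G.dist w z = j + 1 + 1 := by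
        omega
      · exact adj_of_joined_of_level hG hSz (hAA a ha b hb) (hAk b hb) hw h3 hwa
      · exact hmodL w hw h3 hwA a ha b hb hwa
      · exact hmodT w ⟨hw, h3.ge⟩ a ha b hb hwa
    · rintro w (rfl | hw)
      · exact hxT.1
      · exact hw.1
    · intro h
      rcases h ht with rfl | h
      · rw [hTk t hxT] at htj
        omega
      · rw [hAk t h] at htj
        omega


/-! ### Cliques and stars -/

/-- The role of a vertex of a clique or star block. -/
inductive Role
  | clique
  | centre
  | leaf
  deriving DecidableEq

open Classical in
/-- The role of `v` in `G`, meaningful if `G` is a clique or a star. -/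
noncomputable def roleIn {V : Type*} (G : SimpleGraph V) (v : V) : Role :=
  if IsClique G then .clique else if IsStarWithCentre G v then .centre else .leaf

/-- `G` is a clique or a star, with at least three vertices. -/
def IsDegenerate {V : Type*} (G : SimpleGraph V) : Prop :=
  IsClique G ∨ ∃ c, IsStarWithCentre G c

/-- Two roles may meet at a marked edge of a canonical decomposition. -/
def Role.Compatible : Role → Role → Prop
  | .clique, .clique => False
  | .centre, .leaf => False
  | .leaf, .centre => False
  | _, _ => True

lemma Role.Compatible.symm {r s : Role} (h : r.Compatible s) : s.Compatible r := by
  cases r <;> cases s <;> simp_all [Role.Compatible]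

lemma exists_ne_ne_of_three_le {V : Type*} (h : 3 ≤ ENat.card V) (a b : V) :
    ∃ c, c ≠ a ∧ c ≠ b := by
  by_contra! hc
  have h1 : (Set.univ : Set V) ⊆ {a, b} := fun c _ => by
    by_cases hca : c = a
    · exact Or.inl hca
    · exact Or.inr (hc c hca)
  have h2 := Set.encard_le_encard h1
  rw [Set.encard_univ] at h2
  have h3 := (h.trans h2).trans (Set.encard_insert_le _ _)
  rw [Set.encard_singleton] at h3
  exact absurd h3 (by decide)

section

variable {V W : Type*} {G : SimpleGraph V} {H : SimpleGraph W}

lemma IsClique.not_star (h : IsClique G) (c : V) : ¬ IsStarWithCentre G c := by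
  intro hs
  obtain ⟨a, ha, -⟩ := exists_ne_ne_of_three_le h.1 c c
  obtain ⟨b, hb, hab⟩ := exists_ne_ne_of_three_le h.1 c a
  rcases ((hs.2 a b).1 ((h.2 a b).2 hab.symm)).2 with h | h
  · exact ha h
  · exact hb h

lemma IsStarWithCentre.unique {c d : V} (h : IsStarWithCentre G c) (h' : IsStarWithCentre G d) :
    c = d := by
  by_contra hcd
  obtain ⟨a, ha, had⟩ := exists_ne_ne_of_three_le h.1 c d
  rcases ((h'.2 c a).1 ((h.2 c a).2 ⟨ha.symm, Or.inl rfl⟩)).2 with h | h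
  · exact hcd h
  · exact had h

lemma IsClique.roleIn (h : IsClique G) (v : V) : roleIn G v = .clique := by
  simp [SplitTree.roleIn, h]

lemma IsStarWithCentre.roleIn_centre {c : V} (h : IsStarWithCentre G c) :
    roleIn G c = .centre := by
  have : ¬ IsClique G := fun h' => h'.not_star c h
  simp [SplitTree.roleIn, h, this]

lemma IsStarWithCentre.roleIn_leaf {c v : V} (h : IsStarWithCentre G c) (hv : v ≠ c) :
    roleIn G v = .leaf := by
  have h1 : ¬ IsClique G := fun h' => h'.not_star c h
  have h2 : ¬ IsStarWithCentre G v := fun h' => hv (h'.unique h)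
  simp [SplitTree.roleIn, h1, h2]

lemma roleIn_eq_clique (h : IsDegenerate G) {v : V} : roleIn G v = .clique ↔ IsClique G := by
  refine ⟨fun hv => ?_, fun h => h.roleIn v⟩
  rcases h with h | ⟨c, h⟩
  · exact h
  · by_cases hvc : v = c
    · subst hvc
      rw [h.roleIn_centre] at hv
      cases hv
    · rw [h.roleIn_leaf hvc] at hv
      cases hv

lemma roleIn_eq_centre (h : IsDegenerate G) {v : V} :
    roleIn G v = .centre ↔ IsStarWithCentre G v := by
  refine ⟨fun hv => ?_, fun h => h.roleIn_centre⟩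
  rcases h with h | ⟨c, h⟩
  · rw [h.roleIn] at hv
    cases hv
  · by_cases hvc : v = c
    · exact hvc ▸ h
    · rw [h.roleIn_leaf hvc] at hv
      cases hv

lemma roleIn_eq_leaf (h : IsDegenerate G) {v : V} :
    roleIn G v = .leaf ↔ ∃ c, c ≠ v ∧ IsStarWithCentre G c := by
  refine ⟨fun hv => ?_, fun ⟨c, hc, h⟩ => h.roleIn_leaf hc.symm⟩
  rcases h with h | ⟨c, h⟩
  · rw [h.roleIn] at hv
    cases hv
  · refine ⟨c, ?_, h⟩
    rintro rfl
    rw [h.roleIn_centre] at hv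
    cases hv

lemma IsDegenerate.three_le (h : IsDegenerate G) : 3 ≤ ENat.card V := by
  rcases h with h | ⟨c, h⟩
  · exact h.1
  · exact h.1

lemma IsDegenerate.adj_iff (h : IsDegenerate G) (x y : V) :
    G.Adj x y ↔ x ≠ y ∧ (roleIn G x ≠ .leaf ∨ roleIn G y ≠ .leaf) := by
  rcases h with h | ⟨c, h⟩
  · simp [h.2, h.roleIn]
  · rw [h.2]
    refine and_congr_right fun _ => or_congr ?_ ?_
    · by_cases hx : x = c
      · simp [hx, h.roleIn_centre]
      · simp [hx, h.roleIn_leaf hx]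
    · by_cases hx : y = c
      · simp [hx, h.roleIn_centre]
      · simp [hx, h.roleIn_leaf hx]

lemma IsDegenerate.adj_iff_role (h : IsDegenerate G) {x y : V} (hxy : x ≠ y) :
    G.Adj x y ↔ roleIn G x ≠ .leaf ∨ roleIn G y ≠ .leaf := by
  simp [h.adj_iff, hxy]

lemma IsClique.iso (h : IsClique G) (e : G ≃g H) : IsClique H := by
  refine ⟨by rw [← ENat.card_congr e.toEquiv]; exact h.1, fun x y => ?_⟩
  rw [← e.symm.map_adj_iff, h.2, e.symm.injective.ne_iff]

lemma IsStarWithCentre.iso {c : V} (h : IsStarWithCentre G c) (e : G ≃g H) :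
    IsStarWithCentre H (e c) := by
  refine ⟨by rw [← ENat.card_congr e.toEquiv]; exact h.1, fun x y => ?_⟩
  rw [← e.symm.map_adj_iff, h.2, e.symm.injective.ne_iff]
  have : ∀ x, e.symm x = c ↔ x = e c := fun x => e.toEquiv.symm_apply_eq
  rw [this, this]

lemma IsDegenerate.iso (h : IsDegenerate G) (e : G ≃g H) : IsDegenerate H := by
  rcases h with h | ⟨c, h⟩
  · exact Or.inl (h.iso e)
  · exact Or.inr ⟨_, h.iso e⟩

lemma roleIn_iso (e : G ≃g H) (v : V) : roleIn H (e v) = roleIn G v := by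
  have h1 : IsClique H ↔ IsClique G := ⟨fun h => h.iso e.symm, fun h => h.iso e⟩
  have h2 : IsStarWithCentre H (e v) ↔ IsStarWithCentre G v :=
    ⟨fun h => by simpa using h.iso e.symm, fun h => h.iso e⟩
  classical
  exact if_congr h1 rfl (if_congr h2 rfl rfl)

/-- A description of cliques and stars by the roles of their vertices. -/
lemma isDegenerate_of_roles (h3 : 3 ≤ ENat.card V) (ρ : V → Role)
    (h : ∀ x y, x ≠ y → (G.Adj x y ↔ ρ x ≠ .leaf ∨ ρ y ≠ .leaf))
    (hρ : (∀ x, ρ x = .clique) ∨ ∃ c, ρ c = .centre ∧ ∀ x, x ≠ c → ρ x = .leaf) :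
    IsDegenerate G ∧ ∀ x, roleIn G x = ρ x := by
  rcases hρ with hρ | ⟨c, hc, hρ⟩
  · have : IsClique G := ⟨h3, fun x y =>
      ⟨fun h => h.ne, fun hxy => (h x y hxy).2 (by simp [hρ])⟩⟩
    exact ⟨Or.inl this, fun x => by rw [this.roleIn, hρ]⟩
  · have key : ∀ x, ρ x ≠ .leaf ↔ x = c := fun x => by
      by_cases hx : x = c
      · simp [hx, hc]
      · simp [hx, hρ x hx]
    have : IsStarWithCentre G c := ⟨h3, fun x y => by
      by_cases hxy : x = y
      · simp [hxy]
      · simp [h x y hxy, key, hxy]⟩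
    refine ⟨Or.inr ⟨c, this⟩, fun x => ?_⟩
    by_cases hx : x = c
    · rw [hx, this.roleIn_centre, hc]
    · rw [this.roleIn_leaf hx, hρ x hx]

lemma IsDegenerate.roles (h : IsDegenerate G) : (∀ x, roleIn G x = .clique) ∨
    ∃ c, roleIn G c = .centre ∧ ∀ x, x ≠ c → roleIn G x = .leaf := by
  rcases h with h | ⟨c, h⟩
  · exact Or.inl h.roleIn
  · exact Or.inr ⟨c, h.roleIn_centre, fun x hx => h.roleIn_leaf hx⟩

end

/-! ### Blocks, roles and trees of decompositions -/

namespace Decomposition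

variable {V : Type u} {G : SimpleGraph V}

/-- The unique block of a decomposition without splits. -/
def blockSingleIso (G : SimpleGraph V) : G ≃g (single G).block () where
  toFun v := ⟨v, rfl⟩
  invFun v := v.1
  left_inv _ := rfl
  right_inv _ := rfl
  map_rel_iff' := Iff.rfl

/-- A block of the first part, as a block of the whole decomposition. -/
def blockInlIso {X : Set V} (hX : IsSplit G X) (D₁ : Decomposition (splitPart G X))
    (D₂ : Decomposition (splitPart G Xᶜ)) (b : D₁.Block) :
    D₁.block b ≃g (split G X hX D₁ D₂).block (Sum.inl b) where
  toFun w := ⟨Sum.inl w.1, congrArg Sum.inl w.2⟩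
  invFun w := match w with
    | ⟨Sum.inl w, h⟩ => ⟨w, Sum.inl_injective h⟩
    | ⟨Sum.inr w, h⟩ => (Sum.inr_ne_inl h).elim
  left_inv _ := rfl
  right_inv := by
    rintro ⟨w | w, h⟩
    · rfl
    · exact (Sum.inr_ne_inl h).elim
  map_rel_iff' := by
    intro v w
    change (SimpleGraph.sum D₁.solid D₂.solid).Adj (Sum.inl v.1) (Sum.inl w.1) ↔
      D₁.solid.Adj v.1 w.1
    simp

/-- A block of the second part, as a block of the whole decomposition. -/
def blockInrIso {X : Set V} (hX : IsSplit G X) (D₁ : Decomposition (splitPart G X))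
    (D₂ : Decomposition (splitPart G Xᶜ)) (b : D₂.Block) :
    D₂.block b ≃g (split G X hX D₁ D₂).block (Sum.inr b) where
  toFun w := ⟨Sum.inr w.1, congrArg Sum.inr w.2⟩
  invFun w := match w with
    | ⟨Sum.inr w, h⟩ => ⟨w, Sum.inr_injective h⟩
    | ⟨Sum.inl w, h⟩ => (Sum.inl_ne_inr h).elim
  left_inv _ := rfl
  right_inv := by
    rintro ⟨w | w, h⟩
    · exact (Sum.inl_ne_inr h).elim
    · rfl
  map_rel_iff' := by
    intro v w
    change (SimpleGraph.sum D₁.solid D₂.solid).Adj (Sum.inr v.1) (Sum.inr w.1) ↔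
      D₂.solid.Adj v.1 w.1
    simp

/-- The role in its block of a vertex of the blocks. -/
noncomputable def roleAt (D : Decomposition G) (w : D.Vertex) : Role :=
  roleIn (D.block (D.blockOf w)) ⟨w, rfl⟩

/-- The role in its block of a vertex of `G`. -/
noncomputable def role (D : Decomposition G) (v : V) : Role :=
  D.roleAt (D.vertex v)

/-- The block of a vertex of `G`. -/
noncomputable def home (D : Decomposition G) (v : V) : D.Block :=
  D.blockOf (D.vertex v)

/-- All blocks are cliques and stars, and the decomposition is canonical. -/
def Good (D : Decomposition G) : Prop :=
  (∀ b, IsDegenerate (D.block b)) ∧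
    ∀ v w, D.marked.Adj v w → (D.roleAt v).Compatible (D.roleAt w)

lemma Good.isCanonical {D : Decomposition G} (h : D.Good) : D.IsCanonical where
  blocks b := Or.inr (h.1 b)
  cliques v w hvw hcl := by
    have := h.2 v w hvw
    rw [roleAt, roleAt, hcl.1.roleIn, hcl.2.roleIn] at this
    exact this
  stars v w hvw c d hc hd := by
    have h1 := h.2 v w hvw
    rw [roleAt, roleAt] at h1
    by_cases hcv : c = ⟨v, rfl⟩ <;> by_cases hdw : d = ⟨w, rfl⟩
    · simp [hcv, hdw]
    · subst hcv
      rw [hc.roleIn_centre, hd.roleIn_leaf (Ne.symm hdw)] at h1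
      exact h1.elim
    · subst hdw
      rw [hd.roleIn_centre, hc.roleIn_leaf (Ne.symm hcv)] at h1
      exact h1.elim
    · simp [hcv, hdw]

lemma IsCanonical.good {D : Decomposition G} (h : D.IsCanonical)
    (hD : ∀ b, IsDegenerate (D.block b)) : D.Good := by
  refine ⟨hD, fun v w hvw => ?_⟩
  have h1 := h.cliques v w hvw
  have h2 := h.stars v w hvw
  rcases hv : D.roleAt v <;> rcases hw : D.roleAt w
  · rw [roleAt, roleIn_eq_clique (hD _)] at hv hw
    exact (h1 ⟨hv, hw⟩).elim
  · trivial
  · trivial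
  · trivial
  · trivial
  · rw [roleAt, roleIn_eq_centre (hD _)] at hv
    rw [roleAt, roleIn_eq_leaf (hD _)] at hw
    obtain ⟨d, hd, hw⟩ := hw
    exact (hd ((h2 _ _ hv hw).1 rfl)).elim
  · trivial
  · rw [roleAt, roleIn_eq_centre (hD _)] at hw
    rw [roleAt, roleIn_eq_leaf (hD _)] at hv
    obtain ⟨d, hd, hv⟩ := hv
    exact (hd ((h2 _ _ hv hw).2 rfl)).elim
  · trivial

@[simp] lemma role_single (v : V) : (single G).role v = roleIn G v :=
  roleIn_iso (blockSingleIso G) v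

lemma good_single : (single G).Good ↔ IsDegenerate G := by
  constructor
  · intro h
    exact (h.1 ()).iso (blockSingleIso G).symm
  · intro h
    exact ⟨fun _ => h.iso (blockSingleIso G), fun v w hvw => hvw.elim⟩

section Split

variable {X : Set V} (hX : IsSplit G X) (D₁ : Decomposition (splitPart G X))
  (D₂ : Decomposition (splitPart G Xᶜ))

lemma vertex_split_of_mem {v : V} (hv : v ∈ X) :
    (split G X hX D₁ D₂).vertex v = Sum.inl (D₁.vertex (some ⟨v, hv⟩)) := by
  simp [vertex, hv]

lemma vertex_split_of_notMem {v : V} (hv : v ∉ X) :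
    (split G X hX D₁ D₂).vertex v = Sum.inr (D₂.vertex (some ⟨v, hv⟩)) := by
  simp [vertex, hv]

lemma roleAt_split_inl (w : D₁.Vertex) :
    (split G X hX D₁ D₂).roleAt (Sum.inl w) = D₁.roleAt w :=
  roleIn_iso (blockInlIso hX D₁ D₂ (D₁.blockOf w)) ⟨w, rfl⟩

lemma roleAt_split_inr (w : D₂.Vertex) :
    (split G X hX D₁ D₂).roleAt (Sum.inr w) = D₂.roleAt w :=
  roleIn_iso (blockInrIso hX D₁ D₂ (D₂.blockOf w)) ⟨w, rfl⟩

lemma role_split_of_mem {v : V} (hv : v ∈ X) :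
    (split G X hX D₁ D₂).role v = D₁.role (some ⟨v, hv⟩) := by
  rw [role, vertex_split_of_mem hX D₁ D₂ hv, roleAt_split_inl, role]

lemma role_split_of_notMem {v : V} (hv : v ∉ X) :
    (split G X hX D₁ D₂).role v = D₂.role (some ⟨v, hv⟩) := by
  rw [role, vertex_split_of_notMem hX D₁ D₂ hv, roleAt_split_inr, role]

lemma home_split_of_mem {v : V} (hv : v ∈ X) :
    (split G X hX D₁ D₂).home v = Sum.inl (D₁.home (some ⟨v, hv⟩)) := by
  rw [home, vertex_split_of_mem hX D₁ D₂ hv]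
  rfl

lemma home_split_of_notMem {v : V} (hv : v ∉ X) :
    (split G X hX D₁ D₂).home v = Sum.inr (D₂.home (some ⟨v, hv⟩)) := by
  rw [home, vertex_split_of_notMem hX D₁ D₂ hv]
  rfl

lemma marked_split_inl_inl (v w : D₁.Vertex) :
    (split G X hX D₁ D₂).marked.Adj (Sum.inl v) (Sum.inl w) ↔ D₁.marked.Adj v w := by
  simp [marked, edge_adj]

lemma marked_split_inr_inr (v w : D₂.Vertex) :
    (split G X hX D₁ D₂).marked.Adj (Sum.inr v) (Sum.inr w) ↔ D₂.marked.Adj v w := by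
  simp [marked, edge_adj]

lemma marked_split_inl_inr (v : D₁.Vertex) (w : D₂.Vertex) :
    (split G X hX D₁ D₂).marked.Adj (Sum.inl v) (Sum.inr w) ↔
      v = D₁.vertex none ∧ w = D₂.vertex none := by
  simp [marked, edge_adj]

lemma good_split : (split G X hX D₁ D₂).Good ↔
    D₁.Good ∧ D₂.Good ∧ (D₁.role none).Compatible (D₂.role none) := by
  constructor
  · rintro ⟨h1, h2⟩
    refine ⟨⟨fun b => (h1 (Sum.inl b)).iso (blockInlIso hX D₁ D₂ b).symm, fun v w hvw => ?_⟩,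
      ⟨fun b => (h1 (Sum.inr b)).iso (blockInrIso hX D₁ D₂ b).symm, fun v w hvw => ?_⟩, ?_⟩
    · have := h2 _ _ ((marked_split_inl_inl hX D₁ D₂ v w).2 hvw)
      rwa [roleAt_split_inl, roleAt_split_inl] at this
    · have := h2 _ _ ((marked_split_inr_inr hX D₁ D₂ v w).2 hvw)
      rwa [roleAt_split_inr, roleAt_split_inr] at this
    · have := h2 _ _ ((marked_split_inl_inr hX D₁ D₂ _ _).2 ⟨rfl, rfl⟩)
      rwa [roleAt_split_inl, roleAt_split_inr] at this
  · rintro ⟨⟨h1, h1'⟩, ⟨h2, h2'⟩, h⟩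
    refine ⟨?_, ?_⟩
    · rintro (b | b)
      · exact (h1 b).iso (blockInlIso hX D₁ D₂ b)
      · exact (h2 b).iso (blockInrIso hX D₁ D₂ b)
    · rintro (v | v) (w | w) hvw
      · rw [roleAt_split_inl, roleAt_split_inl]
        exact h1' v w ((marked_split_inl_inl hX D₁ D₂ v w).1 hvw)
      · obtain ⟨rfl, rfl⟩ := (marked_split_inl_inr hX D₁ D₂ v w).1 hvw
        rw [roleAt_split_inl, roleAt_split_inr]
        exact h
      · obtain ⟨rfl, rfl⟩ := (marked_split_inl_inr hX D₁ D₂ w v).1 hvw.symm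
        rw [roleAt_split_inl, roleAt_split_inr]
        exact h.symm
      · rw [roleAt_split_inr, roleAt_split_inr]
        exact h2' v w ((marked_split_inr_inr hX D₁ D₂ v w).1 hvw)

lemma tree_split_inl_inl (b c : D₁.Block) :
    (split G X hX D₁ D₂).tree.Adj (Sum.inl b) (Sum.inl c) ↔ D₁.tree.Adj b c := by
  constructor
  · rintro ⟨hbc, v | v, w | w, hvw, hv, hw⟩
    · exact ⟨fun h => hbc (congrArg _ h), v, w, (marked_split_inl_inl hX D₁ D₂ v w).1 hvw,
        Sum.inl_injective hv, Sum.inl_injective hw⟩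
    · exact (Sum.inr_ne_inl hw).elim
    · exact (Sum.inr_ne_inl hv).elim
    · exact (Sum.inr_ne_inl hv).elim
  · rintro ⟨hbc, v, w, hvw, hv, hw⟩
    exact ⟨fun h => hbc (Sum.inl_injective h), _, _, (marked_split_inl_inl hX D₁ D₂ v w).2 hvw,
      congrArg Sum.inl hv, congrArg Sum.inl hw⟩

lemma tree_split_inr_inr (b c : D₂.Block) :
    (split G X hX D₁ D₂).tree.Adj (Sum.inr b) (Sum.inr c) ↔ D₂.tree.Adj b c := by
  constructor
  · rintro ⟨hbc, v | v, w | w, hvw, hv, hw⟩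
    · exact (Sum.inl_ne_inr hv).elim
    · exact (Sum.inl_ne_inr hv).elim
    · exact (Sum.inl_ne_inr hw).elim
    · exact ⟨fun h => hbc (congrArg _ h), v, w, (marked_split_inr_inr hX D₁ D₂ v w).1 hvw,
        Sum.inr_injective hv, Sum.inr_injective hw⟩
  · rintro ⟨hbc, v, w, hvw, hv, hw⟩
    exact ⟨fun h => hbc (Sum.inr_injective h), _, _, (marked_split_inr_inr hX D₁ D₂ v w).2 hvw,
      congrArg Sum.inr hv, congrArg Sum.inr hw⟩

lemma tree_split_inl_inr (b : D₁.Block) (c : D₂.Block) :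
    (split G X hX D₁ D₂).tree.Adj (Sum.inl b) (Sum.inr c) ↔
      b = D₁.home none ∧ c = D₂.home none := by
  constructor
  · rintro ⟨-, v | v, w | w, hvw, hv, hw⟩
    · exact (Sum.inl_ne_inr hw).elim
    · obtain ⟨rfl, rfl⟩ := (marked_split_inl_inr hX D₁ D₂ v w).1 hvw
      exact ⟨(Sum.inl_injective hv).symm, (Sum.inr_injective hw).symm⟩
    · exact (Sum.inr_ne_inl hv).elim
    · exact (Sum.inr_ne_inl hv).elim
  · rintro ⟨rfl, rfl⟩
    exact ⟨Sum.inl_ne_inr, _, _, (marked_split_inl_inr hX D₁ D₂ _ _).2 ⟨rfl, rfl⟩, rfl, rfl⟩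

end Split

instance blockFintype {V : Type u} {G : SimpleGraph V} : (D : Decomposition G) → Fintype D.Block
  | single _ => inferInstanceAs (Fintype Unit)
  | split _ _ _ D₁ D₂ =>
    letI := blockFintype D₁
    letI := blockFintype D₂
    inferInstanceAs (Fintype (D₁.Block ⊕ D₂.Block))

open Classical in
/-- The number of markers in a block. -/
noncomputable def deg {V : Type u} {G : SimpleGraph V} : (D : Decomposition G) → D.Block → ℕ
  | single _, _ => 0
  | split _ _ _ D₁ D₂, b => Sum.elim (fun b => D₁.deg b + if D₁.home none = b then 1 else 0)
      (fun b => D₂.deg b + if D₂.home none = b then 1 else 0) b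

/-- The number of vertices of a block. -/
noncomputable def size {V : Type u} {G : SimpleGraph V} : (D : Decomposition G) → D.Block → ℕ
  | single (V := V) _, _ => Nat.card V
  | split _ _ _ D₁ D₂, b => Sum.elim D₁.size D₂.size b

lemma card_block_split {X : Set V} (hX : IsSplit G X) (D₁ : Decomposition (splitPart G X))
    (D₂ : Decomposition (splitPart G Xᶜ)) :
    Fintype.card (split G X hX D₁ D₂).Block = Fintype.card D₁.Block + Fintype.card D₂.Block :=
  Fintype.card_sum

lemma sum_deg {V : Type u} {G : SimpleGraph V} (D : Decomposition G) :
    ∑ b, D.deg b + 2 = 2 * Fintype.card D.Block := by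
  induction D with
  | single G => rfl
  | split G X hX D₁ D₂ ih₁ ih₂ =>
    classical
    rw [card_block_split]
    have : ∑ b, (split G X hX D₁ D₂).deg b =
        ∑ b, (split G X hX D₁ D₂).deg (Sum.inl b) + ∑ b, (split G X hX D₁ D₂).deg (Sum.inr b) :=
      Fintype.sum_sum_type _
    rw [this]
    simp only [deg, Sum.elim_inl, Sum.elim_inr, Finset.sum_add_distrib, Finset.sum_ite_eq, Finset.mem_univ, if_true]
    omega

lemma sum_size {V : Type u} {G : SimpleGraph V} (D : Decomposition G) : Finite V →
    ∑ b, D.size b + 2 = Nat.card V + 2 * Fintype.card D.Block := by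
  induction D with
  | single G =>
    intro _
    rfl
  | @split V G X hX D₁ D₂ ih₁ ih₂ =>
    intro _
    rw [card_block_split]
    have : ∑ b, (split G X hX D₁ D₂).size b =
        ∑ b, (split G X hX D₁ D₂).size (Sum.inl b) + ∑ b, (split G X hX D₁ D₂).size (Sum.inr b) :=
      Fintype.sum_sum_type _
    rw [this]
    simp only [size, Sum.elim_inl, Sum.elim_inr]
    have h1 := ih₁ inferInstance
    have h2 := ih₂ inferInstance
    rw [Finite.card_option] at h1 h2
    have h3 : Nat.card {x // x ∈ X} + Nat.card {x // x ∈ Xᶜ} = Nat.card V :=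
      Set.ncard_add_ncard_compl X
    omega

lemma three_le_size {V : Type u} {G : SimpleGraph V} (D : Decomposition G) : Finite V → D.Good →
    ∀ b, 3 ≤ D.size b := by
  induction D with
  | @single V G =>
    intro _ h b
    have := (good_single.1 h).three_le
    rw [ENat.card_eq_coe_natCard] at this
    exact_mod_cast this
  | split G X hX D₁ D₂ ih₁ ih₂ =>
    rintro _ h (b | b)
    · exact ih₁ inferInstance ((good_split hX D₁ D₂).1 h).1 b
    · exact ih₂ inferInstance ((good_split hX D₁ D₂).1 h).2.1 b

lemma deg_eq_ncard {V : Type u} {G : SimpleGraph V} (D : Decomposition G) (b : D.Block) :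
    D.deg b = (D.tree.neighborSet b).ncard := by
  induction D with
  | single G =>
    symm
    change _ = 0
    rw [Set.ncard_eq_zero (Set.toFinite _)]
    ext c
    simp only [mem_neighborSet, Set.mem_empty_iff_false, iff_false]
    rintro ⟨h, -⟩
    exact h rfl
  | split G X hX D₁ D₂ ih₁ ih₂ =>
    rcases b with b | b
    · rw [deg, Sum.elim_inl, ih₁]
      have : (split G X hX D₁ D₂).tree.neighborSet (Sum.inl b) =
          Sum.inl '' D₁.tree.neighborSet b ∪
            Sum.inr '' {c | D₁.home none = b ∧ c = D₂.home none} := by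
        ext (c | c)
        · simp [tree_split_inl_inl]
        · simp [tree_split_inl_inr, eq_comm]
      rw [this, Set.ncard_union_eq, Set.ncard_image_of_injective _ Sum.inl_injective,
        Set.ncard_image_of_injective _ Sum.inr_injective]
      · congr 1
        split_ifs with h <;> simp [h]
      · rw [Set.disjoint_iff_forall_ne]
        rintro _ ⟨a, -, rfl⟩ _ ⟨c, -, rfl⟩
        exact Sum.inl_ne_inr
    · rw [deg, Sum.elim_inr, ih₂]
      have : (split G X hX D₁ D₂).tree.neighborSet (Sum.inr b) =
          Sum.inr '' D₂.tree.neighborSet b ∪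
            Sum.inl '' {c | D₂.home none = b ∧ c = D₁.home none} := by
        ext (c | c)
        · simp only [mem_neighborSet, adj_comm, tree_split_inl_inr]
          simp [and_comm, eq_comm]
        · simp [tree_split_inr_inr]
      rw [this, Set.ncard_union_eq, Set.ncard_image_of_injective _ Sum.inl_injective,
        Set.ncard_image_of_injective _ Sum.inr_injective]
      · congr 1
        split_ifs with h <;> simp [h]
      · rw [Set.disjoint_iff_forall_ne]
        rintro _ ⟨a, -, rfl⟩ _ ⟨c, -, rfl⟩
        exact Sum.inr_ne_inl

end Decomposition

/-! ### The parts of a split -/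

section Parts

variable {V : Type u} {G : SimpleGraph V}

/-- A part of a split is isomorphic to an induced subgraph. -/
noncomputable def splitPartEmbedding {X : Set V} (h : CutComplete G X) {y : V} (hy : y ∉ X)
    (hxy : ∃ x ∈ X, G.Adj x y) : splitPart G X ↪g G where
  toFun
    | some x => x
    | none => y
  inj' := by
    rintro (_ | ⟨a, ha⟩) (_ | ⟨b, hb⟩) hab
    · rfl
    · exact absurd hb (by simp only at hab; exact hab ▸ hy)
    · exact absurd ha (by simp only at hab; exact hab ▸ hy)
    · simp only at hab
      subst hab
      rfl
  map_rel_iff' := by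
    obtain ⟨x₀, hx₀, h₀⟩ := hxy
    rintro (_ | ⟨a, ha⟩) (_ | ⟨b, hb⟩)
    · simp [splitPart]
    · exact ⟨fun h' => ⟨y, hy, h'.symm⟩, fun ⟨z, hz, hbz⟩ => (h hb hx₀ hz hy hbz h₀).symm⟩
    · exact ⟨fun h' => ⟨y, hy, h'⟩, fun ⟨z, hz, hbz⟩ => h ha hx₀ hz hy hbz h₀⟩
    · exact Iff.rfl

lemma exists_splitPartEmbedding [Finite V] {X : Set V} (hX : IsSplit G X) :
    ∃ f : splitPart G X ↪g G, ∀ x, f (some x) = x := by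
  obtain ⟨-, -, h, x, hx, y, hy, hxy⟩ := isSplit_iff.1 hX
  exact ⟨splitPartEmbedding h hy ⟨x, hx, hxy⟩, fun _ => rfl⟩

lemma exists_splitPartEmbedding_compl [Finite V] {X : Set V} (hX : IsSplit G X) :
    ∃ f : splitPart G Xᶜ ↪g G, ∀ x, f (some x) = x :=
  exists_splitPartEmbedding hX.compl

lemma connected_of_contraction {W : Type*} {H : SimpleGraph W} (hG : G.Connected) (g : V → W)
    (hg : Function.Surjective g) (h : ∀ a b, G.Adj a b → g a = g b ∨ H.Adj (g a) (g b)) :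
    H.Connected := by
  have key : ∀ a b, G.Reachable a b → H.Reachable (g a) (g b) := by
    rintro a b ⟨p⟩
    induction p with
    | nil => exact Reachable.refl _
    | cons hadj p ih =>
      rcases h _ _ hadj with h | h
      · rwa [h]
      · exact h.reachable.trans ih
  have := hG.nonempty
  have : Nonempty W := this.map g
  refine ⟨fun x y => ?_⟩
  obtain ⟨a, rfl⟩ := hg x
  obtain ⟨b, rfl⟩ := hg y
  exact key a b (hG.preconnected a b)

lemma connected_splitPart (hG : G.Connected) {X : Set V} (hX : Xᶜ.Nonempty) :
    (splitPart G X).Connected := by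
  classical
  refine connected_of_contraction hG (fun v => if h : v ∈ X then some ⟨v, h⟩ else none) ?_ ?_
  · rintro (_ | ⟨x, hx⟩)
    · obtain ⟨y, hy⟩ := hX
      exact ⟨y, dif_neg hy⟩
    · exact ⟨x, dif_pos hx⟩
  · intro a b hab
    by_cases ha : a ∈ X <;> by_cases hb : b ∈ X <;> simp only [ha, hb, dite_true, dite_false]
    · exact Or.inr hab
    · exact Or.inr ⟨b, hb, hab⟩
    · exact Or.inr ⟨a, ha, hab.symm⟩
    · exact Or.inl trivial

lemma three_le_natCard_option {X : Set V} [Finite V] (hX : X.Nontrivial) :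
    3 ≤ Nat.card (Option {x // x ∈ X}) := by
  rw [Finite.card_option]
  have : 1 < X.ncard := Set.one_lt_ncard_iff_nontrivial.2 hX
  change 3 ≤ X.ncard + 1
  omega

end Parts


/-! ### Existence of canonical decompositions -/

lemma isDegenerate_of_two_adj {V : Type*} {G : SimpleGraph V} {a b c : V} (hab : a ≠ b)
    (h : ∀ v, v = a ∨ v = b ∨ v = c) (hac : G.Adj a c) (hbc : G.Adj b c) : IsDegenerate G := by
  classical
  have h3 : 3 ≤ ENat.card V := by
    have h1 : ({a, b, c} : Set V).encard = 3 :=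
      Set.encard_eq_three.2 ⟨a, b, c, hab, hac.ne, hbc.ne, rfl⟩
    rw [← h1, ← Set.encard_univ]
    exact Set.encard_le_encard (Set.subset_univ _)
  by_cases hadj : G.Adj a b
  · refine Or.inl ⟨h3, fun x y => ⟨fun h => h.ne, fun hxy => ?_⟩⟩
    rcases h x with rfl | rfl | rfl <;> rcases h y with rfl | rfl | rfl <;>
      simp_all [adj_comm]
  · refine Or.inr ⟨c, h3, fun x y => ?_⟩
    have h1 := hac.ne
    have h2 := hbc.ne
    have h4 : ¬ G.Adj b a := fun h => hadj h.symm
    rcases h x with rfl | rfl | rfl <;> rcases h y with rfl | rfl | rfl <;>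
      simp_all [adj_comm, Ne.symm]

lemma isDegenerate_of_card_eq_three {V : Type*} {G : SimpleGraph V} (hG : G.Connected)
    (h3 : Nat.card V = 3) : IsDegenerate G := by
  classical
  have : Finite V := Nat.finite_of_card_ne_zero (by omega)
  let := Fintype.ofFinite V
  rw [Nat.card_eq_fintype_card] at h3
  obtain ⟨a, b, c, hab, hac, hbc, habc⟩ := Finset.card_eq_three.1 ((Finset.card_univ).trans h3)
  have h : ∀ v, v = a ∨ v = b ∨ v = c := fun v => by
    have := Finset.mem_univ v
    rw [habc] at this
    simpa using this
  have key : ∀ v w, v ≠ w → ∃ z, G.Adj v z := fun v w hvw => by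
    obtain ⟨p⟩ := hG.preconnected v w
    exact ⟨_, p.adj_snd (p.not_nil_of_ne hvw)⟩
  obtain ⟨a', ha⟩ := key a b hab
  obtain ⟨b', hb⟩ := key b a hab.symm
  obtain ⟨c', hc⟩ := key c a hac.symm
  rcases h a' with rfl | rfl | rfl
  · exact (G.irrefl ha).elim
  · rcases h c' with rfl | rfl | rfl
    · exact isDegenerate_of_two_adj hbc (fun v => by have := h v; tauto) ha.symm hc
    · exact isDegenerate_of_two_adj hac (fun v => by have := h v; tauto) ha hc
    · exact (G.irrefl hc).elim
  · rcases h b' with rfl | rfl | rfl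
    · exact isDegenerate_of_two_adj hbc (fun v => by have := h v; tauto) hb ha.symm
    · exact (G.irrefl hb).elim
    · exact isDegenerate_of_two_adj hab h ha hb

lemma IsDegenerate.exists_adj {V : Type*} {G : SimpleGraph V} (h : IsDegenerate G) (x : V) :
    ∃ a, G.Adj x a := by
  rcases h with h | ⟨c, h⟩
  · obtain ⟨a, ha, -⟩ := exists_ne_ne_of_three_le h.1 x x
    exact ⟨a, (h.2 x a).2 ha.symm⟩
  · by_cases hx : x = c
    · obtain ⟨a, ha, -⟩ := exists_ne_ne_of_three_le h.1 x x
      exact ⟨a, (h.2 x a).2 ⟨ha.symm, Or.inl hx⟩⟩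
    · exact ⟨c, (h.2 x c).2 ⟨hx, Or.inr rfl⟩⟩

lemma exists_splitPart_iso {V V' : Type u} {G : SimpleGraph V} {G' : SimpleGraph V'} {f : V → V'}
    (hf : Function.Injective f) (hadj : ∀ a b, G'.Adj (f a) (f b) ↔ G.Adj a b) {X : Set V}
    {X' : Set V'} (hX : ∀ a, f a ∈ X' ↔ a ∈ X) (hX' : ∀ v ∈ X', ∃ a, f a = v)
    (hacc : ∀ a ∈ X, (∃ z, z ∉ X' ∧ G'.Adj (f a) z) ↔ ∃ z, z ∉ X ∧ G.Adj a z) :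
    ∃ e : splitPart G X ≃g splitPart G' X', e none = none ∧
      ∀ a (ha : a ∈ X), e (some ⟨a, ha⟩) = some ⟨f a, (hX a).2 ha⟩ := by
  let g : {x // x ∈ X} → {x // x ∈ X'} := fun a => ⟨f a.1, (hX a.1).2 a.2⟩
  have hg : Function.Bijective g := by
    constructor
    · intro a b hab
      exact Subtype.ext (hf (congrArg Subtype.val hab))
    · rintro ⟨v, hv⟩
      obtain ⟨a, rfl⟩ := hX' v hv
      exact ⟨⟨a, (hX a).1 hv⟩, rfl⟩
  refine ⟨⟨(Equiv.ofBijective g hg).optionCongr, ?_⟩, rfl, fun a ha => rfl⟩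
  rintro (_ | ⟨a, ha⟩) (_ | ⟨b, hb⟩)
  · exact Iff.rfl
  · exact hacc b hb
  · exact hacc a ha
  · exact hadj a b

namespace Decomposition

lemma Good.exists_iso {V : Type u} {G : SimpleGraph V} (D : Decomposition G) : D.Good → Finite V →
    ∀ {V' : Type u} {G' : SimpleGraph V'} (e : G ≃g G'),
      ∃ D' : Decomposition G', D'.Good ∧ ∀ z, D'.role (e z) = D.role z := by
  induction D with
  | @single V G =>
    intro h _ V' G' e
    exact ⟨single G', good_single.2 ((good_single.1 h).iso e), fun z => by simp [roleIn_iso]⟩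
  | @split V G X hX D₁ D₂ ih₁ ih₂ =>
    intro h _ V' G' e
    obtain ⟨h₁, h₂, h₁₂⟩ := (good_split hX D₁ D₂).1 h
    have : Finite V' := Finite.of_equiv V e.toEquiv
    have hmem : ∀ a, e a ∈ e '' X ↔ a ∈ X := fun a => e.injective.mem_set_image
    have hX' : IsSplit G' (e '' X) := by
      rw [isSplit_iff] at hX ⊢
      obtain ⟨k1, k2, k3, x, hx, y, hy, hxy⟩ := hX
      refine ⟨k1.image e.injective, ?_, ?_, e x, (hmem x).2 hx, e y, fun h => hy ((hmem y).1 h),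
        e.map_adj_iff.2 hxy⟩
      · rw [← Set.image_compl_eq e.bijective]
        exact k2.image e.injective
      · intro x₁ m₁ x₂ m₂ y₁ n₁ y₂ n₂
        obtain ⟨x₁, rfl⟩ := e.surjective x₁
        obtain ⟨x₂, rfl⟩ := e.surjective x₂
        obtain ⟨y₁, rfl⟩ := e.surjective y₁
        obtain ⟨y₂, rfl⟩ := e.surjective y₂
        rw [hmem] at m₁ m₂ n₁ n₂
        rw [e.map_adj_iff, e.map_adj_iff, e.map_adj_iff]
        exact k3 m₁ m₂ n₁ n₂
    have key : ∀ (Y : Set V) (Y' : Set V'), (∀ a, e a ∈ Y' ↔ a ∈ Y) →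
        ∀ a ∈ Y, (∃ z, z ∉ Y' ∧ G'.Adj (e a) z) ↔ ∃ z, z ∉ Y ∧ G.Adj a z := by
      intro Y Y' hY a _
      rw [e.surjective.exists]
      simp [hY, e.map_adj_iff]
    obtain ⟨e₁, e₁n, e₁s⟩ := exists_splitPart_iso e.injective (fun a b => e.map_adj_iff) hmem
      (fun v _ => e.surjective v) (key X _ hmem)
    obtain ⟨e₂, e₂n, e₂s⟩ := exists_splitPart_iso (X := Xᶜ) (X' := (e '' X)ᶜ) e.injective
      (fun a b => e.map_adj_iff) (fun a => not_congr (hmem a))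
      (fun v _ => e.surjective v) (key Xᶜ _ fun a => not_congr (hmem a))
    obtain ⟨D₁', g₁, r₁⟩ := ih₁ h₁ inferInstance e₁
    obtain ⟨D₂', g₂, r₂⟩ := ih₂ h₂ inferInstance e₂
    refine ⟨split G' _ hX' D₁' D₂', (good_split hX' D₁' D₂').2 ⟨g₁, g₂, ?_⟩, fun z => ?_⟩
    · have k1 := r₁ none
      have k2 := r₂ none
      rw [e₁n] at k1
      rw [e₂n] at k2
      rw [k1, k2]
      exact h₁₂
    · by_cases hz : z ∈ X
      · rw [role_split_of_mem hX D₁ D₂ hz, role_split_of_mem hX' D₁' D₂' ((hmem z).2 hz), ← r₁,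
          e₁s]
      · rw [role_split_of_notMem hX D₁ D₂ hz,
          role_split_of_notMem hX' D₁' D₂' (fun h => hz ((hmem z).1 h)), ← r₂, e₂s z hz]

end Decomposition

/-- `G'` is obtained from `G` by adding a vertex `y` that is a true twin, a false twin or a pendant
neighbour of `x`; the role `κ` is that of the marker in the block with the vertices `x`, `y` and
one marker. -/
structure IsTwinExtension {V V' : Type*} (G : SimpleGraph V) (G' : SimpleGraph V') (f : V → V')
    (x : V) (y : V') (κ : Role) : Prop where
  inj : Function.Injective f
  adj : ∀ a b, G'.Adj (f a) (f b) ↔ G.Adj a b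
  ne : ∀ a, f a ≠ y
  cover : ∀ v, v = y ∨ ∃ a, f a = v
  adj_ne : ∀ a, a ≠ x → (G'.Adj y (f a) ↔ κ ≠ .leaf ∧ G.Adj x a)
  adj_base : G'.Adj y (f x) ↔ κ ≠ .centre

namespace IsTwinExtension

variable {V V' : Type u} {G : SimpleGraph V} {G' : SimpleGraph V'} {f : V → V'} {x : V} {y : V'}
  {κ : Role}

lemma exists_retraction (h : IsTwinExtension G G' f x y κ) :
    ∃ g : V' → V, (∀ a, g (f a) = a) ∧ g y = x := by
  classical
  have : Nonempty V := ⟨x⟩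
  refine ⟨fun v => if v = y then x else Function.invFun f v, fun a => ?_, if_pos rfl⟩
  simp only [h.ne a, if_false]
  exact Function.leftInverse_invFun h.inj a

lemma isSplit [Finite V] [Finite V'] (h : IsTwinExtension G G' f x y κ) {X : Set V} {X' : Set V'}
    (hX : ∀ a, f a ∈ X' ↔ a ∈ X) (hyx : y ∈ X' ↔ x ∈ X) (hs : IsSplit G X) : IsSplit G' X' := by
  obtain ⟨g, hg, hgy⟩ := h.exists_retraction
  have hmem : ∀ v, g v ∈ X ↔ v ∈ X' := by
    intro v
    rcases h.cover v with rfl | ⟨a, rfl⟩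
    · rw [hgy, hyx]
    · rw [hg, hX]
  have hcross : ∀ v ∈ X', ∀ w ∉ X', (G'.Adj v w ↔
      (v = y → κ ≠ .leaf) ∧ (w = y → κ ≠ .leaf) ∧ G.Adj (g v) (g w)) := by
    intro v hv w hw
    rcases h.cover v with rfl | ⟨a, rfl⟩ <;> rcases h.cover w with rfl | ⟨b, rfl⟩
    · exact absurd hv hw
    · rw [hgy, hg, h.adj_ne]
      · simp [h.ne]
      · rintro rfl
        exact hw ((hX b).2 (hyx.1 hv))
    · rw [hgy, hg, adj_comm, h.adj_ne, G.adj_comm]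
      · simp [h.ne]
      · rintro rfl
        exact hw (hyx.2 ((hX a).1 hv))
    · simp [hg, h.adj, h.ne]
  rw [isSplit_iff] at hs ⊢
  obtain ⟨k1, k2, k3, a, ha, b, hb, hab⟩ := hs
  refine ⟨?_, ?_, ?_, f a, (hX a).2 ha, f b, fun h => hb ((hX b).1 h), (h.adj a b).2 hab⟩
  · refine (k1.image h.inj).mono ?_
    rintro _ ⟨a, ha, rfl⟩
    exact (hX a).2 ha
  · refine (k2.image h.inj).mono ?_
    rintro _ ⟨a, ha, rfl⟩
    exact fun h => ha ((hX a).1 h)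
  · intro x₁ m₁ x₂ m₂ y₁ n₁ y₂ n₂ a₁ a₂
    rw [hcross _ m₁ _ n₁] at a₁
    rw [hcross _ m₂ _ n₂] at a₂
    rw [hcross _ m₁ _ n₂]
    exact ⟨a₁.1, a₂.2.1, k3 ((hmem _).2 m₁) ((hmem _).2 m₂) (fun h => n₁ ((hmem _).1 h))
      (fun h => n₂ ((hmem _).1 h)) a₁.2.2 a₂.2.2⟩

/-- The part of the split that contains the twins. -/
lemma splitPart (h : IsTwinExtension G G' f x y κ) {X : Set V} {X' : Set V'}
    (hX : ∀ a, f a ∈ X' ↔ a ∈ X) (hx : x ∈ X) (hy : y ∈ X') :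
    IsTwinExtension (SplitTree.splitPart G X) (SplitTree.splitPart G' X')
      (Option.map fun a : {a // a ∈ X} => (⟨f a, (hX a).2 a.2⟩ : {v // v ∈ X'}))
      (some ⟨x, hx⟩) (some ⟨y, hy⟩) κ where
  inj := by
    apply Option.map_injective
    intro a b hab
    exact Subtype.ext (h.inj (congrArg Subtype.val hab))
  adj := by
    have key : ∀ a ∈ X, (∃ z, z ∉ X' ∧ G'.Adj (f a) z) ↔ ∃ z, z ∉ X ∧ G.Adj a z := by
      intro a _
      constructor
      · rintro ⟨z, hz, haz⟩
        rcases h.cover z with rfl | ⟨b, rfl⟩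
        · exact absurd hy hz
        · exact ⟨b, fun hb => hz ((hX b).2 hb), (h.adj a b).1 haz⟩
      · rintro ⟨b, hb, hab⟩
        exact ⟨f b, fun h => hb ((hX b).1 h), (h.adj a b).2 hab⟩
    rintro (_ | ⟨a, ha⟩) (_ | ⟨b, hb⟩)
    · exact Iff.rfl
    · exact key b hb
    · exact key a ha
    · exact h.adj a b
  ne := by
    rintro (_ | a) ha
    · cases ha
    · exact h.ne a.1 (congrArg Subtype.val (Option.some_injective _ ha))
  cover := by
    rintro (_ | ⟨v, hv⟩)
    · exact Or.inr ⟨none, rfl⟩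
    · rcases h.cover v with rfl | ⟨a, rfl⟩
      · exact Or.inl rfl
      · exact Or.inr ⟨some ⟨a, (hX a).1 hv⟩, rfl⟩
  adj_ne := by
    rintro (_ | ⟨a, ha⟩) hax
    · change (∃ z, z ∉ X' ∧ G'.Adj y z) ↔ _ ∧ ∃ z, z ∉ X ∧ G.Adj x z
      constructor
      · rintro ⟨z, hz, hyz⟩
        rcases h.cover z with rfl | ⟨b, rfl⟩
        · exact absurd hy hz
        · have hb : b ∉ X := fun hb => hz ((hX b).2 hb)
          rw [h.adj_ne b (fun hbx => hb (hbx ▸ hx))] at hyz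
          exact ⟨hyz.1, b, hb, hyz.2⟩
      · rintro ⟨hκ, b, hb, hxb⟩
        exact ⟨f b, fun h => hb ((hX b).1 h), (h.adj_ne b (fun hbx => hb (hbx ▸ hx))).2 ⟨hκ, hxb⟩⟩
    · refine h.adj_ne a ?_
      rintro rfl
      exact hax rfl
  adj_base := h.adj_base

/-- The part of the split that does not contain the twins. -/
lemma exists_splitPart_iso (h : IsTwinExtension G G' f x y κ) {X : Set V} {X' : Set V'}
    (hX : ∀ a, f a ∈ X' ↔ a ∈ X) (hx : x ∉ X) (hy : y ∉ X') :
    ∃ e : SplitTree.splitPart G X ≃g SplitTree.splitPart G' X', e none = none ∧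
      ∀ a (ha : a ∈ X), e (some ⟨a, ha⟩) = some ⟨f a, (hX a).2 ha⟩ := by
  refine SplitTree.exists_splitPart_iso h.inj h.adj hX (fun v hv => ?_) (fun a ha => ?_)
  · refine (h.cover v).resolve_left ?_
    rintro rfl
    exact hy hv
  · constructor
    · rintro ⟨z, hz, haz⟩
      rcases h.cover z with rfl | ⟨b, rfl⟩
      · have := (h.adj_ne a (fun hax => hx (hax ▸ ha))).1 haz.symm
        exact ⟨x, hx, this.2.symm⟩
      · exact ⟨b, fun hb => hz ((hX b).2 hb), (h.adj a b).1 haz⟩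
    · rintro ⟨b, hb, hab⟩
      exact ⟨f b, fun h => hb ((hX b).1 h), (h.adj a b).2 hab⟩

open Decomposition

/-- A clique or star in which the new vertex can be included. -/
lemma isDegenerate (h : IsTwinExtension G G' f x y κ) (hG : IsDegenerate G)
    (hκ : ¬ κ.Compatible (roleIn G x)) :
    IsDegenerate G' ∧ ∀ z, roleIn G' (f z) = roleIn G z := by
  classical
  obtain ⟨g, hg, hgy⟩ := h.exists_retraction
  let ρ : V' → Role := fun v =>
    if v = y then (if κ = .clique then .clique else .leaf) else roleIn G (g v)
  have hρf : ∀ a, ρ (f a) = roleIn G a := fun a => by simp [ρ, h.ne, hg]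
  have hρy : ρ y = if κ = .clique then .clique else .leaf := if_pos rfl
  have hy : ∀ a, G'.Adj y (f a) ↔ ρ y ≠ .leaf ∨ ρ (f a) ≠ .leaf := by
    intro a
    rw [hρf, hρy]
    by_cases hax : a = x
    · subst hax
      rw [h.adj_base]
      revert hκ
      cases κ <;> cases roleIn G a <;> simp [Role.Compatible]
    · rw [h.adj_ne a hax, hG.adj_iff_role (Ne.symm hax)]
      rcases hG.roles with hr | ⟨c, hc, hr⟩
      · rw [hr] at hκ ⊢
        revert hκ
        cases κ <;> simp [Role.Compatible, hr]
      · by_cases hxc : x = c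
        · subst hxc
          rw [hc] at hκ ⊢
          rw [hr a hax]
          revert hκ
          cases κ <;> simp [Role.Compatible]
        · rw [hr x hxc] at hκ ⊢
          revert hκ
          cases κ <;> simp [Role.Compatible]
  suffices hs : IsDegenerate G' ∧ ∀ v, roleIn G' v = ρ v from
    ⟨hs.1, fun z => by rw [hs.2, hρf]⟩
  refine isDegenerate_of_roles (hG.three_le.trans (ENat.card_le_card_of_injective h.inj)) ρ ?_ ?_
  · intro v w hvw
    rcases h.cover v with rfl | ⟨a, rfl⟩ <;> rcases h.cover w with rfl | ⟨b, rfl⟩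
    · exact absurd rfl hvw
    · exact hy b
    · rw [adj_comm, hy, or_comm]
    · rw [h.adj, hρf, hρf, hG.adj_iff_role fun hab => hvw (congrArg f hab)]
  · rcases hG.roles with hr | ⟨c, hc, hr⟩
    · left
      intro v
      rcases h.cover v with rfl | ⟨a, rfl⟩
      · rw [hρy]
        rw [hr] at hκ
        revert hκ
        cases κ <;> simp [Role.Compatible]
      · rw [hρf, hr]
    · refine Or.inr ⟨f c, by rw [hρf, hc], fun v hv => ?_⟩
      rcases h.cover v with rfl | ⟨a, rfl⟩
      · rw [hρy]
        revert hκ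
        have : roleIn G x ≠ .clique := by
          by_cases hxc : x = c
          · simp [hxc, hc]
          · simp [hr x hxc]
        revert this
        cases κ <;> cases roleIn G x <;> simp [Role.Compatible]
      · rw [hρf]
        refine hr a ?_
        rintro rfl
        exact hv rfl

/-- A new block for the new vertex. -/
lemma exists_good_of_compatible [Finite V] [Finite V'] (h : IsTwinExtension G G' f x y κ)
    (hG : IsDegenerate G) (hκ : κ.Compatible (roleIn G x)) :
    ∃ D' : Decomposition G', D'.Good ∧ ∀ z, z ≠ x → D'.role (f z) = roleIn G z := by
  classical
  set X' : Set V' := {f x, y} with hX'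
  have hmem : ∀ a, f a ∈ X' ↔ a = x := fun a => by simp [hX', h.ne, h.inj.eq_iff]
  have hout : ∀ v, v ∉ X' → ∃ a, a ≠ x ∧ f a = v := by
    intro v hv
    obtain rfl | ⟨a, rfl⟩ := h.cover v
    · exact absurd (Or.inr rfl) hv
    · exact ⟨a, fun hax => hv ((hmem a).2 hax), rfl⟩
  have hacc : ∀ a, a ≠ x → ((∃ z ∈ X', G'.Adj (f a) z) ↔ G.Adj a x) := by
    intro a ha
    constructor
    · rintro ⟨z, rfl | rfl, hz⟩
      · exact (h.adj a x).1 hz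
      · exact ((h.adj_ne a ha).1 hz.symm).2.symm
    · intro hax
      exact ⟨f x, Or.inl rfl, (h.adj a x).2 hax⟩
  obtain ⟨n, hxn⟩ := hG.exists_adj x
  have hsplit : IsSplit G' X' := by
    rw [isSplit_iff]
    refine ⟨⟨f x, Or.inl rfl, y, Or.inr rfl, h.ne x⟩, ?_, ?_, f x, Or.inl rfl, f n,
      fun hn => hxn.ne' ((hmem n).1 hn), (h.adj x n).2 hxn⟩
    · obtain ⟨a, ha, -⟩ := exists_ne_ne_of_three_le hG.three_le x x
      obtain ⟨b, hb, hba⟩ := exists_ne_ne_of_three_le hG.three_le x a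
      exact ⟨f a, fun h' => ha ((hmem a).1 h'), f b, fun h' => hb ((hmem b).1 h'),
        fun h' => hba (h.inj h').symm⟩
    · intro x₁ m₁ x₂ m₂ y₁ n₁ y₂ n₂ a₁ a₂
      obtain ⟨b₁, hb₁, rfl⟩ := hout y₁ n₁
      obtain ⟨b₂, hb₂, rfl⟩ := hout y₂ n₂
      have hb : G.Adj x b₂ := ((hacc b₂ hb₂).1 ⟨x₂, m₂, a₂.symm⟩).symm
      rcases m₁ with rfl | rfl
      · exact (h.adj x b₂).2 hb
      · exact (h.adj_ne b₂ hb₂).2 ⟨((h.adj_ne b₁ hb₁).1 a₁).1, hb⟩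
  -- the new block
  have hx' : f x ∈ X' := Or.inl rfl
  have hy' : y ∈ X' := Or.inr rfl
  have hnone : ∀ v (hv : v ∈ X'), (SplitTree.splitPart G' X').Adj none (some ⟨v, hv⟩) ↔
      v = f x ∨ κ ≠ .leaf := by
    intro v hv
    change (∃ z, z ∉ X' ∧ G'.Adj v z) ↔ _
    constructor
    · rintro ⟨z, hz, hvz⟩
      obtain ⟨a, ha, rfl⟩ := hout z hz
      rcases hv with rfl | rfl
      · exact Or.inl rfl
      · exact Or.inr ((h.adj_ne a ha).1 hvz).1
    · intro hv'
      refine ⟨f n, fun hn => hxn.ne' ((hmem n).1 hn), ?_⟩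
      rcases hv with rfl | rfl
      · exact (h.adj x n).2 hxn
      · exact (h.adj_ne n hxn.ne').2 ⟨hv'.resolve_left (Ne.symm (h.ne x)), hxn⟩
  have hxy : (SplitTree.splitPart G' X').Adj (some ⟨y, hy'⟩) (some ⟨f x, hx'⟩) ↔ κ ≠ .centre :=
    h.adj_base
  let ρ : Option {v // v ∈ X'} → Role := fun o =>
    match κ with
    | .clique => .clique
    | .centre => if o = none then .centre else .leaf
    | .leaf => if o = some ⟨f x, hx'⟩ then .centre else .leaf
  have hcard : 3 ≤ ENat.card (Option {v // v ∈ X'}) := by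
    rw [ENat.card_eq_coe_natCard]
    exact_mod_cast three_le_natCard_option (isSplit_iff.1 hsplit).1
  obtain ⟨d₁, r₁⟩ := isDegenerate_of_roles (G := SplitTree.splitPart G' X') hcard ρ (by
    have hyx := h.ne x
    have hcases : ∀ o : Option {v // v ∈ X'}, o = none ∨ o = some ⟨f x, hx'⟩ ∨
        o = some ⟨y, hy'⟩ := by
      rintro (_ | ⟨v, rfl | rfl⟩) <;> simp
    intro v w hvw
    rcases hcases v with rfl | rfl | rfl <;> rcases hcases w with rfl | rfl | rfl <;>
      first
      | exact absurd rfl hvw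
      | (simp only [hnone, hxy, adj_comm _ (some _) none,
          adj_comm _ (some (⟨f x, hx'⟩ : {v // v ∈ X'})) (some ⟨y, hy'⟩), ρ]
         cases κ <;> simp [hyx.symm])) (by
    rcases κ with _ | _ | _
    · exact Or.inl fun _ => rfl
    · exact Or.inr ⟨none, if_pos rfl, fun o ho => if_neg ho⟩
    · exact Or.inr ⟨some ⟨f x, hx'⟩, if_pos rfl, fun o ho => if_neg ho⟩)
  have hρ : ρ none = κ := by
    simp only [ρ]
    cases κ <;> simp
  -- the old block
  let e₀ : V → Option {v // v ∈ X'ᶜ} := fun a =>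
    if ha : a = x then none else some ⟨f a, fun h' => ha ((hmem a).1 h')⟩
  have e₀x : e₀ x = none := dif_pos rfl
  have e₀a : ∀ a (ha : a ≠ x), e₀ a = some ⟨f a, fun h' => ha ((hmem a).1 h')⟩ :=
    fun a ha => dif_neg ha
  have hbij : Function.Bijective e₀ := by
    constructor
    · intro a b hab
      by_cases ha : a = x <;> by_cases hb : b = x
      · rw [ha, hb]
      · rw [ha, e₀x, e₀a b hb] at hab
        cases hab
      · rw [hb, e₀x, e₀a a ha] at hab
        cases hab
      · rw [e₀a a ha, e₀a b hb] at hab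
        exact h.inj (congrArg Subtype.val (Option.some_injective _ hab))
    · rintro (_ | ⟨v, hv⟩)
      · exact ⟨x, e₀x⟩
      · obtain ⟨a, ha, rfl⟩ := hout v hv
        exact ⟨a, e₀a a ha⟩
  have hacc' : ∀ a, a ≠ x → ((∃ z, z ∉ X'ᶜ ∧ G'.Adj (f a) z) ↔ G.Adj a x) := by
    intro a ha
    rw [← hacc a ha]
    simp only [Set.notMem_compl_iff]
  let e : G ≃g SplitTree.splitPart G' X'ᶜ :=
    { Equiv.ofBijective e₀ hbij with
      map_rel_iff' := by
        intro a b
        change (SplitTree.splitPart G' X'ᶜ).Adj (e₀ a) (e₀ b) ↔ _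
        by_cases ha : a = x <;> by_cases hb : b = x
        · rw [ha, hb]
          simp
        · rw [ha, e₀x, e₀a b hb, G.adj_comm]
          exact hacc' b hb
        · rw [hb, e₀x, e₀a a ha]
          exact hacc' a ha
        · rw [e₀a a ha, e₀a b hb]
          exact h.adj a b }
  refine ⟨split G' X' hsplit (single _) (single _), (good_split hsplit _ _).2
    ⟨good_single.2 d₁, good_single.2 (hG.iso e), ?_⟩, fun z hz => ?_⟩
  · rw [role_single, role_single, r₁, hρ]
    have : (none : Option {v // v ∈ X'ᶜ}) = e x := e₀x.symm
    rw [this, roleIn_iso]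
    exact hκ
  · rw [role_split_of_notMem hsplit _ _ (fun h' => hz ((hmem z).1 h')), role_single, ← e₀a z hz]
    exact roleIn_iso e z

end IsTwinExtension

namespace Decomposition

lemma Good.exists_twinExtension {V : Type u} {G : SimpleGraph V} (D : Decomposition G) :
    D.Good → Finite V → ∀ {V' : Type u} {G' : SimpleGraph V'} {f : V → V'} {x : V} {y : V'}
      {κ : Role}, Finite V' → IsTwinExtension G G' f x y κ →
      ∃ D' : Decomposition G', D'.Good ∧ ∀ z, z ≠ x → D'.role (f z) = D.role z := by
  induction D with
  | @single V G =>
    intro hD _ V' G' f x y κ _ h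
    rw [good_single] at hD
    by_cases hκ : κ.Compatible (roleIn G x)
    · simp only [role_single]
      exact h.exists_good_of_compatible hD hκ
    · obtain ⟨k1, k2⟩ := h.isDegenerate hD hκ
      exact ⟨single G', good_single.2 k1, fun z _ => by simp [k2]⟩
  | @split V G X hX D₁ D₂ ih₁ ih₂ =>
    intro hD _ V' G' f x y κ _ h
    obtain ⟨h₁, h₂, h₁₂⟩ := (good_split hX D₁ D₂).1 hD
    by_cases hx : x ∈ X
    · set X' : Set V' := insert y (f '' X) with hX'
      have hmem : ∀ a, f a ∈ X' ↔ a ∈ X := fun a => by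
        simp [hX', h.ne, h.inj.mem_set_image]
      have hy : y ∈ X' := Or.inl rfl
      have hs : IsSplit G' X' := h.isSplit hmem (iff_of_true hy hx) hX
      obtain ⟨e, en, es⟩ := h.exists_splitPart_iso (X := Xᶜ) (X' := X'ᶜ)
        (fun a => not_congr (hmem a)) (fun h' => h' hx) (fun h' => h' hy)
      obtain ⟨D₁', g₁, r₁⟩ := ih₁ h₁ inferInstance inferInstance (h.splitPart hmem hx hy)
      obtain ⟨D₂', g₂, r₂⟩ := Good.exists_iso D₂ h₂ inferInstance e
      refine ⟨split G' X' hs D₁' D₂', (good_split hs D₁' D₂').2 ⟨g₁, g₂, ?_⟩, fun z hz => ?_⟩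
      · have k1 := r₁ none (by simp)
        have k2 := r₂ none
        rw [en] at k2
        rw [Option.map_none] at k1
        rw [k1, k2]
        exact h₁₂
      · by_cases hzX : z ∈ X
        · have k1 := r₁ (some ⟨z, hzX⟩) (by simpa using hz)
          rw [role_split_of_mem hX D₁ D₂ hzX, role_split_of_mem hs D₁' D₂' ((hmem z).2 hzX), ← k1,
            Option.map_some]
        · rw [role_split_of_notMem hX D₁ D₂ hzX,
            role_split_of_notMem hs D₁' D₂' (fun h => hzX ((hmem z).1 h)), ← r₂, es z hzX]
    · set X' : Set V' := f '' X with hX'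
      have hmem : ∀ a, f a ∈ X' ↔ a ∈ X := fun a => h.inj.mem_set_image
      have hy : y ∉ X' := by
        rintro ⟨a, -, ha⟩
        exact h.ne a ha
      have hs : IsSplit G' X' := h.isSplit hmem (iff_of_false hy hx) hX
      obtain ⟨e, en, es⟩ := h.exists_splitPart_iso hmem hx hy
      obtain ⟨D₁', g₁, r₁⟩ := Good.exists_iso D₁ h₁ inferInstance e
      obtain ⟨D₂', g₂, r₂⟩ := ih₂ h₂ inferInstance inferInstance
        (h.splitPart (X := Xᶜ) (X' := X'ᶜ) (fun a => not_congr (hmem a)) hx hy)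
      refine ⟨split G' X' hs D₁' D₂', (good_split hs D₁' D₂').2 ⟨g₁, g₂, ?_⟩, fun z hz => ?_⟩
      · have k1 := r₁ none
        have k2 := r₂ none (by simp)
        rw [en] at k1
        rw [Option.map_none] at k2
        rw [k1, k2]
        exact h₁₂
      · by_cases hzX : z ∈ X
        · rw [role_split_of_mem hX D₁ D₂ hzX, role_split_of_mem hs D₁' D₂' ((hmem z).2 hzX),
            ← r₁, es z hzX]
        · have k1 := r₂ (some ⟨z, hzX⟩) (by simpa using hz)
          rw [role_split_of_notMem hX D₁ D₂ hzX,
            role_split_of_notMem hs D₁' D₂' (fun h => hzX ((hmem z).1 h)), ← k1, Option.map_some]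

end Decomposition

open Decomposition

/-- A connected distance-hereditary graph with at least three vertices has a canonical
decomposition into cliques and stars. -/
theorem exists_good (n : ℕ) : ∀ {V : Type u} [Finite V] {G : SimpleGraph V},
    IsDistanceHereditary G → G.Connected → Nat.card V = n + 3 → ∃ D : Decomposition G, D.Good := by
  classical
  induction n with
  | zero =>
    intro V _ G _ hconn h3
    exact ⟨single G, good_single.2 (isDegenerate_of_card_eq_three hconn h3)⟩
  | succ n ih =>
    intro V _ G hG hconn hn
    have hnt : (Set.univ : Set V).Nontrivial := by
      rw [← Set.one_lt_ncard_iff_nontrivial, Set.ncard_univ]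
      omega
    obtain ⟨z, -⟩ := hnt.nonempty
    obtain ⟨y, -, -, x, -, hxy, hred⟩ := hasReducible hG _ Set.univ rfl
      (fun x _ y _ => Joined.of_reachable (hconn.preconnected x y)) hnt z trivial
    have hx : x ∈ ({y}ᶜ : Set V) := hxy
    have hcard : Nat.card ({y}ᶜ : Set V) = n + 3 := by
      have h1 := Set.ncard_add_ncard_compl ({y} : Set V)
      rw [Set.ncard_singleton, hn] at h1
      have : Nat.card ({y}ᶜ : Set V) = ({y}ᶜ : Set V).ncard := rfl
      omega
    have hconn' : (G.induce ({y}ᶜ : Set V)).Connected := by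
      have hyw : ∀ w, G.Adj w y → w = x ∨ G.Adj w x := by
        intro w hw
        rcases hred with ⟨-, h⟩ | h
        · by_cases hwx : w = x
          · exact Or.inl hwx
          · exact Or.inr ((h w trivial hwx hw.ne).2 hw)
        · exact Or.inl ((h w trivial).1 hw)
      refine connected_of_contraction hconn
        (fun v => if hv : v = y then ⟨x, hx⟩ else ⟨v, hv⟩) ?_ ?_
      · rintro ⟨v, hv⟩
        exact ⟨v, dif_neg hv⟩
      · intro a b hab
        by_cases ha : a = y <;> by_cases hb : b = y
        · simp [ha, hb]
        · subst ha
          rcases hyw b hab.symm with rfl | h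
          · simp [hb]
          · right
            simpa [hb] using h.symm
        · subst hb
          rcases hyw a hab with rfl | h
          · simp [ha]
          · right
            simpa [ha] using h
        · right
          simpa [ha, hb] using hab
    have hG' := hG.of_embedding (Embedding.induce ({y}ᶜ : Set V))
    obtain ⟨D, hD⟩ := ih hG' hconn' hcard
    have hext : ∃ κ, IsTwinExtension (G.induce ({y}ᶜ : Set V)) G Subtype.val ⟨x, hx⟩ y κ := by
      have mk : ∀ κ : Role, (∀ a, a ≠ y → a ≠ x → (G.Adj y a ↔ κ ≠ .leaf ∧ G.Adj x a)) →
          (G.Adj y x ↔ κ ≠ .centre) →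
          IsTwinExtension (G.induce ({y}ᶜ : Set V)) G Subtype.val ⟨x, hx⟩ y κ :=
        fun κ h1 h2 =>
        { inj := Subtype.val_injective
          adj := fun _ _ => Iff.rfl
          ne := fun a => a.2
          cover := fun v => by
            by_cases hv : v = y
            · exact Or.inl hv
            · exact Or.inr ⟨⟨v, hv⟩, rfl⟩
          adj_ne := fun a ha => h1 a a.2 fun h => ha (Subtype.ext h)
          adj_base := h2 }
      rcases hred with ⟨-, h⟩ | h
      · by_cases hadj : G.Adj y x
        · refine ⟨.clique, mk _ (fun a hay hax => ?_) (by simp [hadj])⟩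
          rw [G.adj_comm y a, G.adj_comm x a, h a trivial hax hay]
          simp
        · refine ⟨.centre, mk _ (fun a hay hax => ?_) (by simp [hadj])⟩
          rw [G.adj_comm y a, G.adj_comm x a, h a trivial hax hay]
          simp
      · refine ⟨.leaf, mk _ (fun a hay hax => ?_) ?_⟩
        · simp [G.adj_comm y a, h a trivial, hax]
        · simp [G.adj_comm y x, h x trivial]
    obtain ⟨κ, hκ⟩ := hext
    obtain ⟨D', hD', -⟩ := Good.exists_twinExtension D hD inferInstance inferInstance hκ
    exact ⟨D', hD'⟩

lemma IsPrime.isDegenerate {V : Type u} [Finite V] {G : SimpleGraph V} (hG : IsPrime G)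
    (hdh : IsDistanceHereditary G) (hconn : G.Connected) (h3 : 3 ≤ Nat.card V) :
    IsDegenerate G := by
  obtain ⟨D, hD⟩ := exists_good (Nat.card V - 3) hdh hconn (by omega)
  cases D with
  | single => exact good_single.1 hD
  | split _ X hX D₁ D₂ => exact absurd hX (hG X)

lemma IsPrime.iso {V W : Type u} [Finite V] {G : SimpleGraph V} {H : SimpleGraph W}
    (hG : IsPrime G) (e : G ≃g H) : IsPrime H := by
  intro X hX
  have : Finite W := Finite.of_equiv V e.toEquiv
  refine hG (e ⁻¹' X) ?_
  rw [isSplit_iff] at hX ⊢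
  obtain ⟨k1, k2, k3, x, hx, y, hy, hxy⟩ := hX
  refine ⟨k1.preimage e.surjective, k2.preimage e.surjective, ?_, e.symm x, by simpa using hx,
    e.symm y, by simpa using hy, e.symm.map_adj_iff.2 hxy⟩
  intro x₁ m₁ x₂ m₂ y₁ n₁ y₂ n₂
  rw [← e.map_adj_iff, ← e.map_adj_iff, ← e.map_adj_iff]
  exact k3 m₁ m₂ n₁ n₂

lemma finite_vertex {V : Type u} {G : SimpleGraph V} (D : Decomposition G) :
    Finite V → Finite D.Vertex := by
  induction D with
  | single => exact id
  | split _ _ _ _ _ ih₁ ih₂ =>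
    intro _
    have := ih₁ inferInstance
    have := ih₂ inferInstance
    infer_instance

lemma blocks_isDegenerate {V : Type u} {G : SimpleGraph V} (D : Decomposition G) : Finite V →
    IsDistanceHereditary G → G.Connected → 3 ≤ Nat.card V →
    (∀ b, IsPrime (D.block b) ∨ IsDegenerate (D.block b)) → ∀ b, IsDegenerate (D.block b) := by
  induction D with
  | @single V G =>
    intro _ hdh hconn h3 h b
    rcases h b with h | h
    · have : Finite { w // (single G).blockOf w = b } := Finite.of_equiv V (blockSingleIso G).toEquiv
      exact ((h.iso (blockSingleIso G).symm).isDegenerate hdh hconn h3).iso (blockSingleIso G)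
    · exact h
  | @split V G X hX D₁ D₂ ih₁ ih₂ =>
    intro _ hdh hconn h3 h
    have hX' := isSplit_iff.1 hX
    have k1 := ih₁ inferInstance (hdh.of_embedding (exists_splitPartEmbedding hX).choose)
      (connected_splitPart hconn hX'.2.1.nonempty) (three_le_natCard_option hX'.1) (fun b => ?_)
    · have k2 := ih₂ inferInstance (hdh.of_embedding (exists_splitPartEmbedding_compl hX).choose)
        (connected_splitPart hconn (by rw [compl_compl]; exact hX'.1.nonempty))
        (three_le_natCard_option hX'.2.1) (fun b => ?_)
      · rintro (b | b)
        · exact (k1 b).iso (blockInlIso hX D₁ D₂ b)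
        · exact (k2 b).iso (blockInrIso hX D₁ D₂ b)
      · have := finite_vertex (split G X hX D₁ D₂) inferInstance
        exact (h (Sum.inr b)).imp (fun h => h.iso (blockInrIso hX D₁ D₂ b).symm)
          fun h => h.iso (blockInrIso hX D₁ D₂ b).symm
    · have := finite_vertex (split G X hX D₁ D₂) inferInstance
      exact (h (Sum.inl b)).imp (fun h => h.iso (blockInlIso hX D₁ D₂ b).symm)
        fun h => h.iso (blockInlIso hX D₁ D₂ b).symm


/-! ### Decompositions whose tree is a path -/

/-- `G` has a linear layout that begins with `F` and ends with `L`, if these are given. -/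
def HasLayoutWith {V : Type u} (G : SimpleGraph V) (F L : Option V) : Prop :=
  ∃ (ι : Type) (_ : LinearOrder ι) (σ : V → ι), IsLinearLayout G σ ∧
    (∀ v, F = some v → ∀ w, σ v ≤ σ w) ∧ ∀ v, L = some v → ∀ w, σ w ≤ σ v

/-- `T` is a path that begins with `F` and ends with `L`, if these are given. -/
def HasPathNumbering {B : Type} (T : SimpleGraph B) (F L : Option B) : Prop :=
  ∃ (φ : B → ℕ) (n : ℕ), Function.Injective φ ∧ (∀ b, φ b ≤ n) ∧ (∀ k ≤ n, ∃ b, φ b = k) ∧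
    (∀ b c, T.Adj b c ↔ φ b + 1 = φ c ∨ φ c + 1 = φ b) ∧
    (∀ b, F = some b → φ b = 0) ∧ ∀ b, L = some b → φ b = n

lemma HasLayoutWith.symm {V : Type u} {G : SimpleGraph V} {F L : Option V}
    (h : HasLayoutWith G F L) : HasLayoutWith G L F := by
  obtain ⟨ι, _, σ, ⟨hσ, h⟩, hF, hL⟩ := h
  refine ⟨ιᵒᵈ, inferInstance, fun v => OrderDual.toDual (σ v),
    ⟨fun v w h => hσ (OrderDual.toDual.injective h), ?_⟩, hL, hF⟩
  intro x₁ x₂ y₁ y₂ h₁₁ h₁₂ h₂₁ h₂₂ a₁ a₂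
  exact (h y₂ y₁ x₂ x₁ h₂₂ h₁₂ h₂₁ h₁₁ a₂.symm a₁.symm).symm

lemma HasPathNumbering.symm {B : Type} {T : SimpleGraph B} {F L : Option B}
    (h : HasPathNumbering T F L) : HasPathNumbering T L F := by
  obtain ⟨φ, n, h1, h2, h3, h4, h5, h6⟩ := h
  refine ⟨fun b => n - φ b, n, ?_, fun b => Nat.sub_le _ _, ?_, ?_, ?_, ?_⟩
  · intro b c hbc
    have := h2 b
    have := h2 c
    simp only at hbc
    exact h1 (by omega)
  · intro k hk
    obtain ⟨b, hb⟩ := h3 (n - k) (Nat.sub_le _ _)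
    exact ⟨b, by simp only; omega⟩
  · intro b c
    have := h2 b
    have := h2 c
    rw [h4]
    simp only
    omega
  · intro b hb
    simp [h6 b hb]
  · intro b hb
    simp [h5 b hb]

lemma IsDegenerate.isLinearLayout {V ι : Type*} [LinearOrder ι] {G : SimpleGraph V}
    (hG : IsDegenerate G) {σ : V → ι} (hσ : Function.Injective σ) : IsLinearLayout G σ := by
  refine ⟨hσ, ?_⟩
  intro x₁ x₂ y₁ y₂ h₁₁ h₁₂ h₂₁ h₂₂ a₁ a₂
  have n₁₂ : x₁ ≠ y₂ := fun h => (h ▸ h₁₂).false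
  have n₂₁ : x₂ ≠ y₁ := fun h => (h ▸ h₂₁).false
  rcases hG with hG | ⟨c, hG⟩
  · exact (hG.2 _ _).2 n₁₂
  · rcases ((hG.2 _ _).1 a₁).2 with rfl | rfl
    · exact (hG.2 _ _).2 ⟨n₁₂, Or.inl rfl⟩
    · rcases ((hG.2 _ _).1 a₂).2 with rfl | rfl
      · exact absurd rfl n₂₁
      · exact a₁

lemma IsDegenerate.hasLayoutWith {V : Type u} [Finite V] {G : SimpleGraph V}
    (hG : IsDegenerate G) {F L : Option V} (hFL : ∀ v, F = some v → L ≠ some v) :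
    HasLayoutWith G F L := by
  classical
  obtain ⟨n, ⟨e⟩⟩ := Finite.exists_equiv_fin V
  let σ : V → ℤ := fun v => if F = some v then -1 else if L = some v then n else (e v : ℕ)
  have hσ : Function.Injective σ := by
    intro v w hvw
    simp only [σ] at hvw
    have h1 := (e v).2
    have h2 := (e w).2
    split_ifs at hvw with k1 k2 k3 k4 k5 k6 k7 k8
    · exact Option.some_injective _ (k1.symm.trans k2)
    all_goals first
      | omega
      | exact Option.some_injective _ (Eq.trans (Eq.symm ‹L = some v›) ‹L = some w›)
      | exact e.injective (Fin.ext (by omega))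
  refine ⟨ℤ, inferInstance, σ, hG.isLinearLayout hσ, fun v hv w => ?_, fun v hv w => ?_⟩
  · simp only [σ, hv, if_true]
    split_ifs <;> omega
  · have : F ≠ some v := fun h => hFL v h hv
    have h2 := (e w).2
    simp only [σ, hv, this, if_true, if_false]
    split_ifs <;> omega

lemma HasLayoutWith.join {V : Type u} {G : SimpleGraph V} {X : Set V} (hX : CutComplete G X)
    {F : Option {x // x ∈ X}} {L : Option {x // x ∈ Xᶜ}}
    (h₁ : HasLayoutWith (splitPart G X) (F.map some) (some none))
    (h₂ : HasLayoutWith (splitPart G Xᶜ) (some none) (L.map some)) :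
    HasLayoutWith G (F.map Subtype.val) (L.map Subtype.val) := by
  classical
  obtain ⟨ι₁, _, σ₁, ⟨i₁, h₁⟩, F₁, L₁⟩ := h₁
  obtain ⟨ι₂, _, σ₂, ⟨i₂, h₂⟩, F₂, L₂⟩ := h₂
  let σ : V → ι₁ ⊕ₗ ι₂ := fun v => if h : v ∈ X then toLex (Sum.inl (σ₁ (some ⟨v, h⟩)))
    else toLex (Sum.inr (σ₂ (some ⟨v, h⟩)))
  have hin : ∀ v (h : v ∈ X), σ v = toLex (Sum.inl (σ₁ (some ⟨v, h⟩))) := fun v h => dif_pos h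
  have hout : ∀ v (h : v ∉ X), σ v = toLex (Sum.inr (σ₂ (some ⟨v, h⟩))) := fun v h => dif_neg h
  have hoi : ∀ v w, v ∉ X → w ∈ X → ¬ σ v < σ w := by
    intro v w hv hw
    rw [hin w hw, hout v hv]
    simp
  have hii : ∀ v w (hv : v ∈ X) (hw : w ∈ X), σ v < σ w →
      σ₁ (some ⟨v, hv⟩) < σ₁ (some ⟨w, hw⟩) := by
    intro v w hv hw h
    rw [hin v hv, hin w hw] at h
    simpa using h
  have hoo : ∀ v w (hv : v ∉ X) (hw : w ∉ X), σ v < σ w →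
      σ₂ (some ⟨v, hv⟩) < σ₂ (some ⟨w, hw⟩) := by
    intro v w hv hw h
    rw [hout v hv, hout w hw] at h
    simpa using h
  have hlast : ∀ x, σ₁ (some x) < σ₁ none := fun x =>
    lt_of_le_of_ne (L₁ none rfl _) fun h => Option.some_ne_none _ (i₁ h)
  have hfirst : ∀ x, σ₂ none < σ₂ (some x) := fun x =>
    lt_of_le_of_ne (F₂ none rfl _) fun h => Option.some_ne_none _ (i₂ h).symm
  have a₁ : ∀ v w (hv : v ∈ X), w ∉ X → G.Adj v w → (splitPart G X).Adj (some ⟨v, hv⟩) none :=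
    fun v w hv hw h => ⟨w, hw, h⟩
  have a₂ : ∀ v w (hv : v ∉ X), w ∈ X → G.Adj w v → (splitPart G Xᶜ).Adj none (some ⟨v, hv⟩) :=
    fun v w hv hw h => ⟨w, fun h => h hw, h.symm⟩
  refine ⟨ι₁ ⊕ₗ ι₂, inferInstance, σ, ⟨?_, ?_⟩, ?_, ?_⟩
  · intro v w hvw
    by_cases hv : v ∈ X <;> by_cases hw : w ∈ X
    · rw [hin v hv, hin w hw] at hvw
      have := Option.some_injective _ (i₁ (Sum.inl_injective (toLex.injective hvw)))
      exact congrArg Subtype.val this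
    · rw [hin v hv, hout w hw] at hvw
      exact (Sum.inl_ne_inr (toLex.injective hvw)).elim
    · rw [hout v hv, hin w hw] at hvw
      exact (Sum.inr_ne_inl (toLex.injective hvw)).elim
    · rw [hout v hv, hout w hw] at hvw
      have := Option.some_injective _ (i₂ (Sum.inr_injective (toLex.injective hvw)))
      exact congrArg Subtype.val this
  · intro x₁ x₂ y₁ y₂ h₁₁ h₁₂ h₂₁ h₂₂ b₁ b₂
    by_cases hy₂ : y₂ ∈ X
    · have hx₁ : x₁ ∈ X := by
        by_contra h
        exact hoi _ _ h hy₂ h₁₂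
      have hx₂ : x₂ ∈ X := by
        by_contra h
        exact hoi _ _ h hy₂ h₂₂
      by_cases hy₁ : y₁ ∈ X
      · exact h₁ (some ⟨x₁, hx₁⟩) (some ⟨x₂, hx₂⟩) (some ⟨y₁, hy₁⟩) (some ⟨y₂, hy₂⟩)
          (hii _ _ _ _ h₁₁) (hii _ _ _ _ h₁₂) (hii _ _ _ _ h₂₁) (hii _ _ _ _ h₂₂) b₁ b₂
      · exact h₁ (some ⟨x₁, hx₁⟩) (some ⟨x₂, hx₂⟩) none (some ⟨y₂, hy₂⟩)
          (hlast _) (hii _ _ _ _ h₁₂) (hlast _) (hii _ _ _ _ h₂₂) (a₁ _ _ _ hy₁ b₁) b₂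
    · by_cases hx₁ : x₁ ∈ X
      · by_cases hx₂ : x₂ ∈ X
        · by_cases hy₁ : y₁ ∈ X
          · obtain ⟨z, hz, hxz⟩ := h₁ (some ⟨x₁, hx₁⟩) (some ⟨x₂, hx₂⟩) (some ⟨y₁, hy₁⟩) none
              (hii _ _ _ _ h₁₁) (hlast _) (hii _ _ _ _ h₂₁) (hlast _) b₁ (a₁ _ _ _ hy₂ b₂)
            exact hX hx₁ hx₂ hz hy₂ hxz b₂
          · exact hX hx₁ hx₂ hy₁ hy₂ b₁ b₂
        · have hy₁ : y₁ ∉ X := fun h => hoi _ _ hx₂ h h₂₁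
          obtain ⟨z, hz, hyz⟩ := h₂ none (some ⟨x₂, hx₂⟩) (some ⟨y₁, hy₁⟩) (some ⟨y₂, hy₂⟩)
            (hfirst _) (hfirst _) (hoo _ _ _ _ h₂₁) (hoo _ _ _ _ h₂₂) (a₂ _ _ _ hx₁ b₁) b₂
          exact hX hx₁ (Set.notMem_compl_iff.1 hz) hy₁ hy₂ b₁ hyz.symm
      · have hy₁ : y₁ ∉ X := fun h => hoi _ _ hx₁ h h₁₁
        by_cases hx₂ : x₂ ∈ X
        · exact h₂ (some ⟨x₁, hx₁⟩) none (some ⟨y₁, hy₁⟩) (some ⟨y₂, hy₂⟩)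
            (hoo _ _ _ _ h₁₁) (hoo _ _ _ _ h₁₂) (hfirst _) (hfirst _) b₁ (a₂ _ _ _ hx₂ b₂)
        · exact h₂ (some ⟨x₁, hx₁⟩) (some ⟨x₂, hx₂⟩) (some ⟨y₁, hy₁⟩) (some ⟨y₂, hy₂⟩)
            (hoo _ _ _ _ h₁₁) (hoo _ _ _ _ h₁₂) (hoo _ _ _ _ h₂₁) (hoo _ _ _ _ h₂₂) b₁ b₂
  · intro v hv w
    rcases F with _ | ⟨u, hu⟩
    · cases hv
    · obtain rfl : u = v := Option.some_injective _ hv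
      by_cases hw : w ∈ X
      · rw [hin u hu, hin w hw]
        simpa using F₁ _ rfl (some ⟨w, hw⟩)
      · rw [hin u hu, hout w hw]
        simp
  · intro v hv w
    rcases L with _ | ⟨u, hu⟩
    · cases hv
    · obtain rfl : u = v := Option.some_injective _ hv
      by_cases hw : w ∈ X
      · rw [hout u hu, hin w hw]
        simp
      · rw [hout u hu, hout w hw]
        simpa using L₂ _ rfl (some ⟨w, hw⟩)

namespace Decomposition

open Classical in
/-- The contribution of an optional vertex to the number of markers of the block `b`. -/
noncomputable def extra {B : Type} (o : Option B) (b : B) : ℕ := if o = some b then 1 else 0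

lemma extra_none {B : Type} (b : B) : extra none b = 0 := by simp [extra]

lemma extra_some {B : Type} [DecidableEq B] (u b : B) :
    extra (some u) b = if u = b then 1 else 0 := by
  simp [extra]

lemma extra_map {B C : Type} {f : B → C} (hf : Function.Injective f) (u b : B) :
    extra (some (f u)) (f b) = extra (some u) b := by
  classical
  rw [extra_some, extra_some]
  simp [hf.eq_iff]

lemma not_three_extra {V : Type u} {G : SimpleGraph V} (D : Decomposition G) (u v w : D.Block) :
    ¬ ∀ b, D.deg b + extra (some u) b + extra (some v) b + extra (some w) b ≤ 2 := by
  classical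
  intro h
  have h1 : ∑ b, (D.deg b + extra (some u) b + extra (some v) b + extra (some w) b) ≤
      ∑ _b : D.Block, 2 := Finset.sum_le_sum fun b _ => h b
  have h2 : ∀ u : D.Block, ∑ b, extra (some u) b = 1 := fun u => by simp [extra]
  rw [Finset.sum_add_distrib, Finset.sum_add_distrib, Finset.sum_add_distrib, h2, h2, h2,
    Finset.sum_const, Finset.card_univ, smul_eq_mul] at h1
  have := D.sum_deg
  omega

lemma hasPathNumbering_join {V : Type u} {G : SimpleGraph V} {X : Set V} (hX : IsSplit G X)
    (D₁ : Decomposition (splitPart G X)) (D₂ : Decomposition (splitPart G Xᶜ))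
    {F : Option {x // x ∈ X}} {L : Option {x // x ∈ Xᶜ}}
    (h₁ : HasPathNumbering D₁.tree ((F.map some).map D₁.home) ((some none).map D₁.home))
    (h₂ : HasPathNumbering D₂.tree ((some none).map D₂.home) ((L.map some).map D₂.home)) :
    HasPathNumbering (split G X hX D₁ D₂).tree
      ((F.map Subtype.val).map (split G X hX D₁ D₂).home)
      ((L.map Subtype.val).map (split G X hX D₁ D₂).home) := by
  obtain ⟨φ₁, n₁, i₁, l₁, s₁, a₁, F₁, L₁⟩ := h₁
  obtain ⟨φ₂, n₂, i₂, l₂, s₂, a₂, F₂, L₂⟩ := h₂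
  have hlast : ∀ b, b = D₁.home none ↔ φ₁ b = n₁ := fun b => by
    have h := L₁ _ rfl
    exact ⟨fun hb => hb ▸ h, fun hb => i₁ (hb.trans h.symm)⟩
  have hfirst : ∀ b, b = D₂.home none ↔ φ₂ b = 0 := fun b => by
    have h := F₂ _ rfl
    exact ⟨fun hb => hb ▸ h, fun hb => i₂ (hb.trans h.symm)⟩
  let φ : D₁.Block ⊕ D₂.Block → ℕ := Sum.elim φ₁ fun b => n₁ + 1 + φ₂ b
  refine ⟨φ, n₁ + 1 + n₂, ?_, ?_, ?_, ?_, ?_, ?_⟩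
  · rintro (b | b) (c | c) hbc
    · exact congrArg Sum.inl (i₁ hbc)
    · have h1 : φ₁ b = n₁ + 1 + φ₂ c := hbc
      have := l₁ b
      omega
    · have h1 : n₁ + 1 + φ₂ b = φ₁ c := hbc
      have := l₁ c
      omega
    · exact congrArg Sum.inr (i₂ (Nat.add_left_cancel hbc))
  · rintro (b | b)
    · have := l₁ b
      change φ₁ b ≤ _
      omega
    · have := l₂ b
      change n₁ + 1 + φ₂ b ≤ _
      omega
  · intro k hk
    by_cases hk' : k ≤ n₁
    · obtain ⟨b, hb⟩ := s₁ k hk'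
      exact ⟨Sum.inl b, hb⟩
    · obtain ⟨b, hb⟩ := s₂ (k - (n₁ + 1)) (by omega)
      refine ⟨Sum.inr b, ?_⟩
      change n₁ + 1 + φ₂ b = k
      omega
  · rintro (b | b) (c | c)
    · exact (tree_split_inl_inl hX D₁ D₂ b c).trans (a₁ b c)
    · rw [tree_split_inl_inr, hlast, hfirst]
      have := l₁ b
      change _ ↔ φ₁ b + 1 = n₁ + 1 + φ₂ c ∨ n₁ + 1 + φ₂ c + 1 = φ₁ b
      omega
    · rw [adj_comm, tree_split_inl_inr, hlast, hfirst]
      have := l₁ c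
      change _ ↔ n₁ + 1 + φ₂ b + 1 = φ₁ c ∨ φ₁ c + 1 = n₁ + 1 + φ₂ b
      omega
    · refine (tree_split_inr_inr hX D₁ D₂ b c).trans ((a₂ b c).trans ?_)
      change _ ↔ n₁ + 1 + φ₂ b + 1 = n₁ + 1 + φ₂ c ∨ n₁ + 1 + φ₂ c + 1 = n₁ + 1 + φ₂ b
      omega
  · intro b hb
    rcases F with _ | ⟨u, hu⟩
    · cases hb
    · obtain rfl := Option.some_injective _ hb
      rw [home_split_of_mem hX D₁ D₂ hu]
      exact F₁ _ rfl
  · intro b hb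
    rcases L with _ | ⟨u, hu⟩
    · cases hb
    · obtain rfl := Option.some_injective _ hb
      rw [home_split_of_notMem hX D₁ D₂ hu]
      have : φ₂ (D₂.home (some ⟨u, hu⟩)) = n₂ := L₂ _ rfl
      exact congrArg (n₁ + 1 + ·) this

lemma layout_of_deg_le_two {V : Type u} {G : SimpleGraph V} (D : Decomposition G) : Finite V →
    ∀ F L : Option V, (∀ v, F = some v → L ≠ some v) →
    (∀ b, D.deg b + extra (F.map D.home) b + extra (L.map D.home) b ≤ 2) →
    ((∀ b, IsDegenerate (D.block b)) → HasLayoutWith G F L) ∧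
      HasPathNumbering D.tree (F.map D.home) (L.map D.home) := by
  induction D with
  | @single V G =>
    intro _ F L hFL _
    refine ⟨fun h => ((h ()).iso (blockSingleIso G).symm).hasLayoutWith hFL,
      fun _ => 0, 0, fun _ _ _ => rfl, fun _ => le_rfl, fun k hk => ⟨(), (Nat.le_zero.1 hk).symm⟩, ?_,
      fun _ _ => rfl, fun _ _ => rfl⟩
    intro b c
    simp only [Nat.zero_add, one_ne_zero, or_self, iff_false]
    rintro ⟨h, -⟩
    exact h rfl
  | @split V G X hX D₁ D₂ ih₁ ih₂ =>
    intro _ F L hFL hdeg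
    have d₁ : ∀ b, (split G X hX D₁ D₂).deg (Sum.inl b) =
        D₁.deg b + extra (some (D₁.home none)) b := fun b => by
      classical
      rw [extra_some]
      simp [deg]
    have d₂ : ∀ b, (split G X hX D₁ D₂).deg (Sum.inr b) =
        D₂.deg b + extra (some (D₂.home none)) b := fun b => by
      classical
      rw [extra_some]
      simp [deg]
    have e₁ : ∀ v (hv : v ∈ X) b,
        extra (some ((split G X hX D₁ D₂).home v)) (Sum.inl b : D₁.Block ⊕ D₂.Block) =
          extra (some (D₁.home (some ⟨v, hv⟩))) b := fun v hv b => by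
      rw [home_split_of_mem hX D₁ D₂ hv]
      exact extra_map Sum.inl_injective _ _
    have e₂ : ∀ v (hv : v ∉ X) b,
        extra (some ((split G X hX D₁ D₂).home v)) (Sum.inr b : D₁.Block ⊕ D₂.Block) =
          extra (some (D₂.home (some ⟨v, hv⟩))) b := fun v hv b => by
      rw [home_split_of_notMem hX D₁ D₂ hv]
      exact extra_map Sum.inr_injective _ _
    have main : ∀ (F : Option {x // x ∈ X}) (L : Option {x // x ∈ Xᶜ}),
        (∀ b, (split G X hX D₁ D₂).deg b +
          extra ((F.map Subtype.val).map (split G X hX D₁ D₂).home) b +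
          extra ((L.map Subtype.val).map (split G X hX D₁ D₂).home) b ≤ 2) →
        ((∀ b, IsDegenerate ((split G X hX D₁ D₂).block b)) →
          HasLayoutWith G (F.map Subtype.val) (L.map Subtype.val)) ∧
        HasPathNumbering (split G X hX D₁ D₂).tree
          ((F.map Subtype.val).map (split G X hX D₁ D₂).home)
          ((L.map Subtype.val).map (split G X hX D₁ D₂).home) := by
      intro F L hdeg
      obtain ⟨p₁, q₁⟩ := ih₁ inferInstance (F.map some) (some none)
        (by
          rintro v h1 h2
          obtain rfl := Option.some_injective _ h2
          rcases F with _ | u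
          · cases h1
          · exact Option.some_ne_none _ (Option.some_injective _ h1)) (by
          intro b
          have h := hdeg (Sum.inl b)
          rw [d₁] at h
          rcases F with _ | ⟨u, hu⟩
          · simp only [Option.map_none, Option.map_some] at h ⊢
            have := extra_none b
            omega
          · simp only [Option.map_some] at h ⊢
            rw [e₁ u hu] at h
            omega)
      obtain ⟨p₂, q₂⟩ := ih₂ inferInstance (some none) (L.map some)
        (by
          rintro v h1 h2
          obtain rfl := Option.some_injective _ h1
          rcases L with _ | u
          · cases h2
          · exact Option.some_ne_none _ (Option.some_injective _ h2)) (by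
          intro b
          have h := hdeg (Sum.inr b)
          rw [d₂] at h
          rcases L with _ | ⟨u, hu⟩
          · simp only [Option.map_none, Option.map_some] at h ⊢
            have := extra_none b
            omega
          · simp only [Option.map_some] at h ⊢
            rw [e₂ u hu] at h
            omega)
      refine ⟨fun h => ?_, hasPathNumbering_join hX D₁ D₂ q₁ q₂⟩
      exact (p₁ fun b => (h (Sum.inl b)).iso (blockInlIso hX D₁ D₂ b).symm).join
        (isSplit_iff.1 hX).2.2.1
        (p₂ fun b => (h (Sum.inr b)).iso (blockInrIso hX D₁ D₂ b).symm)
    have hsides : (∃ (F' : Option {x // x ∈ X}) (L' : Option {x // x ∈ Xᶜ}),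
        F = F'.map Subtype.val ∧ L = L'.map Subtype.val) ∨
        ∃ (L' : Option {x // x ∈ X}) (F' : Option {x // x ∈ Xᶜ}),
          L = L'.map Subtype.val ∧ F = F'.map Subtype.val := by
      rcases F with _ | v
      · rcases L with _ | w
        · exact Or.inl ⟨none, none, rfl, rfl⟩
        · by_cases hw : w ∈ X
          · exact Or.inr ⟨some ⟨w, hw⟩, none, rfl, rfl⟩
          · exact Or.inl ⟨none, some ⟨w, hw⟩, rfl, rfl⟩
      · by_cases hv : v ∈ X
        · rcases L with _ | w
          · exact Or.inl ⟨some ⟨v, hv⟩, none, rfl, rfl⟩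
          · by_cases hw : w ∈ X
            · refine (D₁.not_three_extra (D₁.home none) (D₁.home (some ⟨v, hv⟩))
                (D₁.home (some ⟨w, hw⟩)) fun b => ?_).elim
              have h := hdeg (Sum.inl b)
              simp only [Option.map_some] at h
              rwa [d₁, e₁ v hv, e₁ w hw] at h
            · exact Or.inl ⟨some ⟨v, hv⟩, some ⟨w, hw⟩, rfl, rfl⟩
        · rcases L with _ | w
          · exact Or.inr ⟨none, some ⟨v, hv⟩, rfl, rfl⟩
          · by_cases hw : w ∈ X
            · exact Or.inr ⟨some ⟨w, hw⟩, some ⟨v, hv⟩, rfl, rfl⟩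
            · refine (D₂.not_three_extra (D₂.home none) (D₂.home (some ⟨v, hv⟩))
                (D₂.home (some ⟨w, hw⟩)) fun b => ?_).elim
              have h := hdeg (Sum.inr b)
              simp only [Option.map_some] at h
              rwa [d₂, e₂ v hv, e₂ w hw] at h
    rcases hsides with ⟨F', L', rfl, rfl⟩ | ⟨L', F', rfl, rfl⟩
    · exact main F' L' hdeg
    · obtain ⟨p, q⟩ := main L' F' fun b => by
        have := hdeg b
        omega
      exact ⟨fun h => (p h).symm, q.symm⟩

lemma hasLinearLayout {V : Type u} [Finite V] {G : SimpleGraph V} (D : Decomposition G)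
    (h : ∀ b, D.deg b ≤ 2) (hD : ∀ b, IsDegenerate (D.block b)) : HasLinearLayout G := by
  obtain ⟨p, -⟩ := D.layout_of_deg_le_two inferInstance none none (by simp)
    (by simpa [extra_none] using h)
  obtain ⟨ι, _, σ, hσ, -⟩ := p hD
  exact ⟨ι, _, σ, hσ⟩

lemma exists_tree_iso_path {V : Type u} [Finite V] {G : SimpleGraph V} (D : Decomposition G)
    (h : ∀ b, D.deg b ≤ 2) : ∃ n, Nonempty (D.tree ≃g pathGraph (n + 1)) := by
  obtain ⟨-, φ, n, h1, h2, h3, h4, -⟩ := D.layout_of_deg_le_two inferInstance none none (by simp)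
    (by simpa [extra_none] using h)
  refine ⟨n, ⟨⟨Equiv.ofBijective (fun b => ⟨φ b, Nat.lt_succ_of_le (h2 b)⟩) ⟨?_, ?_⟩, ?_⟩⟩⟩
  · intro b c hbc
    exact h1 (congrArg Fin.val hbc)
  · rintro ⟨k, hk⟩
    obtain ⟨b, hb⟩ := h3 k (Nat.le_of_lt_succ hk)
    exact ⟨b, Fin.ext hb⟩
  · intro b c
    rw [pathGraph_adj, h4]
    rfl

lemma deg_of_tree_iso {V : Type u} {G : SimpleGraph V} (D : Decomposition G) {B : Type}
    {T : SimpleGraph B} (e : D.tree ≃g T) (b : D.Block) :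
    D.deg b = (T.neighborSet (e b)).ncard := by
  rw [deg_eq_ncard]
  refine Set.ncard_congr (fun c _ => e c) (fun c hc => e.map_adj_iff.2 hc)
    (fun c d _ _ h => e.injective h) (fun c hc => ⟨e.symm c, ?_, e.apply_symm_apply c⟩)
  rw [mem_neighborSet, ← e.map_adj_iff, e.apply_symm_apply]
  exact hc

lemma deg_le_two_of_tree_iso_path {V : Type u} {G : SimpleGraph V} (D : Decomposition G) {n : ℕ}
    (e : D.tree ≃g pathGraph n) (b : D.Block) : D.deg b ≤ 2 := by
  rw [deg_of_tree_iso D e, ← Set.ncard_image_of_injective _ Fin.val_injective]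
  refine (Set.ncard_le_ncard (t := {(e b : ℕ) + 1, (e b : ℕ) - 1}) ?_ (by simp)).trans
    ((Set.ncard_insert_le _ _).trans (by rw [Set.ncard_singleton]))
  rintro _ ⟨c, hc, rfl⟩
  rw [mem_neighborSet, pathGraph_adj] at hc
  simp only [Set.mem_insert_iff, Set.mem_singleton_iff]
  omega

end Decomposition


/-! ### Tripods -/

/-- A clique or star block `b` with three markers, together with two vertices behind each of them:
the vertices `p i` and, unless `O i`, `q i`. The marker `i` has role `ρ i` in the block `b`, and
role `τ i` in the graph on the marker opposite to it, `p i` and `q i`. The vertex `c` is the centre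
of `b`, if none of the markers is. -/
structure Tripod {V : Type*} (G : SimpleGraph V) (O : Fin 3 → Prop) (ρ τ : Fin 3 → Role)
    (p q : Fin 3 → V) (c : V) : Prop where
  pp : ∀ i j, i ≠ j → p i ≠ p j ∧ (G.Adj (p i) (p j) ↔ ρ i ≠ .leaf ∨ ρ j ≠ .leaf)
  pq : ∀ i j, i ≠ j → ¬ O j → p i ≠ q j ∧
    (G.Adj (p i) (q j) ↔ (ρ i ≠ .leaf ∨ ρ j ≠ .leaf) ∧ τ j ≠ .leaf)
  qq : ∀ i j, i ≠ j → ¬ O i → ¬ O j → q i ≠ q j ∧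
    (G.Adj (q i) (q j) ↔ (ρ i ≠ .leaf ∨ ρ j ≠ .leaf) ∧ τ i ≠ .leaf ∧ τ j ≠ .leaf)
  leg : ∀ i, ¬ O i → p i ≠ q i ∧ (G.Adj (p i) (q i) ↔ τ i ≠ .centre) ∧ (ρ i).Compatible (τ i)
  roles : (∀ i, ρ i = .clique) ∨ (∃ i, ρ i = .centre ∧ ∀ j, j ≠ i → ρ j = .leaf) ∨
    ∀ i, ρ i = .leaf
  centre : (∀ i, ρ i = .leaf) → ∀ i, c ≠ p i ∧ G.Adj c (p i) ∧
    (¬ O i → c ≠ q i ∧ (G.Adj c (q i) ↔ τ i ≠ .leaf))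

namespace Tripod

section

variable {V W : Type*} {G : SimpleGraph V} {H : SimpleGraph W} {O : Fin 3 → Prop}
  {ρ τ : Fin 3 → Role} {p q : Fin 3 → V} {c : V}

lemma map_iff (f : G ↪g H) : Tripod H O ρ τ (f ∘ p) (f ∘ q) (f c) ↔ Tripod G O ρ τ p q c := by
  constructor <;> rintro ⟨h1, h2, h3, h4, h5, h6⟩
  · simp only [Function.comp_apply, f.injective.ne_iff, f.map_adj_iff] at h1 h2 h3 h4 h6
    exact ⟨h1, h2, h3, h4, h5, h6⟩
  · refine ⟨?_, ?_, ?_, ?_, h5, ?_⟩ <;>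
      simpa only [Function.comp_apply, f.injective.ne_iff, f.map_adj_iff]

lemma addLeg (t : Tripod G O ρ τ p q c) {i₀ : Fin 3} {v : V} {κ : Role} (hv : p i₀ ≠ v)
    (hadj : G.Adj (p i₀) v ↔ κ ≠ .centre) (hκ : (ρ i₀).Compatible κ) {S : Set V}
    (hS : ∀ w ∈ S, w ≠ v ∧ (G.Adj w v ↔ G.Adj w (p i₀) ∧ κ ≠ .leaf))
    (hp : ∀ i, i ≠ i₀ → p i ∈ S) (hq : ∀ i, i ≠ i₀ → ¬ O i → q i ∈ S)
    (hc : (∀ i, ρ i = .leaf) → c ∈ S) :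
    Tripod G (fun i => O i ∧ i ≠ i₀) ρ (Function.update τ i₀ κ) p (Function.update q i₀ v) c := by
  classical
  have hO : ∀ {i}, i ≠ i₀ → ¬ (O i ∧ i ≠ i₀) → ¬ O i := fun hi h h' => h ⟨h', hi⟩
  have key : ∀ i, i ≠ i₀ → q i ∈ S → (G.Adj (q i) (p i₀) ↔
      (ρ i ≠ .leaf ∨ ρ i₀ ≠ .leaf) ∧ τ i ≠ .leaf) → q i ≠ v ∧
      (G.Adj (q i) v ↔ (ρ i ≠ .leaf ∨ ρ i₀ ≠ .leaf) ∧ τ i ≠ .leaf ∧ κ ≠ .leaf) := by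
    intro i _ hi h
    rw [(hS _ hi).2, h, and_assoc]
    exact ⟨(hS _ hi).1, Iff.rfl⟩
  refine ⟨t.pp, ?_, ?_, ?_, t.roles, ?_⟩
  · intro i j hij hj
    by_cases hj₀ : j = i₀
    · subst hj₀
      rw [Function.update_self, Function.update_self]
      obtain ⟨h1, h2⟩ := hS _ (hp i hij)
      rw [h2, (t.pp i j hij).2]
      exact ⟨h1, Iff.rfl⟩
    · rw [Function.update_of_ne hj₀, Function.update_of_ne hj₀]
      exact t.pq i j hij (hO hj₀ hj)
  · intro i j hij hi hj
    by_cases hi₀ : i = i₀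
    · subst hi₀
      have hj' := hO hij.symm hj
      rw [Function.update_self, Function.update_self, Function.update_of_ne hij.symm,
        Function.update_of_ne hij.symm]
      obtain ⟨h1, h2⟩ := key j hij.symm (hq j hij.symm hj') (by
        rw [adj_comm, (t.pq i j hij hj').2, or_comm])
      rw [adj_comm, h2, or_comm, and_comm (a := τ j ≠ .leaf)]
      exact ⟨h1.symm, Iff.rfl⟩
    · by_cases hj₀ : j = i₀
      · subst hj₀
        have hi' := hO hij hi
        rw [Function.update_self, Function.update_self, Function.update_of_ne hij,
          Function.update_of_ne hij]
        exact key i hij (hq i hij hi') (by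
          rw [adj_comm, (t.pq j i hij.symm hi').2, or_comm])
      · rw [Function.update_of_ne hi₀, Function.update_of_ne hi₀, Function.update_of_ne hj₀,
          Function.update_of_ne hj₀]
        exact t.qq i j hij (hO hi₀ hi) (hO hj₀ hj)
  · intro i hi
    by_cases hi₀ : i = i₀
    · subst hi₀
      rw [Function.update_self, Function.update_self]
      exact ⟨hv, hadj, hκ⟩
    · rw [Function.update_of_ne hi₀, Function.update_of_ne hi₀]
      exact t.leg i (hO hi₀ hi)
  · intro hρ i
    obtain ⟨h1, h2, h3⟩ := t.centre hρ i
    refine ⟨h1, h2, fun hi => ?_⟩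
    by_cases hi₀ : i = i₀
    · subst hi₀
      rw [Function.update_self, Function.update_self]
      obtain ⟨h1, h4⟩ := hS _ (hc hρ)
      rw [h4]
      exact ⟨h1, by simp [h2]⟩
    · rw [Function.update_of_ne hi₀, Function.update_of_ne hi₀]
      exact h3 (hO hi₀ hi)

end

/-- A tripod in one part of a split can be extended by two vertices of the other part. -/
lemma join {V : Type u} {G : SimpleGraph V} {Y : Set V} (hY : CutComplete G Y) {O : Fin 3 → Prop}
    {ρ τ : Fin 3 → Role} {p q : Fin 3 → Option {y // y ∈ Y}} {c : Option {y // y ∈ Y}}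
    {i₀ : Fin 3} (hi₀ : ¬ O i₀)
    (t : Tripod (splitPart G Y) (fun i => O i ∨ i = i₀) ρ τ p q c) (hp : p i₀ = none) {u v : V}
    (hu : u ∉ Y) (hv : v ∉ Y) {κ : Role} (huY : ∃ y ∈ Y, G.Adj y u)
    (hvY : (∃ y ∈ Y, G.Adj y v) ↔ κ ≠ .leaf) (huv : u ≠ v) (hadj : G.Adj u v ↔ κ ≠ .centre)
    (hκ : (ρ i₀).Compatible κ) :
    ∃ (τ : Fin 3 → Role) (p' q' : Fin 3 → V) (c : V), Tripod G O ρ τ p' q' c ∧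
      ∀ i y, p i = some y → p' i = y := by
  have hf := (map_iff (splitPartEmbedding hY hu huY)).2 t
  set f := splitPartEmbedding hY hu huY with hfdef
  have hfn : f none = u := rfl
  have hfs : ∀ y, f (some y) = y := fun _ => rfl
  have hmem : ∀ w, w ≠ p i₀ → f w ∈ Y := by
    rintro (_ | w) hw
    · exact absurd hp.symm hw
    · exact w.2
  have hpu : (f ∘ p) i₀ = u := by
    rw [Function.comp_apply, hp, hfn]
  have h := hf.addLeg (i₀ := i₀) (v := v) (κ := κ) (S := Y) (by rwa [hpu]) (by rwa [hpu]) hκ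
    (fun w hw => ⟨fun h => hv (h ▸ hw), ?_⟩) (fun i hi => hmem _ (t.pp i i₀ hi).1)
    (fun i hi hO => hmem _ (t.pq i₀ i hi.symm hO).1.symm) (fun hρ => hmem _ (t.centre hρ i₀).1)
  · have hO : (fun i => (O i ∨ i = i₀) ∧ i ≠ i₀) = O := by
      funext i
      apply propext
      constructor
      · rintro ⟨h | h, h'⟩
        · exact h
        · exact absurd h h'
      · intro h
        exact ⟨Or.inl h, fun h' => hi₀ (h' ▸ h)⟩
    rw [hO] at h
    refine ⟨_, _, _, _, h, fun i y hi => ?_⟩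
    rw [Function.comp_apply, hi, hfs]
  · rw [hpu]
    obtain ⟨y, hy, hyu⟩ := huY
    constructor
    · intro hwv
      exact ⟨hY hw hy hv hu hwv hyu, hvY.1 ⟨w, hw, hwv⟩⟩
    · rintro ⟨hwu, hκ'⟩
      obtain ⟨y', hy', hyv⟩ := hvY.2 hκ'
      exact hY hw hy' hu hv hwu hyv

end Tripod

namespace Decomposition

/-- Every vertex of a graph with a good decomposition lies in a clique or star with three vertices
in which it has the same role as in the decomposition. -/
lemma Good.exists_leg {V : Type u} {G : SimpleGraph V} (D : Decomposition G) : D.Good →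
    Finite V → ∀ z, ∃ u v, u ≠ z ∧ v ≠ z ∧ u ≠ v ∧ G.Adj z u ∧ (G.Adj z v ↔ D.role z ≠ .leaf) ∧
      (G.Adj u v ↔ D.role z ≠ .centre) := by
  induction D with
  | @single V G =>
    intro h _ z
    rw [good_single] at h
    rw [role_single]
    rcases h with h | ⟨c, h⟩
    · obtain ⟨u, hu, -⟩ := exists_ne_ne_of_three_le h.1 z z
      obtain ⟨v, hv, hvu⟩ := exists_ne_ne_of_three_le h.1 z u
      refine ⟨u, v, hu, hv, hvu.symm, ?_⟩
      simp [h.2, h.roleIn, hu.symm, hv.symm, hvu.symm]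
    · by_cases hz : z = c
      · subst hz
        obtain ⟨u, hu, -⟩ := exists_ne_ne_of_three_le h.1 z z
        obtain ⟨v, hv, hvu⟩ := exists_ne_ne_of_three_le h.1 z u
        refine ⟨u, v, hu, hv, hvu.symm, ?_⟩
        simp [h.2, h.roleIn_centre, hu, hv, hu.symm, hv.symm]
      · obtain ⟨v, hv, hvc⟩ := exists_ne_ne_of_three_le h.1 z c
        refine ⟨c, v, Ne.symm hz, hv, hvc.symm, ?_⟩
        simp [h.2, h.roleIn_leaf hz, hz, hvc, hvc.symm]
  | @split V G X hX D₁ D₂ ih₁ ih₂ =>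
    intro h _ z
    obtain ⟨h₁, h₂, -⟩ := (good_split hX D₁ D₂).1 h
    by_cases hz : z ∈ X
    · obtain ⟨f, hf⟩ := exists_splitPartEmbedding hX
      obtain ⟨u, v, k1, k2, k3, k4, k5, k6⟩ := ih₁ h₁ inferInstance (some ⟨z, hz⟩)
      rw [role_split_of_mem hX D₁ D₂ hz, ← k5, ← k6]
      have hfz : f (some ⟨z, hz⟩) = z := hf _
      refine ⟨f u, f v, ?_, ?_, f.injective.ne k3, ?_, ?_, f.map_adj_iff⟩
      · exact hfz ▸ f.injective.ne k1
      · exact hfz ▸ f.injective.ne k2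
      · rw [← f.map_adj_iff, hfz] at k4
        exact k4
      · rw [← f.map_adj_iff, hfz]
    · obtain ⟨f, hf⟩ := exists_splitPartEmbedding_compl hX
      obtain ⟨u, v, k1, k2, k3, k4, k5, k6⟩ := ih₂ h₂ inferInstance (some ⟨z, hz⟩)
      rw [role_split_of_notMem hX D₁ D₂ hz, ← k5, ← k6]
      have hfz : f (some ⟨z, hz⟩) = z := hf _
      refine ⟨f u, f v, ?_, ?_, f.injective.ne k3, ?_, ?_, f.map_adj_iff⟩
      · exact hfz ▸ f.injective.ne k1
      · exact hfz ▸ f.injective.ne k2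
      · rw [← f.map_adj_iff, hfz] at k4
        exact k4
      · rw [← f.map_adj_iff, hfz]

lemma exists_tripod_single {V : Type u} [Finite V] {G : SimpleGraph V} (hG : IsDegenerate G)
    {O : Fin 3 → Prop} (hO : ∀ i, O i) {z : Fin 3 → V} (hz : ∀ i j, i ≠ j → z i ≠ z j) :
    ∃ c, Tripod G O (fun i => roleIn G (z i)) (fun _ => .clique) z z c ∧
      ((∀ i, roleIn G (z i) = .leaf) → 4 ≤ Nat.card V) := by
  have mk : ∀ c, ((∀ i, roleIn G (z i) = .clique) ∨
      (∃ i, roleIn G (z i) = .centre ∧ ∀ j, j ≠ i → roleIn G (z j) = .leaf) ∨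
      ∀ i, roleIn G (z i) = .leaf) → ((∀ i, roleIn G (z i) = .leaf) → ∀ i, c ≠ z i ∧
      G.Adj c (z i)) → Tripod G O (fun i => roleIn G (z i)) (fun _ => .clique) z z c := by
    intro c h1 h2
    exact ⟨fun i j hij => ⟨hz i j hij, hG.adj_iff_role (hz i j hij)⟩,
      fun _ j _ hj => absurd (hO j) hj, fun _ j _ _ hj => absurd (hO j) hj,
      fun j hj => absurd (hO j) hj, h1,
      fun h i => ⟨(h2 h i).1, (h2 h i).2, fun hi => absurd (hO i) hi⟩⟩
  rcases hG.roles with hr | ⟨c, hc, hr⟩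
  · exact ⟨z 0, mk _ (Or.inl fun i => hr _) (fun h => by simp [hr] at h), fun h => by simp [hr] at h⟩
  · by_cases hcz : ∃ i, z i = c
    · obtain ⟨i, rfl⟩ := hcz
      have hne : ¬ ∀ i, roleIn G (z i) = .leaf := fun h => by
        rw [h i] at hc
        cases hc
      exact ⟨z 0, mk _ (Or.inr (Or.inl ⟨i, hc, fun j hj => hr _ (hz j i hj)⟩))
        (fun h => absurd h hne), fun h => absurd h hne⟩
    · push Not at hcz
      refine ⟨c, mk _ (Or.inr (Or.inr fun i => hr _ (hcz i))) (fun _ i => ⟨(hcz i).symm, ?_⟩),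
        fun _ => ?_⟩
      · exact (hG.adj_iff_role (hcz i).symm).2 (Or.inl (by simp [hc]))
      · let g : Option (Fin 3) → V := fun o => o.elim c z
        have hg : Function.Injective g := by
          rintro (_ | i) (_ | j) hij
          · rfl
          · exact absurd hij.symm (hcz j)
          · exact absurd hij (hcz i)
          · by_contra h
            exact hz i j (fun h' => h (congrArg some h')) hij
        have := Nat.card_le_card_of_injective g hg
        simpa using this

/-- A block with three markers gives rise to a tripod. More generally, there is a tripod in which
some of the markers are replaced by given vertices of the block. -/
lemma Good.exists_tripod {V : Type u} {G : SimpleGraph V} (D : Decomposition G) : D.Good →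
    Finite V → ∀ (O : Fin 3 → Prop) (z : Fin 3 → V) (b : D.Block), (∀ i, O i → D.home (z i) = b) →
    (∀ i j, i ≠ j → O i → O j → z i ≠ z j) → 3 ≤ D.deg b + {i | O i}.ncard →
    ∃ ρ τ p q c, Tripod G O ρ τ p q c ∧ (∀ i, O i → p i = z i ∧ ρ i = D.role (z i)) ∧
      ((∀ i, ρ i = .leaf) → 4 ≤ D.size b) := by
  classical
  have hlt : ∀ O : Fin 3 → Prop, {i | O i}.ncard ≤ 3 := fun O => by
    simpa using Set.ncard_le_card {i | O i}
  have hall : ∀ O : Fin 3 → Prop, 3 ≤ {i | O i}.ncard → ∀ i, O i := by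
    intro O h i
    have : {i | O i} = Set.univ := by
      apply Set.eq_of_subset_of_ncard_le (Set.subset_univ _)
      simpa using h
    have hi : i ∈ {i | O i} := this ▸ Set.mem_univ i
    exact hi
  have hex : ∀ O : Fin 3 → Prop, {i | O i}.ncard < 3 → ∃ i, ¬ O i := by
    intro O h
    by_contra! h'
    have : {i | O i} = Set.univ := Set.eq_univ_of_forall h'
    rw [this] at h
    simp at h
  have hins : ∀ (O : Fin 3 → Prop) (i₀ : Fin 3), ¬ O i₀ →
      {i | O i ∨ i = i₀}.ncard = {i | O i}.ncard + 1 := by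
    intro O i₀ h
    rw [← Set.ncard_insert_of_notMem (a := i₀) (s := {i | O i}) h]
    congr 1
    ext i
    simp [or_comm]
  induction D with
  | @single V G =>
    intro h _ O z b _ hz h3
    have hO := hall O (by simpa [deg] using h3)
    obtain ⟨c, t, hc⟩ := exists_tripod_single (good_single.1 h) hO
      (z := z) (fun i j hij => hz i j hij (hO i) (hO j))
    exact ⟨_, _, _, _, c, t, fun i _ => ⟨rfl, (role_single _).symm⟩, hc⟩
  | @split V G X hX D₁ D₂ ih₁ ih₂ =>
    intro h _ O z b hb hz h3
    obtain ⟨h₁, h₂, h₁₂⟩ := (good_split hX D₁ D₂).1 h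
    have hX' := (isSplit_iff.1 hX).2.2.1
    rcases b with b | b
    · have hzX : ∀ i, O i → z i ∈ X := by
        intro i hi
        by_contra hzi
        have := hb i hi
        rw [home_split_of_notMem hX D₁ D₂ hzi] at this
        exact Sum.inr_ne_inl this
      let z' : Fin 3 → Option {x // x ∈ X} :=
        fun i => if h : z i ∈ X then some ⟨z i, h⟩ else none
      have hz's : ∀ i (hi : O i), z' i = some ⟨z i, hzX i hi⟩ := fun i hi => dif_pos (hzX i hi)
      have hz'b : ∀ i, O i → D₁.home (z' i) = b := by
        intro i hi
        have := hb i hi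
        rw [home_split_of_mem hX D₁ D₂ (hzX i hi)] at this
        rw [hz's i hi]
        exact Sum.inl_injective this
      have hz'r : ∀ i, O i → D₁.role (z' i) = (split G X hX D₁ D₂).role (z i) := by
        intro i hi
        rw [hz's i hi, role_split_of_mem hX D₁ D₂ (hzX i hi)]
      have hz'i : ∀ i j, i ≠ j → O i → O j → z' i ≠ z' j := by
        intro i j hij hi hj
        rw [hz's i hi, hz's j hj]
        intro h
        exact hz i j hij hi hj (congrArg Subtype.val (Option.some_injective _ h))
      by_cases hdeg : 3 ≤ D₁.deg b + {i | O i}.ncard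
      · obtain ⟨ρ, τ, p, q, c, t, ht, hs⟩ := ih₁ h₁ inferInstance O z' b hz'b hz'i hdeg
        obtain ⟨f, hf⟩ := exists_splitPartEmbedding hX
        refine ⟨ρ, τ, _, _, _, (Tripod.map_iff f).2 t, fun i hi => ⟨?_, ?_⟩, hs⟩
        · rw [Function.comp_apply, (ht i hi).1, hz's i hi, hf]
        · rw [(ht i hi).2, hz'r i hi]
      · have hd : (split G X hX D₁ D₂).deg (Sum.inl b) =
          D₁.deg b + if D₁.home none = b then 1 else 0 := rfl
        rw [hd] at h3
        have hn : D₁.home none = b := by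
          by_contra hn
          rw [if_neg hn] at h3
          omega
        rw [if_pos hn] at h3
        obtain ⟨i₀, hi₀⟩ := hex O (by omega)
        have hz₀ : ∀ i, O i → Function.update z' i₀ none i = z' i := by
          intro i hi
          rw [Function.update_of_ne]
          rintro rfl
          exact hi₀ hi
        obtain ⟨ρ, τ, p, q, c, t, ht, hs⟩ := ih₁ h₁ inferInstance (fun i => O i ∨ i = i₀)
          (Function.update z' i₀ none) b (by
            rintro i (hi | rfl)
            · rw [hz₀ i hi, hz'b i hi]
            · rw [Function.update_self, hn]) (by
            rintro i j hij (hi | rfl) (hj | rfl)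
            · rw [hz₀ i hi, hz₀ j hj]
              exact hz'i i j hij hi hj
            · rw [hz₀ i hi, Function.update_self, hz's i hi]
              exact Option.some_ne_none _
            · rw [hz₀ j hj, Function.update_self, hz's j hj]
              exact (Option.some_ne_none _).symm
            · exact absurd rfl hij) (by
            rw [hins O i₀ hi₀]
            omega)
        have hp₀ := ht i₀ (Or.inr rfl)
        rw [Function.update_self] at hp₀
        obtain ⟨u, v, hu, hv, huv, k1, k2, k3⟩ := Good.exists_leg D₂ h₂ inferInstance none
        obtain ⟨⟨u, huX⟩, rfl⟩ := Option.ne_none_iff_exists'.1 hu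
        obtain ⟨⟨v, hvX⟩, rfl⟩ := Option.ne_none_iff_exists'.1 hv
        have hacc : ∀ w (hw : w ∈ Xᶜ), (splitPart G Xᶜ).Adj none (some ⟨w, hw⟩) ↔
            ∃ y ∈ X, G.Adj y w := by
          intro w hw
          change (∃ y, y ∉ Xᶜ ∧ G.Adj w y) ↔ _
          simp only [Set.notMem_compl_iff, G.adj_comm w]
        obtain ⟨τ', p', q', c', t', ht'⟩ := t.join hX' hi₀ hp₀.1 huX hvX ((hacc _ huX).1 k1)
          ((hacc _ hvX).symm.trans k2) (fun h => huv (by subst h; rfl)) k3 (hp₀.2 ▸ h₁₂)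
        refine ⟨ρ, τ', p', q', c', t', fun i hi => ⟨?_, ?_⟩, hs⟩
        · have := (ht i (Or.inl hi)).1
          rw [hz₀ i hi, hz's i hi] at this
          exact ht' i _ this
        · rw [(ht i (Or.inl hi)).2, hz₀ i hi, hz'r i hi]
    · have hzX : ∀ i, O i → z i ∈ Xᶜ := by
        intro i hi hzi
        have := hb i hi
        rw [home_split_of_mem hX D₁ D₂ hzi] at this
        exact Sum.inl_ne_inr this
      let z' : Fin 3 → Option {x // x ∈ Xᶜ} :=
        fun i => if h : z i ∈ Xᶜ then some ⟨z i, h⟩ else none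
      have hz's : ∀ i (hi : O i), z' i = some ⟨z i, hzX i hi⟩ := fun i hi => dif_pos (hzX i hi)
      have hz'b : ∀ i, O i → D₂.home (z' i) = b := by
        intro i hi
        have := hb i hi
        rw [home_split_of_notMem hX D₁ D₂ (hzX i hi)] at this
        rw [hz's i hi]
        exact Sum.inr_injective this
      have hz'r : ∀ i, O i → D₂.role (z' i) = (split G X hX D₁ D₂).role (z i) := by
        intro i hi
        rw [hz's i hi, role_split_of_notMem hX D₁ D₂ (hzX i hi)]
      have hz'i : ∀ i j, i ≠ j → O i → O j → z' i ≠ z' j := by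
        intro i j hij hi hj
        rw [hz's i hi, hz's j hj]
        intro h
        exact hz i j hij hi hj (congrArg Subtype.val (Option.some_injective _ h))
      by_cases hdeg : 3 ≤ D₂.deg b + {i | O i}.ncard
      · obtain ⟨ρ, τ, p, q, c, t, ht, hs⟩ := ih₂ h₂ inferInstance O z' b hz'b hz'i hdeg
        obtain ⟨f, hf⟩ := exists_splitPartEmbedding_compl hX
        refine ⟨ρ, τ, _, _, _, (Tripod.map_iff f).2 t, fun i hi => ⟨?_, ?_⟩, hs⟩
        · rw [Function.comp_apply, (ht i hi).1, hz's i hi, hf]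
        · rw [(ht i hi).2, hz'r i hi]
      · have hd : (split G X hX D₁ D₂).deg (Sum.inr b) =
          D₂.deg b + if D₂.home none = b then 1 else 0 := rfl
        rw [hd] at h3
        have hn : D₂.home none = b := by
          by_contra hn
          rw [if_neg hn] at h3
          omega
        rw [if_pos hn] at h3
        obtain ⟨i₀, hi₀⟩ := hex O (by omega)
        have hz₀ : ∀ i, O i → Function.update z' i₀ none i = z' i := by
          intro i hi
          rw [Function.update_of_ne]
          rintro rfl
          exact hi₀ hi
        obtain ⟨ρ, τ, p, q, c, t, ht, hs⟩ := ih₂ h₂ inferInstance (fun i => O i ∨ i = i₀)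
          (Function.update z' i₀ none) b (by
            rintro i (hi | rfl)
            · rw [hz₀ i hi, hz'b i hi]
            · rw [Function.update_self, hn]) (by
            rintro i j hij (hi | rfl) (hj | rfl)
            · rw [hz₀ i hi, hz₀ j hj]
              exact hz'i i j hij hi hj
            · rw [hz₀ i hi, Function.update_self, hz's i hi]
              exact Option.some_ne_none _
            · rw [hz₀ j hj, Function.update_self, hz's j hj]
              exact (Option.some_ne_none _).symm
            · exact absurd rfl hij) (by
            rw [hins O i₀ hi₀]
            omega)
        have hp₀ := ht i₀ (Or.inr rfl)
        rw [Function.update_self] at hp₀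
        obtain ⟨u, v, hu, hv, huv, k1, k2, k3⟩ := Good.exists_leg D₁ h₁ inferInstance none
        obtain ⟨⟨u, huX⟩, rfl⟩ := Option.ne_none_iff_exists'.1 hu
        obtain ⟨⟨v, hvX⟩, rfl⟩ := Option.ne_none_iff_exists'.1 hv
        have hacc : ∀ w (hw : w ∈ X), (splitPart G X).Adj none (some ⟨w, hw⟩) ↔
            ∃ y ∈ Xᶜ, G.Adj y w := by
          intro w hw
          change (∃ y, y ∉ X ∧ G.Adj w y) ↔ _
          simp only [Set.mem_compl_iff, G.adj_comm w]
        obtain ⟨τ', p', q', c', t', ht'⟩ := t.join hX'.compl hi₀ hp₀.1 (fun h => h huX)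
          (fun h => h hvX) ((hacc _ huX).1 k1)
          ((hacc _ hvX).symm.trans k2) (fun h => huv (by subst h; rfl)) k3 (hp₀.2 ▸ h₁₂.symm)
        refine ⟨ρ, τ', p', q', c', t', fun i hi => ⟨?_, ?_⟩, hs⟩
        · have := (ht i (Or.inl hi)).1
          rw [hz₀ i hi, hz's i hi] at this
          exact ht' i _ this
        · rw [(ht i (Or.inl hi)).2, hz₀ i hi, hz'r i hi]

end Decomposition


namespace Tripod

variable {V : Type*} {G : SimpleGraph V} {ρ τ : Fin 3 → Role} {p q : Fin 3 → V} {c : V} {P : Set V}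

/-- If a vertex set of cut-rank at most one separates the two vertices of a leg of a tripod, then
it does not separate any two vertices of the two other legs. -/
lemma sameSide_of_mem (t : Tripod G (fun _ => False) ρ τ p q c) (hP : CutComplete G P)
    {i j k : Fin 3} (hij : j ≠ i) (hik : k ≠ i) (hjk : j ≠ k) (hp : p i ∈ P) (hq : q i ∉ P) :
    (q j ∈ P ↔ p j ∈ P) ∧ (p j ∈ P ↔ p k ∈ P) := by
  have hs : ∀ u w, u ∈ P → w ∉ P → ((G.Adj (p i) (q i) ∧ G.Adj u w) ↔
      (G.Adj (p i) w ∧ G.Adj (q i) u)) := by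
    intro u w hu hw
    constructor
    · rintro ⟨h1, h2⟩
      exact ⟨hP hp hu hq hw h1 h2, (hP hu hp hw hq h2 h1).symm⟩
    · rintro ⟨h1, h2⟩
      exact ⟨hP hp hu hw hq h1 h2.symm, hP hu hp hq hw h2.symm h1⟩
  have hss : ∀ u w, ¬ ((G.Adj (p i) (q i) ∧ G.Adj u w) ↔ (G.Adj (p i) w ∧ G.Adj (q i) u)) →
      ¬ ((G.Adj (p i) (q i) ∧ G.Adj u w) ↔ (G.Adj (p i) u ∧ G.Adj (q i) w)) →
      (u ∈ P ↔ w ∈ P) := by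
    intro u w h1 h2
    constructor
    · intro hu
      by_contra hw
      exact h1 (hs u w hu hw)
    · intro hw
      by_contra hu
      exact h2 (by rw [G.adj_comm u w]; exact hs w u hw hu)
  -- the vertices of a leg whose far graph is a star centred at its marker
  have hl : τ i = .centre → G.Adj (q i) (p k) → G.Adj (p j) (q j) → ¬ G.Adj (p k) (q j) →
      G.Adj (p i) (p k) → (p j ∈ P ↔ p k ∈ P) → (q j ∈ P ↔ p j ∈ P) := by
    intro _ h1 h2 h3 h4 h5
    constructor
    · intro h6
      by_contra h7
      exact h3 (hP h6 hp h7 (fun h8 => h7 (h5.2 h8)) h2.symm h4).symm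
    · intro h6
      by_contra h7
      exact h3 (hP (h5.1 h6) h6 hq h7 h1.symm h2)
  have hf : ¬ False := id
  have a1 := (t.pp i j hij.symm).2
  have a2 := (t.pp i k hik.symm).2
  have a3 := (t.pp j k hjk).2
  have b1 := (t.pq i j hij.symm hf).2
  have b3 := (t.pq k j hjk.symm hf).2
  have b3' := (G.adj_comm _ _).trans b3
  have c1 := (G.adj_comm _ _).trans (t.pq j i hij hf).2
  have c2 := (G.adj_comm _ _).trans (t.pq k i hik hf).2
  have d1 := (t.qq i j hij.symm hf hf).2
  obtain ⟨-, e1, f1⟩ := t.leg i hf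
  obtain ⟨-, e2, f2⟩ := t.leg j hf
  have e2' := (G.adj_comm _ _).trans e2
  have k1 := hss (p j) (p k)
  have k2 := hss (q j) (p j)
  have k3 := hss (q j) (p k)
  have k4 := hss c (p j)
  have k5 := hss c (p k)
  simp only [a1, a2, a3, b1, b3, b3', c1, c2, d1, e1, e2, e2'] at k1 k2 k3 k4 k5 hl
  rcases t.roles with h | ⟨l, h, h'⟩ | h
  · rw [h] at f1 f2
    clear * - h k1 k2 k3 f1 f2 hl
    cases hτi : τ i <;> cases hτj : τ j <;> simp [h, hτi, hτj, Role.Compatible] at * <;> tauto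
  · have hl3 : l = i ∨ l = j ∨ l = k := by
      clear * - hij hik hjk
      omega
    rcases hl3 with rfl | rfl | rfl
    · have h1 := h' j hij
      have h2 := h' k hik
      rw [h] at f1
      rw [h1] at f2
      clear * - h h1 h2 k1 k2 k3 f1 f2 hl
      cases hτi : τ l <;> cases hτj : τ j <;>
        simp [h, h1, h2, hτi, hτj, Role.Compatible] at * <;> tauto
    · have h1 := h' i hij.symm
      have h2 := h' k hjk.symm
      rw [h1] at f1
      rw [h] at f2
      clear * - h h1 h2 k1 k2 k3 f1 f2 hl
      cases hτi : τ i <;> cases hτj : τ l <;>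
        simp [h, h1, h2, hτi, hτj, Role.Compatible] at * <;> tauto
    · have h1 := h' i hik.symm
      have h2 := h' j hjk
      rw [h1] at f1
      rw [h2] at f2
      clear * - h h1 h2 k1 k2 k3 f1 f2 hl
      cases hτi : τ i <;> cases hτj : τ j <;>
        simp [h, h1, h2, hτi, hτj, Role.Compatible] at * <;> tauto
  · obtain ⟨-, h1, h2⟩ := t.centre h i
    obtain ⟨-, h3, h4⟩ := t.centre h j
    obtain ⟨-, h5, h6⟩ := t.centre h k
    have g1 := (h2 hf).2
    have g2 := (h4 hf).2
    rw [h] at f1 f2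
    rw [G.adj_comm] at h1 g1
    simp only [h1, g1, h3, h5] at k4 k5
    clear * - h k1 k2 k3 k4 k5 f1 f2
    cases hτi : τ i <;> cases hτj : τ j <;> simp [h, hτi, hτj, Role.Compatible] at * <;> tauto

/-- A graph with a tripod has no linear layout. -/
lemma not_hasLinearLayout (t : Tripod G (fun _ => False) ρ τ p q c) : ¬ HasLinearLayout G := by
  rintro ⟨L, _, σ, hσ, hL⟩
  have hpq : ∀ i, σ (p i) ≠ σ (q i) := fun i => hσ.ne (t.leg i id).1
  have hcut : ∀ i, CutComplete G {v | σ v ≤ min (σ (p i)) (σ (q i))} := by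
    intro i x₁ hx₁ x₂ hx₂ y₁ hy₁ y₂ hy₂
    have hy₁ := not_le.1 hy₁
    have hy₂ := not_le.1 hy₂
    exact hL x₁ x₂ y₁ y₂ (lt_of_le_of_lt hx₁ hy₁) (lt_of_le_of_lt hx₁ hy₂)
      (lt_of_le_of_lt hx₂ hy₁) (lt_of_le_of_lt hx₂ hy₂)
  have hside : ∀ i j k, j ≠ i → k ≠ i → j ≠ k →
      (σ (q j) ≤ min (σ (p i)) (σ (q i)) ↔ σ (p j) ≤ min (σ (p i)) (σ (q i))) ∧
      (σ (p j) ≤ min (σ (p i)) (σ (q i)) ↔ σ (p k) ≤ min (σ (p i)) (σ (q i))) := by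
    intro i j k hij hik hjk
    rcases lt_or_gt_of_ne (hpq i) with h | h
    · exact t.sameSide_of_mem (hcut i) hij hik hjk (by simp [h.le]) (by simp [h])
    · obtain ⟨h1, h2⟩ := t.sameSide_of_mem (hcut i).compl hij hik hjk (by simp [h]) (by simp [h.le])
      exact ⟨not_iff_not.1 h1, not_iff_not.1 h2⟩
  have hup : ∀ i j, j ≠ i → σ (p j) ≤ min (σ (p i)) (σ (q i)) →
      ¬ σ (p i) ≤ min (σ (p j)) (σ (q j)) := by
    intro i j hij h1 h2
    have := (hside i j (3 - i - j) hij (by omega) (by omega)).1.2 h1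
    have := (hside j i (3 - i - j) hij.symm (by omega) (by omega)).1.2 h2
    simp only [le_min_iff] at *
    exact hpq i (le_antisymm (by order) (by order))
  have hdown : ∀ i j, j ≠ i → ¬ σ (p j) ≤ min (σ (p i)) (σ (q i)) →
      σ (p i) ≤ min (σ (p j)) (σ (q j)) := by
    intro i j hij h1
    by_contra h2
    have h3 := (not_congr (hside i j (3 - i - j) hij (by omega) (by omega)).1).2 h1
    have h4 := (not_congr (hside j i (3 - i - j) hij.symm (by omega) (by omega)).1).2 h2
    simp only [not_le] at h1 h2 h3 h4
    exact lt_asymm (lt_min h1 h3) (lt_min h2 h4)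
  have h01 := (hside 0 1 2 (by decide) (by decide) (by decide)).2
  have h12 := (hside 1 0 2 (by decide) (by decide) (by decide)).2
  have h20 := (hside 2 0 1 (by decide) (by decide) (by decide)).2
  have u01 := hup 0 1 (by decide)
  have u02 := hup 0 2 (by decide)
  have u12 := hup 1 2 (by decide)
  have d01 := hdown 0 1 (by decide)
  have d02 := hdown 0 2 (by decide)
  have d12 := hdown 1 2 (by decide)
  tauto

lemma restrict (t : Tripod G (fun _ => False) ρ τ p q c) : ∃ W : Set V,
    ¬ HasLinearLayout (G.induce W) ∧ W.ncard ≤ 7 ∧ ((∃ i, ρ i ≠ .leaf) → W.ncard ≤ 6) := by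
  have hr : ∀ f : Fin 3 → V, (Set.range f).Finite ∧ (Set.range f).ncard ≤ 3 := by
    intro f
    refine ⟨Set.finite_range f, ?_⟩
    rw [← Set.image_univ]
    simpa using Set.ncard_image_le (f := f) (s := Set.univ)
  have h6 : (Set.range p ∪ Set.range q).ncard ≤ 6 :=
    (Set.ncard_union_le _ _).trans (Nat.add_le_add (hr p).2 (hr q).2)
  have key : ∀ W : Set V, Set.range p ∪ Set.range q ⊆ W → ∀ c ∈ W,
      Tripod G (fun _ => False) ρ τ p q c → ¬ HasLinearLayout (G.induce W) := by
    intro W hW c hc t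
    have : Tripod (G.induce W) (fun _ => False) ρ τ (fun i => ⟨p i, hW (Or.inl ⟨i, rfl⟩)⟩)
        (fun i => ⟨q i, hW (Or.inr ⟨i, rfl⟩)⟩) ⟨c, hc⟩ :=
      (map_iff (Embedding.induce W)).1 t
    exact this.not_hasLinearLayout
  by_cases hρ : ∃ i, ρ i ≠ .leaf
  · refine ⟨Set.range p ∪ Set.range q, key _ subset_rfl (p 0) (Or.inl ⟨0, rfl⟩)
      ⟨t.pp, t.pq, t.qq, t.leg, t.roles, fun h => ?_⟩, h6.trans (by norm_num), fun _ => h6⟩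
    obtain ⟨i, hi⟩ := hρ
    exact absurd (h i) hi
  · exact ⟨insert c (Set.range p ∪ Set.range q), key _ (Set.subset_insert _ _) c
      (Set.mem_insert _ _) t, (Set.ncard_insert_le _ _).trans (by omega), fun h => absurd h hρ⟩

end Tripod

namespace Decomposition

variable {V : Type u} [Finite V] {G : SimpleGraph V} {D : Decomposition G} {b : D.Block}

lemma Good.exists_tripod_of_deg (h : D.Good) (hb : 3 ≤ D.deg b) : ∃ ρ τ p q c,
    Tripod G (fun _ => False) ρ τ p q c ∧ ((∀ i, ρ i = .leaf) → 4 ≤ D.size b) := by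
  have : 2 ≤ Nat.card V := by
    have := D.sum_size inferInstance
    have h2 := Finset.sum_le_sum fun b (_ : b ∈ Finset.univ) => three_le_size D inferInstance h b
    simp at h2
    have : Fintype.card D.Block ≠ 0 := (Fintype.card_pos_iff.2 ⟨b⟩).ne'
    omega
  have : Nonempty V := Finite.card_pos_iff.1 (by omega)
  obtain ⟨ρ, τ, p, q, c, t, -, hs⟩ := Good.exists_tripod D h inferInstance (fun _ => False)
    (fun _ => Classical.arbitrary V) b (by simp) (by simp) (by omega)
  exact ⟨ρ, τ, p, q, c, t, hs⟩

/-- The blocks of the canonical decomposition of a graph with a linear layout have at most two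
neighbours. -/
lemma Good.deg_le_two (h : D.Good) (hG : HasLinearLayout G) (b : D.Block) : D.deg b ≤ 2 := by
  by_contra! hb
  obtain ⟨ρ, τ, p, q, c, t, -⟩ := h.exists_tripod_of_deg hb
  exact t.not_hasLinearLayout hG

/-- If a block of a canonical decomposition has three neighbours, but all proper induced subgraphs
have linear layouts, then there are at most four blocks. -/
lemma Good.card_block_le (h : D.Good) (hb : 3 ≤ D.deg b)
    (hG : ∀ S : Set V, S ≠ Set.univ → HasLinearLayout (G.induce S)) :
    Fintype.card D.Block ≤ 4 := by
  classical
  obtain ⟨ρ, τ, p, q, c, t, hs⟩ := h.exists_tripod_of_deg hb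
  obtain ⟨W, hW, h7, h6⟩ := t.restrict
  have hW' : W = Set.univ := by
    by_contra hne
    exact hW (hG W hne)
  rw [hW', Set.ncard_univ] at h7 h6
  have h1 := D.sum_size inferInstance
  have h3 := fun b => three_le_size D inferInstance h b
  by_cases hρ : ∃ i, ρ i ≠ .leaf
  · have h2 := Finset.sum_le_sum fun b (_ : b ∈ Finset.univ) => h3 b
    simp at h2
    have := h6 hρ
    omega
  · push Not at hρ
    have h2 : ∑ c, (3 + if c = b then 1 else 0) ≤ ∑ c, D.size c := by
      refine Finset.sum_le_sum fun c _ => ?_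
      split_ifs with hc
      · exact hc ▸ hs hρ
      · exact h3 c
    simp [Finset.sum_add_distrib] at h2
    omega

/-- A decomposition with at most four blocks, one of which has three neighbours, has a star with
three leaves as its tree. -/
lemma nonempty_tree_iso_star {V : Type u} {G : SimpleGraph V} {D : Decomposition G} {b : D.Block}
    (hb : 3 ≤ D.deg b) (h4 : Fintype.card D.Block ≤ 4) :
    Nonempty (D.tree ≃g completeBipartiteGraph (Fin 1) (Fin 3)) := by
  classical
  have hsub : D.tree.neighborSet b ⊆ {b}ᶜ := by
    rintro c hc rfl
    exact D.tree.irrefl hc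
  have hcard : ({b}ᶜ : Set D.Block).ncard = Fintype.card D.Block - 1 := by
    rw [Set.ncard_compl, Set.ncard_singleton, Nat.card_eq_fintype_card]
  have hle := Set.ncard_le_ncard hsub
  have hdeg := D.deg_eq_ncard b
  have hN : D.tree.neighborSet b = {b}ᶜ := Set.eq_of_subset_of_ncard_le hsub (by omega)
  have hadj : ∀ c, c ≠ b → D.tree.Adj b c := fun c hc => by
    have : c ∈ D.tree.neighborSet b := hN ▸ hc
    exact this
  have hpos : ∀ c, c ≠ b → 1 ≤ D.deg c := by
    intro c hc
    rw [deg_eq_ncard, Nat.one_le_iff_ne_zero]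
    refine Set.ncard_ne_zero_of_mem (a := b) ?_
    exact (hadj c hc).symm
  have hone : ∀ c, c ≠ b → D.deg c < 2 := by
    intro c hc
    by_contra! h2
    have h1 : ∑ d, ((1 + if d = b then 2 else 0) + if d = c then 1 else 0) ≤ ∑ d, D.deg d := by
      refine Finset.sum_le_sum fun d _ => ?_
      by_cases hdb : d = b
      · subst hdb
        simpa [hc.symm] using hb
      · by_cases hdc : d = c
        · subst hdc
          simpa [hdb] using h2
        · simpa [hdb, hdc] using hpos d hdb
    have h3 := D.sum_deg
    simp [Finset.sum_add_distrib] at h1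
    omega
  have hnadj : ∀ c d, c ≠ b → d ≠ b → ¬ D.tree.Adj c d := by
    intro c d hc hd hcd
    have h1 : ({b, d} : Set D.Block).ncard ≤ D.deg c := by
      rw [deg_eq_ncard]
      refine Set.ncard_le_ncard ?_
      rintro _ (rfl | rfl)
      · exact (hadj c hc).symm
      · exact hcd
    rw [Set.ncard_pair hd.symm] at h1
    exact absurd (hone c hc) (by omega)
  have h3 : Nat.card ({b}ᶜ : Set D.Block) = 3 := by
    rw [Nat.card_coe_set_eq]
    omega
  let e := (Finite.equivFinOfCardEq h3).symm
  have he : ∀ i, (e i : D.Block) ≠ b := fun i => (e i).2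
  refine ⟨Iso.symm ⟨Equiv.ofBijective (Sum.elim (fun _ => b) fun i => e i) ⟨?_, ?_⟩, ?_⟩⟩
  · rintro (i | i) (j | j) hij
    · rw [Subsingleton.elim i j]
    · exact absurd hij.symm (he j)
    · exact absurd hij (he i)
    · exact congrArg _ (e.injective (Subtype.ext hij))
  · intro c
    by_cases hc : c = b
    · exact ⟨Sum.inl 0, hc.symm⟩
    · exact ⟨Sum.inr (e.symm ⟨c, hc⟩), by simp⟩
  · rintro (i | i) (j | j)
    · exact iff_of_false D.tree.irrefl (by simp)
    · exact iff_of_true (hadj _ (he j)) (by simp)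
    · exact iff_of_true (hadj _ (he i)).symm (by simp)
    · exact iff_of_false (hnadj _ _ (he i) (he j)) (by simp)

end Decomposition

lemma hasLinearLayout_of_card_le_two {V : Type u} [Finite V] {G : SimpleGraph V}
    (h : Nat.card V ≤ 2) : HasLinearLayout G := by
  let e := Finite.equivFin V
  refine ⟨Fin (Nat.card V), inferInstance, e, e.injective, ?_⟩
  intro x₁ x₂ y₁ y₂ h1 h2 h3 h4 a1 a2
  have : y₁ = y₂ := e.injective (by omega)
  exact this ▸ a1

variable {V : Type u} [Finite V] {G : SimpleGraph V}

lemma isPrime_of_card_le_two (h : Nat.card V ≤ 2) : IsPrime G := by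
  intro X hX
  obtain ⟨h1, h2, -⟩ := isSplit_iff.1 hX
  have h3 := Set.ncard_add_ncard_compl X
  have h4 := (Set.one_lt_ncard_iff_nontrivial (s := X)).2 h1
  have h5 := (Set.one_lt_ncard_iff_nontrivial (s := Xᶜ)).2 h2
  omega

/-- A connected distance-hereditary graph has a linear layout if and only if its split
decomposition tree is a path. -/
lemma hasPathAsSplitTree_iff (hG : IsDistanceHereditary G) (hc : G.Connected) :
    HasPathAsSplitTree G ↔ HasLinearLayout G := by
  rcases le_or_gt (Nat.card V) 2 with h2 | h3
  · refine iff_of_true ?_ (hasLinearLayout_of_card_le_two h2)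
    obtain ⟨n, hn⟩ := (Decomposition.single G).exists_tree_iso_path (fun _ => Nat.zero_le _)
    refine ⟨n, hc, Decomposition.single G, ⟨fun b => Or.inl ?_, ?_, ?_⟩, hn⟩
    · exact (isPrime_of_card_le_two h2).iso (Decomposition.blockSingleIso G)
    · intro v w hvw
      exact absurd hvw id
    · intro v w hvw
      exact absurd hvw id
  · constructor
    · rintro ⟨n, -, D, hD, ⟨e⟩⟩
      exact D.hasLinearLayout (fun b => D.deg_le_two_of_tree_iso_path e b)
        (blocks_isDegenerate D inferInstance hG hc h3 hD.blocks)
    · intro h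
      obtain ⟨D, hD⟩ := exists_good (Nat.card V - 3) hG hc (by omega)
      obtain ⟨n, hn⟩ := D.exists_tree_iso_path (hD.deg_le_two h)
      exact ⟨n, hc, D, hD.isCanonical, hn⟩

/-- A distance-hereditary graph has a linear layout if and only if the split decomposition trees
of its connected components are paths. -/
lemma hasLinearLayout_iff_forall_component (hG : IsDistanceHereditary G) :
    HasLinearLayout G ↔ ∀ C : G.ConnectedComponent, HasPathAsSplitTree C.toSimpleGraph := by
  have h : ∀ C : G.ConnectedComponent,
      HasPathAsSplitTree C.toSimpleGraph ↔ HasLinearLayout C.toSimpleGraph := fun C =>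
    hasPathAsSplitTree_iff (hG.of_embedding (Embedding.induce _)) C.connected_toSimpleGraph
  simp only [h]
  exact ⟨fun h C => h.of_embedding (Embedding.induce _), hasLinearLayout_of_components⟩

/-- Linear rank-width `2`, for graphs whose proper induced subgraphs have linear layouts. -/
lemma linearRankWidth_eq_two_iff
    (hG : ∀ S : Set V, S ≠ Set.univ → HasLinearLayout (G.induce S)) :
    linearRankWidth G = 2 ↔ ¬ HasLinearLayout G := by
  rw [← linearRankWidth_le_one_iff, not_le]
  constructor
  · intro h
    rw [h]
    exact Nat.one_lt_ofNat
  · intro h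
    refine le_antisymm ?_ (Order.add_one_le_of_lt h)
    rcases isEmpty_or_nonempty V with hV | ⟨⟨a⟩⟩
    · have : HasLinearLayout G := hasLinearLayout_of_card_le_two (by simp)
      exact absurd (linearRankWidth_le_one_iff.2 this) h.not_ge
    · exact linearRankWidth_le_two a (hG _ (fun h => (h ▸ Set.mem_univ a : a ∈ ({a}ᶜ : Set V)) rfl))

/-- For graphs whose proper induced subgraphs have linear layouts, the split decomposition tree is
a star with three leaves if and only if there is no linear layout. -/
lemma hasThreeLeafStarAsSplitTree_iff (hdh : IsDistanceHereditary G)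
    (hG : ∀ S : Set V, S ≠ Set.univ → HasLinearLayout (G.induce S)) :
    HasThreeLeafStarAsSplitTree G ↔ ¬ HasLinearLayout G := by
  constructor
  · rintro ⟨hc, D, hD, ⟨e⟩⟩ hL
    have h3 : 3 ≤ Nat.card V := by
      by_contra! h
      cases D with
      | single =>
        have h1 := e.symm.injective (Subsingleton.elim (e.symm (Sum.inl 0)) (e.symm (Sum.inr 0)))
        cases h1
      | split _ X hX D₁ D₂ => exact isPrime_of_card_le_two (by omega) X hX
    have hgood := hD.good (blocks_isDegenerate D inferInstance hdh hc h3 hD.blocks)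
    have h1 := hgood.deg_le_two hL (e.symm (Sum.inl 0))
    rw [D.deg_of_tree_iso e, e.apply_symm_apply] at h1
    have h2 : (completeBipartiteGraph (Fin 1) (Fin 3)).neighborSet (Sum.inl 0) =
        Set.range Sum.inr := by
      ext (x | x) <;> simp
    rw [h2, ← Set.image_univ, Set.ncard_image_of_injective _ Sum.inr_injective] at h1
    simp at h1
  · intro hL
    have h3 : 2 < Nat.card V := by
      by_contra! h
      exact hL (hasLinearLayout_of_card_le_two h)
    have hc : G.Connected := by
      have hcon : ∃ C : G.ConnectedComponent, ¬ HasLinearLayout C.toSimpleGraph := by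
        by_contra! h
        exact hL (hasLinearLayout_of_components h)
      obtain ⟨C, hC⟩ := hcon
      have hs : C.supp = Set.univ := by
        by_contra hs
        exact hC (hG _ hs)
      have h1 := C.connected_toSimpleGraph
      have e : G.induce C.supp ≃g G := by
        rw [hs]
        exact induceUnivIso G
      exact e.connected_iff.1 h1
    obtain ⟨D, hD⟩ := exists_good (Nat.card V - 3) hdh hc (by omega)
    have hb : ∃ b, 2 < D.deg b := by
      by_contra! h
      exact hL (D.hasLinearLayout h hD.1)
    obtain ⟨b, hb⟩ := hb
    exact ⟨hc, D, hD.isCanonical, D.nonempty_tree_iso_star hb (hD.card_block_le hb hG)⟩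

end SplitTree

theorem mainTheorem3 {V : Type u} [Finite V] (G : SimpleGraph V)
    (hG : SplitTree.IsDistanceHereditary G) :
    SplitTree.IsObstruction G ↔
      SplitTree.HasThreeLeafStarAsSplitTree G ∧
        ∀ S : Set V, S ≠ Set.univ → ∀ C : (G.induce S).ConnectedComponent,
          SplitTree.HasPathAsSplitTree C.toSimpleGraph := by
  have h1 : ∀ S : Set V, (∀ C : (G.induce S).ConnectedComponent,
      SplitTree.HasPathAsSplitTree C.toSimpleGraph) ↔ SplitTree.HasLinearLayout (G.induce S) :=
    fun S => (SplitTree.hasLinearLayout_iff_forall_component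
      (hG.of_embedding (SimpleGraph.Embedding.induce S))).symm
  simp only [h1, SplitTree.IsObstruction, SplitTree.linearRankWidth_le_one_iff]
  refine and_congr_left fun h => ?_
  rw [SplitTree.linearRankWidth_eq_two_iff h, SplitTree.hasThreeLeafStarAsSplitTree_iff hG h]
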